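/- **Theorem 4.1.** Let $\Bbbk$ be a field and $n\ge 1$ an integer. 2-categories and their constructions are understood up to the usual coherence isomorphisms. *The 2-categories $\mathcal A_n$ and $\mathcal B_n$.* Each has a single object $\mathtt i$; the 1-morphisms are the elements of the symmetric group $S_n$, composed as in $S_n$, with the identity permutation as identity 1-morphism. In $\mathcal A_n$, a 2-morphism $\pi\to\sigma$ is a binary relation $\alpha$ on $\{1,\dots,n\}$ contained in the graphs of both $\pi$ and $\sigma$; vertical composition is intersection, horizontal composition is composition of binary relations, and the identity 2-morphism of $\pi$ is the graph of $\pi$. In $\mathcal B_n$, a 2-morphism $\pi\to\sigma$ is a partition $\alpha$ of $\{1,\dots,n,1',\dots,n'\}$, each of whose parts meets both $\{1,\dots,n\}$ and $\{1',\dots,n'\}$ (a *propagating* partition), which is coarser than or equal to both $\pi$ and $\sigma$, where $\pi$ is identified with the partition with parts $\{i,\pi(i)'\}$; vertical composition is the join of partitions, horizontal composition is the usual composition in the partition monoid, and the identity 2-morphism of $\pi$ is $\pi$. *Ordered monoids.* For a monoid $S$ with a partial order for which multiplication is monotone on both sides, $\mathcal S_S$ has one object, the elements of $S$ as 1-morphisms,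 composed by multiplication, exactly one 2-morphism $s\to t$ if $s\le t$ and none otherwise. $IS_n$ is the monoid of bijections between subsets of $\{1,\dots,n\}$. $I_n^*$ is the monoid of propagating partitions of $\{1,\dots,n,1',\dots,n'\}$, and $F_n^*\subseteq I_n^*$ is the submonoid of all $\sigma\varepsilon$ with $\sigma\in S_n$ and $\varepsilon\in I_n^*$ idempotent. Both $IS_n$ and $F_n^*$ carry the natural partial order: $s\le t$ if and only if $s=\varepsilon t$ for some idempotent $\varepsilon$ of the monoid. *Linearisation.* For a 2-category $\mathcal C$ with finitely many 2-morphisms, $\Bbbk\mathcal C$ has the same objects, and $\Bbbk\mathcal C(\mathtt i,\mathtt j)$ is obtained from $\mathcal C(\mathtt i,\mathtt j)$ by replacing morphism sets by the $\Bbbk$-vector spaces they freely span, then passing to finite formal direct sums with matrices as morphisms, then to the idempotent completion; compositions are extended biadditively and $\Bbbk$-bilinearly. A $\Bbbk$-linear category is *finitary* if it is additive, idempotent split and Krull–Schmidt, with finitely many indecomposables up to isomorphism and finite dimensional morphism spaces. A 2-category with $\Bbbk$-linear morphism categories and $\Bbbk$-bilinear compositions is *prefinitary* if it has finitely many objects and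 finitary morphism categories, and *finitary* if moreover all identity 1-morphisms are indecomposable. For $\mathcal C$ prefinitary, $\overline{\mathcal C}$ is the following 2-category. Its objects are pairs $(\mathtt i,\varepsilon)$ with $\mathtt i$ an object of $\mathcal C$ and $\varepsilon$ a primitive idempotent of the algebra $\mathrm{End}_{\mathcal C}(\mathbb 1_{\mathtt i})$. The 1-morphisms $(\mathtt i,\varepsilon)\to(\mathtt j,\varepsilon')$ are the 1-morphisms $F:\mathtt i\to\mathtt j$ of $\mathcal C$ with $\varepsilon'\circ_0\mathrm{id}_F\circ_0\varepsilon=\mathrm{id}_F$, and the 2-morphisms are all 2-morphisms of $\mathcal C$ between them, so that $\mathrm{Hom}_{\overline{\mathcal C}}(F,G)=\varepsilon'\circ_0\mathrm{Hom}_{\mathcal C}(F,G)\circ_0\varepsilon$. Compositions are those of $\mathcal C$, and the identity 1-morphism of $(\mathtt i,\varepsilon)$ is the direct summand of $\mathbb 1_{\mathtt i}$ cut out by $\varepsilon$. A finitary 2-category $\mathcal C$ is *fiat* if there is a weak anti-involution $\star$ on $\mathcal C$, that is an object preserving $\Bbbk$-linear pseudofunctor $\mathcal C\to\mathcal C^{\mathrm{co},\mathrm{op}}$,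 reversing the direction of both 1- and 2-morphisms, with an isomorphism of pseudofunctors $\mathrm{Id}\cong\star\star$, such that for every 1-morphism $F:\mathtt i\to\mathtt j$ there are 2-morphisms $\mathbb 1_{\mathtt i}\to F^\star F$ and $FF^\star\to\mathbb 1_{\mathtt j}$ satisfying the two triangle identities of an adjunction. Then: (i) both $\overline{\Bbbk\mathcal A_n}$ and $\overline{\Bbbk\mathcal B_n}$ are fiat; (ii) both $\Bbbk\mathcal S_{IS_n}$ and $\Bbbk\mathcal S_{F_n^*}$ are finitary; $\Bbbk\mathcal S_{IS_n}$ is not fiat, and $\Bbbk\mathcal S_{F_n^*}$ is not fiat if $n\ge 2$. -/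

import Mathlib

open CategoryTheory CategoryTheory.Limits CategoryTheory.Bicategory

noncomputable section

namespace TwoCat

universe w v u

/-! ### Horizontal composition of 2-morphisms -/

section HComp

variable {B : Type u} [Bicategory.{w, v} B]

/-- Horizontal composition of 2-morphisms, in diagrammatic order:
for `η : f ⟶ f'` in `B(a, b)` and `θ : g ⟶ g'` in `B(b, c)` this is what is usually written
`θ ∘₀ η : g f ⟶ g' f'`. -/
def hh {a b c : B} {f f' : a ⟶ b} {g g' : b ⟶ c} (η : f ⟶ f') (θ : g ⟶ g') :
    f ≫ g ⟶ f' ≫ g' :=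
  η ▷ g ≫ f' ◁ θ

lemma hh_id {a b c : B} (f : a ⟶ b) (g : b ⟶ c) : hh (𝟙 f) (𝟙 g) = 𝟙 (f ≫ g) := by
  simp [hh]

lemma hh_comp {a b c : B} {f f' f'' : a ⟶ b} {g g' g'' : b ⟶ c} (η : f ⟶ f') (η' : f' ⟶ f'')
    (θ : g ⟶ g') (θ' : g' ⟶ g'') : hh (η ≫ η') (θ ≫ θ') = hh η θ ≫ hh η' θ' := by
  simp only [hh, comp_whiskerRight, whiskerLeft_comp, Category.assoc]
  rw [← whisker_exchange_assoc]

lemma hh_assoc {a b c d : B} {f f' : a ⟶ b} {g g' : b ⟶ c} {h h' : c ⟶ d}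
    (η : f ⟶ f') (θ : g ⟶ g') (κ : h ⟶ h') :
    hh (hh η θ) κ ≫ (α_ f' g' h').hom = (α_ f g h).hom ≫ hh η (hh θ κ) := by
  simp [hh]

lemma hh_leftUnitor {a b : B} {f f' : a ⟶ b} (η : f ⟶ f') :
    hh (𝟙 (𝟙 a)) η ≫ (λ_ f').hom = (λ_ f).hom ≫ η := by
  simp [hh]

lemma hh_rightUnitor {a b : B} {f f' : a ⟶ b} (η : f ⟶ f') :
    hh η (𝟙 (𝟙 b)) ≫ (ρ_ f').hom = (ρ_ f).hom ≫ η := by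
  simp [hh]

lemma hh_pentagon {a b c d e : B} (f : a ⟶ b) (g : b ⟶ c) (h : c ⟶ d) (i : d ⟶ e) :
    hh (α_ f g h).hom (𝟙 i) ≫ (α_ f (g ≫ h) i).hom ≫ hh (𝟙 f) (α_ g h i).hom =
      (α_ (f ≫ g) h i).hom ≫ (α_ f g (h ≫ i)).hom := by
  simp [hh]

lemma hh_triangle {a b c : B} (f : a ⟶ b) (g : b ⟶ c) :
    (α_ f (𝟙 b) g).hom ≫ hh (𝟙 f) (λ_ g).hom = hh (ρ_ f).hom (𝟙 g) := by
  simp [hh]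

/-- Horizontal composition of invertible 2-morphisms. -/
def hhIso {a b c : B} {f f' : a ⟶ b} {g g' : b ⟶ c} (η : f ≅ f') (θ : g ≅ g') :
    f ≫ g ≅ f' ≫ g' where
  hom := hh η.hom θ.hom
  inv := hh η.inv θ.inv
  hom_inv_id := by rw [← hh_comp, Iso.hom_inv_id, Iso.hom_inv_id, hh_id]
  inv_hom_id := by rw [← hh_comp, Iso.inv_hom_id, Iso.inv_hom_id, hh_id]

end HComp

/-- A bicategory given by a bifunctorial horizontal composition `hc` of 2-morphisms together with
natural, coherent associators and unitors. -/
abbrev bicategoryOfHComp (B : Type u) [CategoryStruct.{v} B]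
    (homCat : ∀ a b : B, Category.{w} (a ⟶ b))
    (hc : ∀ {a b c : B} {f f' : a ⟶ b} {g g' : b ⟶ c}, (f ⟶ f') → (g ⟶ g') →
      ((f ≫ g) ⟶ (f' ≫ g')))
    (as : ∀ {a b c d : B} (f : a ⟶ b) (g : b ⟶ c) (h : c ⟶ d), (f ≫ g) ≫ h ≅ f ≫ g ≫ h)
    (lu : ∀ {a b : B} (f : a ⟶ b), 𝟙 a ≫ f ≅ f)
    (ru : ∀ {a b : B} (f : a ⟶ b), f ≫ 𝟙 b ≅ f)
    (hc_id : ∀ {a b c : B} (f : a ⟶ b) (g : b ⟶ c), hc (𝟙 f) (𝟙 g) = 𝟙 (f ≫ g))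
    (hc_comp : ∀ {a b c : B} {f f' f'' : a ⟶ b} {g g' g'' : b ⟶ c} (η : f ⟶ f') (η' : f' ⟶ f'')
      (θ : g ⟶ g') (θ' : g' ⟶ g''), hc (η ≫ η') (θ ≫ θ') = hc η θ ≫ hc η' θ')
    (as_nat : ∀ {a b c d : B} {f f' : a ⟶ b} {g g' : b ⟶ c} {h h' : c ⟶ d}
      (η : f ⟶ f') (θ : g ⟶ g') (κ : h ⟶ h'),
      hc (hc η θ) κ ≫ (as f' g' h').hom = (as f g h).hom ≫ hc η (hc θ κ))
    (lu_nat : ∀ {a b : B} {f f' : a ⟶ b} (η : f ⟶ f'),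
      hc (𝟙 (𝟙 a)) η ≫ (lu f').hom = (lu f).hom ≫ η)
    (ru_nat : ∀ {a b : B} {f f' : a ⟶ b} (η : f ⟶ f'),
      hc η (𝟙 (𝟙 b)) ≫ (ru f').hom = (ru f).hom ≫ η)
    (pent : ∀ {a b c d e : B} (f : a ⟶ b) (g : b ⟶ c) (h : c ⟶ d) (i : d ⟶ e),
      hc (as f g h).hom (𝟙 i) ≫ (as f (g ≫ h) i).hom ≫ hc (𝟙 f) (as g h i).hom =
        (as (f ≫ g) h i).hom ≫ (as f g (h ≫ i)).hom)
    (tri : ∀ {a b c : B} (f : a ⟶ b) (g : b ⟶ c),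
      (as f (𝟙 b) g).hom ≫ hc (𝟙 f) (lu g).hom = hc (ru f).hom (𝟙 g)) :
    Bicategory.{w, v} B where
  homCategory := homCat
  whiskerLeft f _ _ η := hc (𝟙 f) η
  whiskerRight η g := hc η (𝟙 g)
  associator f g h := as f g h
  leftUnitor f := lu f
  rightUnitor f := ru f
  whiskerLeft_id f g := hc_id f g
  whiskerLeft_comp f g h i η θ := by rw [← hc_comp, Category.comp_id]
  id_whiskerLeft η := by rw [← Category.assoc, ← lu_nat, Category.assoc, Iso.hom_inv_id,
    Category.comp_id]
  comp_whiskerLeft f g h h' η := by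
    rw [← Category.assoc, ← as_nat, Category.assoc, Iso.hom_inv_id, Category.comp_id, hc_id]
  id_whiskerRight f g := hc_id f g
  comp_whiskerRight η θ i := by rw [← hc_comp, Category.comp_id]
  whiskerRight_id η := by rw [← Category.assoc, ← ru_nat, Category.assoc, Iso.hom_inv_id,
    Category.comp_id]
  whiskerRight_comp η g h := by
    rw [as_nat, ← Category.assoc, Iso.inv_hom_id, Category.id_comp, hc_id]
  whisker_assoc f g g' η h := by
    rw [← Category.assoc, ← as_nat, Category.assoc, Iso.hom_inv_id, Category.comp_id]
  whisker_exchange η θ := by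
    rw [← hc_comp, ← hc_comp, Category.comp_id, Category.id_comp, Category.comp_id,
      Category.id_comp]
  pentagon f g h i := pent f g h i
  triangle f g := tri f g

/-! ### Linear 2-categories -/

/-- The morphism categories are preadditive and horizontal composition is biadditive. -/
class PreaddBicategory (B : Type u) [Bicategory.{w, v} B] where
  homPreadditive (a b : B) : Preadditive (a ⟶ b)
  whiskerLeft_add {a b c : B} (f : a ⟶ b) {g h : b ⟶ c} (η θ : g ⟶ h) :
    f ◁ (η + θ) = f ◁ η + f ◁ θ
  add_whiskerRight {a b c : B} {f g : a ⟶ b} (η θ : f ⟶ g) (h : b ⟶ c) :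
    (η + θ) ▷ h = η ▷ h + θ ▷ h

attribute [reducible, instance] PreaddBicategory.homPreadditive

/-- The morphism categories are `k`-linear and horizontal composition is `k`-bilinear. -/
class LinBicategory (k : Type*) [Field k] (B : Type u) [Bicategory.{w, v} B]
    [PreaddBicategory B] where
  homLinear (a b : B) : Linear k (a ⟶ b)
  whiskerLeft_smul {a b c : B} (f : a ⟶ b) {g h : b ⟶ c} (r : k) (η : g ⟶ h) :
    f ◁ (r • η) = r • (f ◁ η)
  smul_whiskerRight {a b c : B} {f g : a ⟶ b} (r : k) (η : f ⟶ g) (h : b ⟶ c) :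
    (r • η) ▷ h = r • (η ▷ h)

attribute [reducible, instance] LinBicategory.homLinear

section Bilinear

variable {B : Type u} [Bicategory.{w, v} B] [PreaddBicategory B] {a b c : B}

lemma hh_add_left {f f' : a ⟶ b} {g g' : b ⟶ c} (η η' : f ⟶ f') (θ : g ⟶ g') :
    hh (η + η') θ = hh η θ + hh η' θ := by
  simp [hh, PreaddBicategory.add_whiskerRight]

lemma hh_add_right {f f' : a ⟶ b} {g g' : b ⟶ c} (η : f ⟶ f') (θ θ' : g ⟶ g') :
    hh η (θ + θ') = hh η θ + hh η θ' := by
  simp [hh, PreaddBicategory.whiskerLeft_add]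

lemma hh_zero_left {f f' : a ⟶ b} {g g' : b ⟶ c} (θ : g ⟶ g') :
    hh (0 : f ⟶ f') θ = 0 := by
  simpa using hh_add_left (0 : f ⟶ f') 0 θ

lemma hh_zero_right {f f' : a ⟶ b} {g g' : b ⟶ c} (η : f ⟶ f') :
    hh η (0 : g ⟶ g') = 0 := by
  simpa using hh_add_right η (0 : g ⟶ g') 0

lemma hh_sum_left {f f' : a ⟶ b} {g g' : b ⟶ c} {ι : Type*} (s : Finset ι) (η : ι → (f ⟶ f'))
    (θ : g ⟶ g') : hh (∑ i ∈ s, η i) θ = ∑ i ∈ s, hh (η i) θ :=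
  map_sum (AddMonoidHom.mk' (fun η : f ⟶ f' => hh η θ) fun _ _ => hh_add_left _ _ _) η s

lemma hh_sum_right {f f' : a ⟶ b} {g g' : b ⟶ c} {ι : Type*} (s : Finset ι) (η : f ⟶ f')
    (θ : ι → (g ⟶ g')) : hh η (∑ i ∈ s, θ i) = ∑ i ∈ s, hh η (θ i) :=
  map_sum (AddMonoidHom.mk' (fun θ : g ⟶ g' => hh η θ) fun _ _ => hh_add_right _ _ _) θ s

lemma hh_smul_left (k : Type*) [Field k] [LinBicategory k B] {f f' : a ⟶ b} {g g' : b ⟶ c}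
    (r : k) (η : f ⟶ f') (θ : g ⟶ g') : hh (r • η) θ = r • hh η θ := by
  simp [hh, LinBicategory.smul_whiskerRight]

lemma hh_smul_right (k : Type*) [Field k] [LinBicategory k B] {f f' : a ⟶ b} {g g' : b ⟶ c}
    (r : k) (η : f ⟶ f') (θ : g ⟶ g') : hh η (r • θ) = r • hh η θ := by
  simp [hh, LinBicategory.whiskerLeft_smul]

end Bilinear

/-! ### Linearisation -/

/-- The objects of the `k`-linearisation of a category `C`; they are the objects of `C`. -/
structure Lin (k : Type*) (C : Type*) where
  /-- the underlying object -/
  as : C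

namespace Lin

variable {k : Type*} [Field k] {C : Type*} [Category C]

/-- Morphisms of the `k`-linearisation are formal `k`-linear combinations of morphisms of `C`,
composed `k`-bilinearly. -/
instance : Category (Lin k C) where
  Hom X Y := (X.as ⟶ Y.as) →₀ k
  id X := Finsupp.single (𝟙 X.as) 1
  comp f g := f.sum fun f' s => g.sum fun g' t => Finsupp.single (f' ≫ g') (s * t)
  id_comp f := by simp [-Finsupp.single_mul]
  comp_id f := by simp [-Finsupp.single_mul]
  assoc f g h := by
    simp [-Finsupp.single_mul, Finsupp.sum_sum_index, add_mul, mul_add, Category.assoc, mul_assoc]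

lemma comp_def {X Y Z : Lin k C} (f : X ⟶ Y) (g : Y ⟶ Z) :
    f ≫ g = Finsupp.sum f fun f' s => Finsupp.sum g fun g' t =>
      Finsupp.single (f' ≫ g') (s * t) := rfl

instance : Preadditive (Lin k C) where
  homGroup X Y := inferInstanceAs (AddCommGroup ((X.as ⟶ Y.as) →₀ k))
  add_comp X Y Z f f' g :=
    Finsupp.sum_add_index' (N := (X.as ⟶ Z.as) →₀ k) (by simp)
      (by simp [-Finsupp.single_mul, add_mul])
  comp_add X Y Z f g g' :=
    (Finsupp.sum_congr (N := (X.as ⟶ Z.as) →₀ k) fun x _ => Finsupp.sum_add_index' (N := (X.as ⟶ Z.as) →₀ k) (by simp)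
      (by simp [-Finsupp.single_mul, mul_add])).trans
      (Finsupp.sum_add (N := (X.as ⟶ Z.as) →₀ k))

instance : Linear k (Lin k C) where
  homModule X Y := inferInstanceAs (Module k ((X.as ⟶ Y.as) →₀ k))
  smul_comp X Y Z r f g := by
    refine (Finsupp.sum_smul_index (M := (X.as ⟶ Z.as) →₀ k) (by simp)).trans ?_
    refine Eq.trans ?_ (Finsupp.smul_sum (M := (X.as ⟶ Z.as) →₀ k)).symm
    refine Finsupp.sum_congr fun x _ => ?_
    refine Eq.trans ?_ (Finsupp.smul_sum (M := (X.as ⟶ Z.as) →₀ k)).symm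
    refine Finsupp.sum_congr fun y _ => ?_
    rw [mul_assoc, Finsupp.smul_single, smul_eq_mul]
  comp_smul X Y Z f r g := by
    refine Eq.trans ?_ (Finsupp.smul_sum (M := (X.as ⟶ Z.as) →₀ k)).symm
    refine Finsupp.sum_congr fun x _ => ?_
    refine (Finsupp.sum_smul_index (M := (X.as ⟶ Z.as) →₀ k) (by simp)).trans ?_
    refine Eq.trans ?_ (Finsupp.smul_sum (M := (X.as ⟶ Z.as) →₀ k)).symm
    refine Finsupp.sum_congr fun y _ => ?_
    rw [mul_left_comm, Finsupp.smul_single, smul_eq_mul]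

/-- A morphism of `C` as a morphism of the linearisation (an element of the standard basis). -/
def bas {X Y : Lin k C} (x : X.as ⟶ Y.as) : X ⟶ Y := Finsupp.single x (1 : k)

lemma induction {X Y : Lin k C} {p : (X ⟶ Y) → Prop} (η : X ⟶ Y) (zero : p 0)
    (add : ∀ a b, p a → p b → p (a + b)) (basis : ∀ (r : k) (x : X.as ⟶ Y.as), p (r • bas x)) :
    p η := by
  refine Finsupp.induction_linear (motive := p) η zero add ?_
  intro x r
  have : r • Finsupp.single x (1 : k) = Finsupp.single x r := by simp
  exact this ▸ basis r x

lemma bas_comp {X Y Z : Lin k C} (x : X.as ⟶ Y.as) (y : Y.as ⟶ Z.as) :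
    (bas x : X ⟶ Y) ≫ (bas y : Y ⟶ Z) = bas (x ≫ y) := by
  simp [-Finsupp.single_mul, comp_def, bas]

lemma bas_id (X : Lin k C) : (bas (𝟙 X.as) : X ⟶ X) = 𝟙 X := rfl

/-- The isomorphism given by an isomorphism of the original category. -/
def basIso {X Y : Lin k C} (e : X.as ≅ Y.as) : X ≅ Y where
  hom := bas e.hom
  inv := bas e.inv
  hom_inv_id := by rw [bas_comp, e.hom_inv_id, bas_id]
  inv_hom_id := by rw [bas_comp, e.inv_hom_id, bas_id]

variable {D : Type*} [Category D]

/-- The linear extension of a map between sets of morphisms. -/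
def ext {X Y : Lin k C} {X' Y' : Lin k D} (F : (X.as ⟶ Y.as) → (X'.as ⟶ Y'.as)) (η : X ⟶ Y) :
    X' ⟶ Y' :=
  Finsupp.mapDomain F η

section

variable {X Y : Lin k C} {X' Y' : Lin k D} (F : (X.as ⟶ Y.as) → (X'.as ⟶ Y'.as))

lemma ext_bas (x : X.as ⟶ Y.as) : ext F (bas x : X ⟶ Y) = bas (F x) := Finsupp.mapDomain_single

lemma ext_add (η θ : X ⟶ Y) : ext F (η + θ) = ext F η + ext F θ := Finsupp.mapDomain_add

lemma ext_zero : ext F (0 : X ⟶ Y) = 0 := Finsupp.mapDomain_zero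

lemma ext_smul (r : k) (η : X ⟶ Y) : ext F (r • η) = r • ext F η := Finsupp.mapDomain_smul r η

end

lemma ext_comp {X Y Z : Lin k C} {X' Y' Z' : Lin k D} (F : (X.as ⟶ Y.as) → (X'.as ⟶ Y'.as))
    (G : (Y.as ⟶ Z.as) → (Y'.as ⟶ Z'.as)) (H : (X.as ⟶ Z.as) → (X'.as ⟶ Z'.as))
    (h : ∀ x y, H (x ≫ y) = F x ≫ G y) (η : X ⟶ Y) (θ : Y ⟶ Z) :
    ext H (η ≫ θ) = ext F η ≫ ext G θ := by
  induction η using induction with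
  | zero => simp [ext_zero]
  | add a b ha hb => simp [ext_add, ha, hb, Preadditive.add_comp]
  | basis r x =>
    induction θ using induction with
    | zero => simp [ext_zero]
    | add a b ha hb => simp only [ext_add, ha, hb, Preadditive.comp_add]
    | basis s y => simp [ext_smul, ext_bas, bas_comp, h]

end Lin

/-- The 2-category with the same objects and 1-morphisms as `B` whose morphism categories are the
`k`-linearisations of those of `B`. -/
structure LinBicat (k : Type*) (B : Type u) where
  /-- the underlying object -/
  as : B

namespace LinBicat

open Lin

variable {k : Type*} [Field k] {B : Type u} [Bicategory.{w, v} B]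

instance : CategoryStruct.{v} (LinBicat k B) where
  Hom a b := Lin k (a.as ⟶ b.as)
  id a := ⟨𝟙 a.as⟩
  comp f g := ⟨f.as ≫ g.as⟩

instance (a b : LinBicat k B) : Category (a ⟶ b) :=
  inferInstanceAs (Category (Lin k (a.as ⟶ b.as)))
instance (a b : LinBicat k B) : Preadditive (a ⟶ b) :=
  inferInstanceAs (Preadditive (Lin k (a.as ⟶ b.as)))
instance (a b : LinBicat k B) : Linear k (a ⟶ b) :=
  inferInstanceAs (Linear k (Lin k (a.as ⟶ b.as)))

variable {a b c d : LinBicat k B}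

/-- Left whiskering: the linear extension of left whiskering in `B`. -/
def wl (f : a ⟶ b) {g h : b ⟶ c} (η : g ⟶ h) : f ≫ g ⟶ f ≫ h :=
  ext (X' := f ≫ g) (Y' := f ≫ h) (fun x => f.as ◁ x) η

/-- Right whiskering: the linear extension of right whiskering in `B`. -/
def wr {f g : a ⟶ b} (η : f ⟶ g) (h : b ⟶ c) : f ≫ h ⟶ g ≫ h :=
  ext (X' := f ≫ h) (Y' := g ≫ h) (fun x => x ▷ h.as) η

lemma wl_bas (f : a ⟶ b) {g h : b ⟶ c} (x : g.as ⟶ h.as) :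
    wl f (bas x : g ⟶ h) = (bas (f.as ◁ x) : f ≫ g ⟶ f ≫ h) := ext_bas _ _
lemma wr_bas {f g : a ⟶ b} (x : f.as ⟶ g.as) (h : b ⟶ c) :
    wr (bas x : f ⟶ g) h = (bas (x ▷ h.as) : f ≫ h ⟶ g ≫ h) := ext_bas _ _
lemma wl_add (f : a ⟶ b) {g h : b ⟶ c} (η θ : g ⟶ h) : wl f (η + θ) = wl f η + wl f θ :=
  ext_add _ _ _
lemma wr_add {f g : a ⟶ b} (η θ : f ⟶ g) (h : b ⟶ c) : wr (η + θ) h = wr η h + wr θ h :=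
  ext_add _ _ _
lemma wl_smul (f : a ⟶ b) {g h : b ⟶ c} (r : k) (η : g ⟶ h) : wl f (r • η) = r • wl f η :=
  ext_smul _ _ _
lemma wr_smul {f g : a ⟶ b} (r : k) (η : f ⟶ g) (h : b ⟶ c) : wr (r • η) h = r • wr η h :=
  ext_smul _ _ _
lemma wl_zero (f : a ⟶ b) {g h : b ⟶ c} : wl f (0 : g ⟶ h) = 0 := ext_zero _
lemma wr_zero {f g : a ⟶ b} (h : b ⟶ c) : wr (0 : f ⟶ g) h = 0 := ext_zero _

lemma bc {f g h : a ⟶ b} (x : f.as ⟶ g.as) (y : g.as ⟶ h.as) :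
    (bas x : f ⟶ g) ≫ (bas y : g ⟶ h) = bas (x ≫ y) := bas_comp x y

lemma ind {f g : a ⟶ b} {p : (f ⟶ g) → Prop} (η : f ⟶ g) (zero : p 0)
    (add : ∀ x y, p x → p y → p (x + y)) (basis : ∀ (r : k) (x : f.as ⟶ g.as), p (r • bas x)) :
    p η := Lin.induction η zero add basis

/-- The 2-isomorphism given by a 2-isomorphism of `B`. -/
def bIso {f g : a ⟶ b} (e : f.as ≅ g.as) : f ≅ g := Lin.basIso e

lemma bIso_hom {f g : a ⟶ b} (e : f.as ≅ g.as) : (bIso e).hom = (bas e.hom : f ⟶ g) := rfl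
lemma bIso_inv {f g : a ⟶ b} (e : f.as ≅ g.as) : (bIso e).inv = (bas e.inv : g ⟶ f) := rfl

/-- The associator, induced from `B`. -/
def as' (f : a ⟶ b) (g : b ⟶ c) (h : c ⟶ d) : (f ≫ g) ≫ h ≅ f ≫ g ≫ h :=
  bIso (f := (f ≫ g) ≫ h) (g := f ≫ g ≫ h) (α_ f.as g.as h.as)

/-- The left unitor, induced from `B`. -/
def lu (f : a ⟶ b) : 𝟙 a ≫ f ≅ f := bIso (f := 𝟙 a ≫ f) (g := f) (λ_ f.as)

/-- The right unitor, induced from `B`. -/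
def ru (f : a ⟶ b) : f ≫ 𝟙 b ≅ f := bIso (f := f ≫ 𝟙 b) (g := f) (ρ_ f.as)

lemma id_wl {f g : a ⟶ b} (η : f ⟶ g) : wl (𝟙 a) η = (lu f).hom ≫ η ≫ (lu g).inv := by
  induction η using ind with
  | zero => simp [wl_zero]
  | add x y hx hy => simp only [wl_add, hx, hy, Preadditive.comp_add, Preadditive.add_comp]
  | basis r x =>
    rw [wl_smul, wl_bas, lu, lu, bIso_hom, bIso_inv, Linear.smul_comp, Linear.comp_smul, bc, bc]
    exact congrArg (fun t => r • bas t) (id_whiskerLeft x)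

lemma wr_id {f g : a ⟶ b} (η : f ⟶ g) : wr η (𝟙 b) = (ru f).hom ≫ η ≫ (ru g).inv := by
  induction η using ind with
  | zero => simp [wr_zero]
  | add x y hx hy => simp only [wr_add, hx, hy, Preadditive.comp_add, Preadditive.add_comp]
  | basis r x =>
    rw [wr_smul, wr_bas, ru, ru, bIso_hom, bIso_inv, Linear.smul_comp, Linear.comp_smul, bc, bc]
    exact congrArg (fun t => r • bas t) (whiskerRight_id x)

lemma comp_wl (f : a ⟶ b) (g : b ⟶ c) {h h' : c ⟶ d} (η : h ⟶ h') :
    wl (f ≫ g) η = (as' f g h).hom ≫ wl f (wl g η) ≫ (as' f g h').inv := by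
  induction η using ind with
  | zero => simp [wl_zero]
  | add x y hx hy => simp only [wl_add, hx, hy, Preadditive.comp_add, Preadditive.add_comp]
  | basis r x =>
    rw [wl_smul, wl_smul, wl_smul, wl_bas, wl_bas, as', as', bIso_hom, bIso_inv,
      Linear.smul_comp, Linear.comp_smul]
    refine congrArg (fun t => r • t) ?_
    refine (congrArg bas (comp_whiskerLeft f.as g.as x)).trans ?_
    refine Eq.trans ?_ (congrArg (_ ≫ ·) (congrArg (· ≫ _) (wl_bas f (g.as ◁ x)).symm))
    exact ((congrArg (_ ≫ ·) (bc _ _)).trans (bc _ _)).symm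

lemma wr_comp {f f' : a ⟶ b} (η : f ⟶ f') (g : b ⟶ c) (h : c ⟶ d) :
    wr η (g ≫ h) = (as' f g h).inv ≫ wr (wr η g) h ≫ (as' f' g h).hom := by
  induction η using ind with
  | zero => simp [wr_zero]
  | add x y hx hy => simp only [wr_add, hx, hy, Preadditive.comp_add, Preadditive.add_comp]
  | basis r x =>
    rw [wr_smul, wr_smul, wr_smul, wr_bas, wr_bas, as', as', bIso_hom, bIso_inv,
      Linear.smul_comp, Linear.comp_smul]
    refine congrArg (fun t => r • t) ?_
    refine (congrArg bas (whiskerRight_comp x g.as h.as)).trans ?_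
    refine Eq.trans ?_ (congrArg (_ ≫ ·) (congrArg (· ≫ _) (wr_bas (x ▷ g.as) h).symm))
    exact ((congrArg (_ ≫ ·) (bc _ _)).trans (bc _ _)).symm

lemma w_assoc (f : a ⟶ b) {g g' : b ⟶ c} (η : g ⟶ g') (h : c ⟶ d) :
    wr (wl f η) h = (as' f g h).hom ≫ wl f (wr η h) ≫ (as' f g' h).inv := by
  induction η using ind with
  | zero => simp [wr_zero, wl_zero]
  | add x y hx hy =>
    simp only [wl_add, wr_add, hx, hy, Preadditive.comp_add, Preadditive.add_comp]
  | basis r x =>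
    rw [wl_smul, wr_smul, wr_smul, wl_smul, wr_bas, wl_bas, as', as', bIso_hom, bIso_inv,
      Linear.smul_comp, Linear.comp_smul]
    refine congrArg (fun t => r • t) ?_
    refine (wr_bas (f.as ◁ x) h).trans ?_
    refine (congrArg bas (whisker_assoc f.as x h.as)).trans ?_
    refine Eq.trans ?_ (congrArg (_ ≫ ·) (congrArg (· ≫ _) (wl_bas f (x ▷ h.as)).symm))
    exact ((congrArg (_ ≫ ·) (bc _ _)).trans (bc _ _)).symm

lemma w_exchange {f g : a ⟶ b} {h i : b ⟶ c} (η : f ⟶ g) (θ : h ⟶ i) :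
    wl f θ ≫ wr η i = wr η h ≫ wl g θ := by
  induction η using ind with
  | zero => simp [wr_zero]
  | add x y hx hy => simp only [wr_add, hx, hy, Preadditive.comp_add, Preadditive.add_comp]
  | basis r x =>
    induction θ using ind with
    | zero => simp [wl_zero]
    | add x y hx hy => simp only [wl_add, hx, hy, Preadditive.comp_add, Preadditive.add_comp]
    | basis s y =>
      rw [wl_smul, wl_smul, wr_smul, wr_smul, wl_bas, wl_bas, wr_bas, wr_bas, Linear.smul_comp,
        Linear.smul_comp, Linear.comp_smul, Linear.comp_smul, smul_comm]
      refine congrArg (fun t => r • s • t) ?_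
      exact ((bc _ _).trans (congrArg bas (whisker_exchange x y))).trans (bc _ _).symm

instance : Bicategory (LinBicat k B) where
  homCategory a b := inferInstance
  whiskerLeft f _ _ η := wl f η
  whiskerRight η h := wr η h
  associator := as'
  leftUnitor := lu
  rightUnitor := ru
  whiskerLeft_id f g := (wl_bas f (𝟙 g.as)).trans (by rw [whiskerLeft_id]; rfl)
  id_whiskerRight f g := (wr_bas (𝟙 f.as) g).trans (by rw [id_whiskerRight]; rfl)
  whiskerLeft_comp f g h i η θ := ext_comp _ _ _ (fun x y => whiskerLeft_comp _ x y) η θ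
  comp_whiskerRight η θ i := ext_comp _ _ _ (fun x y => comp_whiskerRight x y _) η θ
  id_whiskerLeft := id_wl
  whiskerRight_id := wr_id
  comp_whiskerLeft := comp_wl
  whiskerRight_comp := wr_comp
  whisker_assoc := w_assoc
  whisker_exchange := w_exchange
  pentagon f g h i := by
    refine (congrArg₂ (fun s t => s ≫ _ ≫ t) (wr_bas _ _) (wl_bas _ _)).trans ?_
    refine ((congrArg (_ ≫ ·) (bc _ _)).trans (bc _ _)).trans ?_
    exact (congrArg bas (pentagon f.as g.as h.as i.as)).trans (bc _ _).symm
  triangle f g := by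
    refine (congrArg (_ ≫ ·) (wl_bas _ _)).trans ?_
    refine (bc _ _).trans ?_
    exact (congrArg bas (triangle f.as g.as)).trans (wr_bas _ _).symm

instance : PreaddBicategory (LinBicat k B) where
  homPreadditive _ _ := inferInstance
  whiskerLeft_add f _ _ η θ := wl_add f η θ
  add_whiskerRight η θ h := wr_add η θ h

instance : LinBicategory k (LinBicat k B) where
  homLinear _ _ := inferInstance
  whiskerLeft_smul f _ _ r η := wl_smul f r η
  smul_whiskerRight r η h := wr_smul r η h

end LinBicat

/-! ### Additive envelopes of the morphism categories -/

namespace MatAux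

section

variable {C : Type*} [Category C] [Preadditive C]

/-- Scalar multiplication of matrices of morphisms. -/
instance matLinear (k : Type*) [Field k] [Linear k C] : Linear k (Mat_ C) where
  homModule M N := inferInstanceAs (Module k (∀ (i : M.ι) (j : N.ι), M.X i ⟶ N.X j))
  smul_comp X Y Z r f g := by
    ext i j
    refine Eq.trans ?_ (Finset.smul_sum (r := r) (f := fun l => f i l ≫ g l j)).symm
    exact Finset.sum_congr rfl fun l _ => Linear.smul_comp _ _ _ r (f i l) (g l j)
  comp_smul X Y Z f r g := by
    ext i j
    refine Eq.trans ?_ (Finset.smul_sum (r := r) (f := fun l => f i l ≫ g l j)).symm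
    exact Finset.sum_congr rfl fun l _ => Linear.comp_smul _ _ _ (f i l) r (g l j)

lemma smul_apply (k : Type*) [Field k] [Linear k C] {M N : Mat_ C} (r : k) (f : M ⟶ N) (i j) :
    (r • f) i j = r • f i j := rfl

open Classical in
/-- The matrix of a bijection of index sets with isomorphisms between corresponding entries. -/
def rhom {M N : Mat_ C} (e : M.ι ≃ N.ι) (φ : ∀ i, M.X i ≅ N.X (e i)) : M ⟶ N := fun i j =>
  if h : e i = j then (φ i).hom ≫ eqToHom (congrArg N.X h) else 0

open Classical in
/-- The inverse of `rhom`. -/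
def rinv {M N : Mat_ C} (e : M.ι ≃ N.ι) (φ : ∀ i, M.X i ≅ N.X (e i)) : N ⟶ M := fun j i =>
  if h : e i = j then eqToHom (congrArg N.X h.symm) ≫ (φ i).inv else 0

variable {M N K : Mat_ C} (e : M.ι ≃ N.ι) (φ : ∀ i, M.X i ≅ N.X (e i))

lemma rhom_self (i : M.ι) : rhom e φ i (e i) = (φ i).hom := by simp [rhom]

lemma rhom_ne {i : M.ι} {j : N.ι} (h : e i ≠ j) : rhom e φ i j = 0 := by simp [rhom, h]

lemma rinv_self (i : M.ι) : rinv e φ (e i) i = (φ i).inv := by simp [rinv]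

lemma rinv_ne {i : M.ι} {j : N.ι} (h : e i ≠ j) : rinv e φ j i = 0 := by simp [rinv, h]

lemma rhom_comp (f : N ⟶ K) (i : M.ι) (l : K.ι) : (rhom e φ ≫ f) i l = (φ i).hom ≫ f (e i) l := by
  rw [Mat_.comp_apply, Finset.sum_eq_single (e i), rhom_self]
  · intro j _ hj
    rw [rhom_ne e φ hj.symm, zero_comp]
  · simp

lemma comp_rhom (f : K ⟶ M) (l : K.ι) (i : M.ι) : (f ≫ rhom e φ) l (e i) = f l i ≫ (φ i).hom := by
  rw [Mat_.comp_apply, Finset.sum_eq_single i, rhom_self]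
  · intro j _ hj
    rw [rhom_ne e φ (fun h => hj (e.injective h)), comp_zero]
  · simp

lemma comp_rinv (f : K ⟶ N) (l : K.ι) (i : M.ι) :
    (f ≫ rinv e φ) l i = f l (e i) ≫ (φ i).inv := by
  rw [Mat_.comp_apply, Finset.sum_eq_single (e i), rinv_self]
  · intro j _ hj
    rw [rinv_ne e φ hj.symm, comp_zero]
  · simp

lemma ext_right {f g : K ⟶ N} (h : ∀ l i, f l (e i) = g l (e i)) : f = g := by
  ext l j
  obtain ⟨i, rfl⟩ := e.surjective j
  exact h l i

/-- Re-indexing a formal direct sum along a bijection, replacing summands by isomorphic ones. -/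
def reindex : M ≅ N where
  hom := rhom e φ
  inv := rinv e φ
  hom_inv_id := by
    ext i j
    rw [comp_rinv]
    by_cases h : i = j
    · subst h
      rw [rhom_self, Iso.hom_inv_id, Mat_.id_apply_self]
    · rw [rhom_ne e φ (fun h' => h (e.injective h')), zero_comp, Mat_.id_apply_of_ne _ _ _ h]
  inv_hom_id := by
    ext l j
    obtain ⟨i, rfl⟩ := e.surjective j
    obtain ⟨l, rfl⟩ := e.surjective l
    rw [comp_rhom]
    by_cases h : i = l
    · subst h
      rw [rinv_self, Iso.inv_hom_id, Mat_.id_apply_self]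
    · rw [rinv_ne e φ (fun h' => h (e.injective h')), zero_comp,
        Mat_.id_apply_of_ne _ _ _ (fun h' => h (e.injective h').symm)]

lemma reindex_hom : (reindex e φ).hom = rhom e φ := rfl

end

end MatAux

/-- The 2-category with the same objects as `B` whose morphism categories are the additive
envelopes of those of `B`: 1-morphisms are finite formal direct sums of 1-morphisms of `B`, and
2-morphisms are matrices of 2-morphisms of `B`. -/
structure MatBicat (B : Type u) where
  /-- the underlying object -/
  as : B

namespace MatBicat

open MatAux

variable {B : Type u} [Bicategory.{w, v} B] [PreaddBicategory B]

/-- Horizontal composition of 1-morphisms is distributive over formal direct sums. -/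
instance : CategoryStruct.{max 1 v} (MatBicat B) where
  Hom a b := Mat_ (a.as ⟶ b.as)
  id a := ⟨PUnit.{1}, fun _ => 𝟙 a.as⟩
  comp F G := ⟨F.ι × G.ι, fun p => F.X p.1 ≫ G.X p.2⟩

instance (a b : MatBicat B) : Category (a ⟶ b) :=
  inferInstanceAs (Category (Mat_ (a.as ⟶ b.as)))
instance (a b : MatBicat B) : Preadditive (a ⟶ b) :=
  inferInstanceAs (Preadditive (Mat_ (a.as ⟶ b.as)))
instance (k : Type*) [Field k] [LinBicategory k B] (a b : MatBicat B) : Linear k (a ⟶ b) :=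
  inferInstanceAs (Linear k (Mat_ (a.as ⟶ b.as)))

variable {a b c d e : MatBicat B}

/-- The entry of a matrix of 2-morphisms. -/
def entry {F G : a ⟶ b} (η : F ⟶ G) (i : F.ι) (j : G.ι) : F.X i ⟶ G.X j := η i j

/-- Horizontal composition of 2-morphisms: the Kronecker product of matrices. -/
def hc {F F' : a ⟶ b} {G G' : b ⟶ c} (η : F ⟶ F') (θ : G ⟶ G') : F ≫ G ⟶ F' ≫ G' :=
  fun p q => hh (entry η p.1 q.1) (entry θ p.2 q.2)

lemma entry_hc {F F' : a ⟶ b} {G G' : b ⟶ c} (η : F ⟶ F') (θ : G ⟶ G') (p : F.ι × G.ι)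
    (q : F'.ι × G'.ι) : entry (hc η θ) p q = hh (entry η p.1 q.1) (entry θ p.2 q.2) := rfl

lemma ext_entry {F G : a ⟶ b} {η θ : F ⟶ G} (h : ∀ i j, entry η i j = entry θ i j) : η = θ :=
  Mat_.hom_ext _ _ h

lemma entry_comp {F G H : a ⟶ b} (η : F ⟶ G) (θ : G ⟶ H) (i : F.ι) (j : H.ι) :
    entry (η ≫ θ) i j = ∑ l : G.ι, entry η i l ≫ entry θ l j := rfl

lemma entry_id (F : a ⟶ b) (i : F.ι) : entry (𝟙 F) i i = 𝟙 (F.X i) := Mat_.id_apply_self _ _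

lemma entry_id_ne (F : a ⟶ b) {i j : F.ι} (h : i ≠ j) : entry (𝟙 F) i j = 0 :=
  Mat_.id_apply_of_ne _ _ _ h

lemma hc_id (F : a ⟶ b) (G : b ⟶ c) : hc (𝟙 F) (𝟙 G) = 𝟙 (F ≫ G) := by
  refine ext_entry ?_
  rintro ⟨i, j⟩ ⟨i', j'⟩
  rw [entry_hc]
  by_cases h : i = i'
  · subst h
    by_cases h : j = j'
    · subst h
      rw [entry_id, entry_id, hh_id]
      exact (entry_id (F ≫ G) (i, j)).symm
    · refine Eq.trans ?_ (entry_id_ne (F ≫ G) (i := (i, j)) (j := (i, j'))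
        fun h' => h (congrArg Prod.snd h')).symm
      rw [entry_id_ne G h, hh_zero_right]
  · refine Eq.trans ?_ (entry_id_ne (F ≫ G) (i := (i, j)) (j := (i', j'))
      fun h' => h (congrArg Prod.fst h')).symm
    rw [entry_id_ne F h, hh_zero_left]

lemma hc_comp {F F' F'' : a ⟶ b} {G G' G'' : b ⟶ c} (η : F ⟶ F') (η' : F' ⟶ F'')
    (θ : G ⟶ G') (θ' : G' ⟶ G'') : hc (η ≫ η') (θ ≫ θ') = hc η θ ≫ hc η' θ' := by
  refine ext_entry fun p q => ?_
  rw [entry_hc, entry_comp, entry_comp, entry_comp, hh_sum_left]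
  simp only [hh_sum_right, hh_comp]
  exact (Fintype.sum_prod_type' (fun i j => hh (entry η p.1 i) (entry θ p.2 j) ≫
    hh (entry η' i q.1) (entry θ' j q.2))).symm

/-- Re-indexing formal direct sums of 1-morphisms. -/
def ri {F G : a ⟶ b} (e : F.ι ≃ G.ι) (φ : ∀ i, F.X i ≅ G.X (e i)) : F ≅ G := reindex e φ

section

variable {F G H : a ⟶ b} (e : F.ι ≃ G.ι) (φ : ∀ i, F.X i ≅ G.X (e i))

lemma ri_self (i : F.ι) : entry (ri e φ).hom i (e i) = (φ i).hom := rhom_self e φ i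

lemma ri_ne {i : F.ι} {j : G.ι} (h : e i ≠ j) : entry (ri e φ).hom i j = 0 := rhom_ne e φ h

lemma ri_comp (η : G ⟶ H) (i : F.ι) (l : H.ι) :
    entry ((ri e φ).hom ≫ η) i l = (φ i).hom ≫ entry η (e i) l := rhom_comp e φ η i l

lemma comp_ri (η : H ⟶ F) (l : H.ι) (i : F.ι) :
    entry (η ≫ (ri e φ).hom) l (e i) = entry η l i ≫ (φ i).hom := comp_rhom e φ η l i

lemma id_eq_ri (F : a ⟶ b) : 𝟙 F = (ri (Equiv.refl F.ι) fun i => Iso.refl (F.X i)).hom := by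
  refine ext_entry fun i j => ?_
  by_cases h : i = j
  · subst h
    exact (entry_id F i).trans (ri_self (F := F) (G := F) (Equiv.refl F.ι) (fun i => Iso.refl (F.X i)) i).symm
  · exact (entry_id_ne F h).trans (ri_ne (F := F) (G := F) (Equiv.refl F.ι) (fun i => Iso.refl (F.X i)) h).symm

lemma hc_ri {F G : a ⟶ b} {F' G' : b ⟶ c} (e : F.ι ≃ G.ι) (φ : ∀ i, F.X i ≅ G.X (e i))
    (e' : F'.ι ≃ G'.ι) (φ' : ∀ i, F'.X i ≅ G'.X (e' i)) :
    hc (ri e φ).hom (ri e' φ').hom =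
      (ri (F := F ≫ F') (G := G ≫ G') (Equiv.prodCongr e e')
        fun p => hhIso (φ p.1) (φ' p.2)).hom := by
  refine ext_entry ?_
  rintro ⟨i, j⟩ ⟨i', j'⟩
  obtain ⟨i', rfl⟩ := e.surjective i'
  obtain ⟨j', rfl⟩ := e'.surjective j'
  rw [entry_hc]
  by_cases h : i = i'
  · subst h
    by_cases h : j = j'
    · subst h
      refine Eq.trans ?_ (ri_self (F := F ≫ F') (G := G ≫ G') (Equiv.prodCongr e e')
        (fun p => hhIso (φ p.1) (φ' p.2)) (i, j)).symm
      rw [ri_self, ri_self]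
      rfl
    · refine Eq.trans ?_ (ri_ne (F := F ≫ F') (G := G ≫ G') (Equiv.prodCongr e e')
        (fun p => hhIso (φ p.1) (φ' p.2)) (i := (i, j)) (j := (e i, e' j'))
        fun h' => h (e'.injective (congrArg Prod.snd h'))).symm
      rw [ri_ne e' φ' (fun h' => h (e'.injective h')), hh_zero_right]
  · refine Eq.trans ?_ (ri_ne (F := F ≫ F') (G := G ≫ G') (Equiv.prodCongr e e')
        (fun p => hhIso (φ p.1) (φ' p.2)) (i := (i, j)) (j := (e i', e' j'))
        fun h' => h (e.injective (congrArg Prod.fst h'))).symm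
    rw [ri_ne e φ (fun h' => h (e.injective h')), hh_zero_left]

end

/-- The associator. -/
def as' (F : a ⟶ b) (G : b ⟶ c) (H : c ⟶ d) : (F ≫ G) ≫ H ≅ F ≫ G ≫ H :=
  ri (F := (F ≫ G) ≫ H) (G := F ≫ G ≫ H) (Equiv.prodAssoc F.ι G.ι H.ι)
    fun p => α_ (F.X p.1.1) (G.X p.1.2) (H.X p.2)

/-- The left unitor. -/
def lu (F : a ⟶ b) : 𝟙 a ≫ F ≅ F :=
  ri (F := 𝟙 a ≫ F) (G := F) (Equiv.punitProd F.ι) fun p => λ_ (F.X p.2)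

/-- The right unitor. -/
def ru (F : a ⟶ b) : F ≫ 𝟙 b ≅ F :=
  ri (F := F ≫ 𝟙 b) (G := F) (Equiv.prodPUnit F.ι) fun p => ρ_ (F.X p.1)

lemma as_nat {F F' : a ⟶ b} {G G' : b ⟶ c} {H H' : c ⟶ d} (η : F ⟶ F') (θ : G ⟶ G')
    (κ : H ⟶ H') : hc (hc η θ) κ ≫ (as' F' G' H').hom = (as' F G H).hom ≫ hc η (hc θ κ) := by
  refine ext_entry fun p q => ?_
  obtain ⟨q, rfl⟩ := (Equiv.prodAssoc F'.ι G'.ι H'.ι).surjective q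
  refine (comp_ri (F := (F' ≫ G') ≫ H') (G := F' ≫ G' ≫ H') _ _ _ p q).trans ?_
  refine Eq.trans ?_ (ri_comp (F := (F ≫ G) ≫ H) (G := F ≫ G ≫ H) _ _ _ p _).symm
  exact hh_assoc _ _ _

lemma lu_nat {F F' : a ⟶ b} (η : F ⟶ F') : hc (𝟙 (𝟙 a)) η ≫ (lu F').hom = (lu F).hom ≫ η := by
  refine ext_entry fun p q => ?_
  obtain ⟨q, rfl⟩ := (Equiv.punitProd F'.ι).surjective q
  refine (comp_ri (F := 𝟙 a ≫ F') (G := F') _ _ _ p q).trans ?_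
  refine Eq.trans ?_ (ri_comp (F := 𝟙 a ≫ F) (G := F) _ _ _ p _).symm
  rw [entry_hc]
  exact (congrArg (fun t => hh t _ ≫ _) (entry_id (𝟙 a) PUnit.unit)).trans
    (hh_leftUnitor _)

lemma ru_nat {F F' : a ⟶ b} (η : F ⟶ F') : hc η (𝟙 (𝟙 b)) ≫ (ru F').hom = (ru F).hom ≫ η := by
  refine ext_entry fun p q => ?_
  obtain ⟨q, rfl⟩ := (Equiv.prodPUnit F'.ι).surjective q
  refine (comp_ri (F := F' ≫ 𝟙 b) (G := F') _ _ _ p q).trans ?_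
  refine Eq.trans ?_ (ri_comp (F := F ≫ 𝟙 b) (G := F) _ _ _ p _).symm
  rw [entry_hc]
  exact (congrArg (fun t => hh _ t ≫ _) (entry_id (𝟙 b) PUnit.unit)).trans
    (hh_rightUnitor _)

lemma ri_trans {F G H : a ⟶ b} (e : F.ι ≃ G.ι) (φ : ∀ i, F.X i ≅ G.X (e i)) (e' : G.ι ≃ H.ι)
    (φ' : ∀ i, G.X i ≅ H.X (e' i)) :
    (ri e φ).hom ≫ (ri e' φ').hom = (ri (e.trans e') fun i => φ i ≪≫ φ' (e i)).hom := by
  refine ext_entry fun i j => ?_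
  obtain ⟨i', rfl⟩ := (e.trans e').surjective j
  rw [ri_comp]
  by_cases h : i = i'
  · subst h
    rw [ri_self]
    exact congrArg ((φ i).hom ≫ ·) (ri_self e' φ' (e i))
  · rw [ri_ne _ _ (fun h' => h ((e.trans e').injective h')), ri_ne, comp_zero]
    exact fun h' => h (e.injective (e'.injective h'))

lemma ri_congr {F G : a ⟶ b} {e e' : F.ι ≃ G.ι} {φ : ∀ i, F.X i ≅ G.X (e i)}
    {φ' : ∀ i, F.X i ≅ G.X (e' i)} (h : e = e') (h' : ∀ i, HEq (φ i).hom (φ' i).hom) :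
    (ri e φ).hom = (ri e' φ').hom := by
  subst h
  congr 1
  congr 1
  funext i
  exact Iso.ext (eq_of_heq (h' i))

instance : Bicategory (MatBicat B) :=
  bicategoryOfHComp (MatBicat B) (fun _ _ => inferInstance) hc as' lu ru hc_id hc_comp as_nat
    lu_nat ru_nat
    (fun F G H I => by
      rw [id_eq_ri F, id_eq_ri I]
      unfold as'
      erw [hc_ri, hc_ri, ri_trans, ri_trans, ri_trans]
      exact ri_congr rfl fun p => heq_of_eq (hh_pentagon _ _ _ _))
    (fun F G => by
      rw [id_eq_ri F, id_eq_ri G]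
      unfold as' lu ru
      erw [hc_ri, hc_ri, ri_trans]
      exact ri_congr rfl fun p => heq_of_eq (hh_triangle _ _))

lemma whiskerLeft_def (F : a ⟶ b) {G H : b ⟶ c} (η : G ⟶ H) : F ◁ η = hc (𝟙 F) η := rfl

lemma whiskerRight_def {F G : a ⟶ b} (η : F ⟶ G) (H : b ⟶ c) : η ▷ H = hc η (𝟙 H) := rfl

instance : PreaddBicategory (MatBicat B) where
  homPreadditive _ _ := inferInstance
  whiskerLeft_add _ _ _ _ _ := ext_entry fun _ _ => hh_add_right _ _ _
  add_whiskerRight _ _ _ := ext_entry fun _ _ => hh_add_left _ _ _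

instance (k : Type*) [Field k] [LinBicategory k B] : LinBicategory k (MatBicat B) where
  homLinear _ _ := inferInstance
  whiskerLeft_smul _ _ _ r _ := ext_entry fun _ _ => hh_smul_right k r _ _
  smul_whiskerRight r _ _ := ext_entry fun _ _ => hh_smul_left k r _ _

end MatBicat

/-! ### Idempotent completions of the morphism categories -/

open CategoryTheory.Idempotents

/-- Scalar multiplication in the idempotent completion. -/
instance karoubiLinear {C : Type*} [Category C] [Preadditive C] (k : Type*) [Field k]
    [Linear k C] : Linear k (Karoubi C) where
  homModule P Q :=
    { smul := fun r f => ⟨r • f.f, by rw [Linear.smul_comp, Linear.comp_smul, f.comm]⟩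
      one_smul := fun f => Karoubi.hom_ext _ _ (one_smul k f.f)
      mul_smul := fun r s f => Karoubi.hom_ext _ _ (mul_smul r s f.f)
      smul_zero := fun r => Karoubi.hom_ext _ _ (smul_zero r)
      smul_add := fun r f g => Karoubi.hom_ext _ _ (smul_add r f.f g.f)
      add_smul := fun r s f => Karoubi.hom_ext _ _ (add_smul r s f.f)
      zero_smul := fun f => Karoubi.hom_ext _ _ (zero_smul k f.f) }
  smul_comp _ _ _ r f g := Karoubi.hom_ext _ _ (Linear.smul_comp _ _ _ r f.f g.f)
  comp_smul _ _ _ f r g := Karoubi.hom_ext _ _ (Linear.comp_smul _ _ _ f.f r g.f)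

/-- The 2-category with the same objects as `B` whose morphism categories are the idempotent
completions of those of `B`: 1-morphisms are pairs of a 1-morphism of `B` and an idempotent
2-endomorphism of it. -/
structure KarBicat (B : Type u) where
  /-- the underlying object -/
  as : B

namespace KarBicat

variable {B : Type u} [Bicategory.{w, v} B]

instance : CategoryStruct.{max v w} (KarBicat B) where
  Hom a b := Karoubi (a.as ⟶ b.as)
  id a := ⟨𝟙 a.as, 𝟙 (𝟙 a.as), Category.comp_id _⟩
  comp P Q := ⟨P.X ≫ Q.X, hh P.p Q.p, by rw [← hh_comp, P.idem, Q.idem]⟩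

instance (a b : KarBicat B) : Category (a ⟶ b) :=
  inferInstanceAs (Category (Karoubi (a.as ⟶ b.as)))
instance (a b : KarBicat B) : IsIdempotentComplete (a ⟶ b) :=
  inferInstanceAs (IsIdempotentComplete (Karoubi (a.as ⟶ b.as)))
instance [PreaddBicategory B] (a b : KarBicat B) : Preadditive (a ⟶ b) :=
  inferInstanceAs (Preadditive (Karoubi (a.as ⟶ b.as)))
instance [PreaddBicategory B] (k : Type*) [Field k] [LinBicategory k B] (a b : KarBicat B) :
    Linear k (a ⟶ b) :=
  inferInstanceAs (Linear k (Karoubi (a.as ⟶ b.as)))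

variable {a b c d e : KarBicat B}

/-- The 2-morphism of `B` underlying a 2-morphism of the idempotent completion. -/
def un {P Q : a ⟶ b} (η : P ⟶ Q) : P.X ⟶ Q.X := Karoubi.Hom.f η

/-- A 2-morphism absorbing the idempotents as a 2-morphism of the idempotent completion. -/
def mk' {P Q : a ⟶ b} (f : P.X ⟶ Q.X) (hf : P.p ≫ f ≫ Q.p = f) : P ⟶ Q := Karoubi.Hom.mk f hf

lemma un_mk' {P Q : a ⟶ b} (f : P.X ⟶ Q.X) (hf : P.p ≫ f ≫ Q.p = f) :
    un (mk' f hf : P ⟶ Q) = f := rfl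

lemma ext_un {P Q : a ⟶ b} {η θ : P ⟶ Q} (h : un η = un θ) : η = θ := Karoubi.hom_ext _ _ h

lemma un_comp {P Q R : a ⟶ b} (η : P ⟶ Q) (θ : Q ⟶ R) : un (η ≫ θ) = un η ≫ un θ := rfl

lemma un_id (P : a ⟶ b) : un (𝟙 P) = P.p := rfl

lemma p_un {P Q : a ⟶ b} (η : P ⟶ Q) : P.p ≫ un η = un η := Karoubi.p_comp η

lemma un_p {P Q : a ⟶ b} (η : P ⟶ Q) : un η ≫ Q.p = un η := Karoubi.comp_p η

lemma comp_p (P : a ⟶ b) (Q : b ⟶ c) : (P ≫ Q).p = hh P.p Q.p := rfl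

/-- Horizontal composition of 2-morphisms, induced from `B`. -/
def hc {P P' : a ⟶ b} {Q Q' : b ⟶ c} (η : P ⟶ P') (θ : Q ⟶ Q') : P ≫ Q ⟶ P' ≫ Q' :=
  mk' (hh (un η) (un θ)) (by
    rw [comp_p, comp_p, ← hh_comp, ← hh_comp, un_p, un_p, p_un, p_un])

lemma un_hc {P P' : a ⟶ b} {Q Q' : b ⟶ c} (η : P ⟶ P') (θ : Q ⟶ Q') :
    un (hc η θ) = hh (un η) (un θ) := rfl

/-- A 2-isomorphism of `B` intertwining the idempotents gives a 2-isomorphism of the idempotent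
completion. -/
def isoMk {P Q : a ⟶ b} (φ : P.X ≅ Q.X) (h : P.p ≫ φ.hom = φ.hom ≫ Q.p) : P ≅ Q where
  hom := mk' (P.p ≫ φ.hom) (by
    rw [Category.assoc, ← h, ← Category.assoc, ← Category.assoc, P.idem, P.idem])
  inv := mk' (φ.inv ≫ P.p) (by
    have h' : Q.p ≫ φ.inv = φ.inv ≫ P.p := by
      rw [Iso.eq_inv_comp, ← Category.assoc, ← h, Category.assoc, Iso.hom_inv_id,
        Category.comp_id]
    rw [Category.assoc, P.idem, ← Category.assoc, h', Category.assoc, P.idem])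
  hom_inv_id := ext_un (by
    rw [un_comp, un_mk', un_mk', un_id, Category.assoc, ← Category.assoc φ.hom, Iso.hom_inv_id,
      Category.id_comp, P.idem])
  inv_hom_id := ext_un (by
    rw [un_comp, un_mk', un_mk', un_id, Category.assoc, ← Category.assoc P.p, P.idem, h,
      ← Category.assoc, Iso.inv_hom_id, Category.id_comp])

lemma un_isoMk_hom {P Q : a ⟶ b} (φ : P.X ≅ Q.X) (h : P.p ≫ φ.hom = φ.hom ≫ Q.p) :
    un (isoMk φ h).hom = P.p ≫ φ.hom := rfl

lemma un_isoMk_hom' {P Q : a ⟶ b} (φ : P.X ≅ Q.X) (h : P.p ≫ φ.hom = φ.hom ≫ Q.p) :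
    un (isoMk φ h).hom = φ.hom ≫ Q.p := h

/-- The associator. -/
def as' (P : a ⟶ b) (Q : b ⟶ c) (R : c ⟶ d) : (P ≫ Q) ≫ R ≅ P ≫ Q ≫ R :=
  isoMk (α_ P.X Q.X R.X) (hh_assoc _ _ _)

/-- The left unitor. -/
def lu (P : a ⟶ b) : 𝟙 a ≫ P ≅ P := isoMk (λ_ P.X) (hh_leftUnitor _)

/-- The right unitor. -/
def ru (P : a ⟶ b) : P ≫ 𝟙 b ≅ P := isoMk (ρ_ P.X) (hh_rightUnitor _)

lemma un_as (P : a ⟶ b) (Q : b ⟶ c) (R : c ⟶ d) :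
    un (as' P Q R).hom = hh (hh P.p Q.p) R.p ≫ (α_ P.X Q.X R.X).hom := rfl
lemma un_as' (P : a ⟶ b) (Q : b ⟶ c) (R : c ⟶ d) :
    un (as' P Q R).hom = (α_ P.X Q.X R.X).hom ≫ hh P.p (hh Q.p R.p) := hh_assoc _ _ _
lemma un_lu (P : a ⟶ b) : un (lu P).hom = hh (𝟙 (𝟙 a.as)) P.p ≫ (λ_ P.X).hom := rfl
lemma un_lu' (P : a ⟶ b) : un (lu P).hom = (λ_ P.X).hom ≫ P.p := hh_leftUnitor _
lemma un_ru (P : a ⟶ b) : un (ru P).hom = hh P.p (𝟙 (𝟙 b.as)) ≫ (ρ_ P.X).hom := rfl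
lemma un_ru' (P : a ⟶ b) : un (ru P).hom = (ρ_ P.X).hom ≫ P.p := hh_rightUnitor _

lemma raw_comp {P Q R : a ⟶ b} {η : P ⟶ Q} {θ : Q ⟶ R} {x : P.X ⟶ Q.X} {y : Q.X ⟶ R.X}
    (hx : un η = P.p ≫ x) (hy : un θ = Q.p ≫ y) : un (η ≫ θ) = P.p ≫ x ≫ y := by
  rw [un_comp, hy, ← Category.assoc, un_p, hx, Category.assoc]

lemma raw_hc {P P' : a ⟶ b} {Q Q' : b ⟶ c} {η : P ⟶ P'} {θ : Q ⟶ Q'} {x : P.X ⟶ P'.X}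
    {y : Q.X ⟶ Q'.X} (hx : un η = P.p ≫ x) (hy : un θ = Q.p ≫ y) :
    un (hc η θ) = (P ≫ Q).p ≫ hh x y := by
  rw [un_hc, hx, hy, hh_comp, comp_p]

lemma raw_id (P : a ⟶ b) : un (𝟙 P) = P.p ≫ 𝟙 P.X := (Category.comp_id _).symm

instance : Bicategory (KarBicat B) :=
  bicategoryOfHComp (KarBicat B) (fun _ _ => inferInstance) hc as' lu ru
    (fun _ _ => rfl)
    (fun _ _ _ _ => ext_un (hh_comp _ _ _ _))
    (fun {a b c d} {P P'} {Q Q'} {R R'} η θ κ => ext_un (by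
      rw [un_comp, un_comp, un_as, un_as', un_hc, un_hc, un_hc, un_hc, ← Category.assoc,
        ← hh_comp, ← hh_comp, un_p, un_p, un_p, Category.assoc, ← hh_comp, ← hh_comp, p_un, p_un,
        p_un, hh_assoc]))
    (fun η => ext_un (by
      rw [un_comp, un_comp, un_lu', un_lu', un_hc, Category.assoc, p_un, ← Category.assoc]
      refine (congrArg (· ≫ _) (hh_leftUnitor (un η))).trans ?_
      rw [Category.assoc, un_p]))
    (fun η => ext_un (by
      rw [un_comp, un_comp, un_ru', un_ru', un_hc, Category.assoc, p_un, ← Category.assoc]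
      refine (congrArg (· ≫ _) (hh_rightUnitor (un η))).trans ?_
      rw [Category.assoc, un_p]))
    (fun P Q R S => ext_un (by
      refine (raw_comp (raw_hc (un_as P Q R) (raw_id S))
        (raw_comp (un_as P (Q ≫ R) S) (raw_hc (raw_id P) (un_as Q R S)))).trans ?_
      refine Eq.trans ?_ (raw_comp (un_as (P ≫ Q) R S) (un_as P Q (R ≫ S))).symm
      exact congrArg (_ ≫ ·) (hh_pentagon P.X Q.X R.X S.X)))
    (fun {_ b _} P Q => ext_un (by
      refine (raw_comp (un_as P (𝟙 b) Q) (raw_hc (raw_id P) (un_lu Q))).trans ?_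
      refine Eq.trans ?_ (raw_hc (un_ru P) (raw_id Q)).symm
      exact congrArg (_ ≫ ·) (hh_triangle P.X Q.X)))

lemma whiskerLeft_def (P : a ⟶ b) {Q R : b ⟶ c} (η : Q ⟶ R) : P ◁ η = hc (𝟙 P) η := rfl

lemma whiskerRight_def {P Q : a ⟶ b} (η : P ⟶ Q) (R : b ⟶ c) : η ▷ R = hc η (𝟙 R) := rfl

instance [PreaddBicategory B] : PreaddBicategory (KarBicat B) where
  homPreadditive _ _ := inferInstance
  whiskerLeft_add _ _ _ _ _ := ext_un (hh_add_right _ _ _)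
  add_whiskerRight _ _ _ := ext_un (hh_add_left _ _ _)

instance [PreaddBicategory B] (k : Type*) [Field k] [LinBicategory k B] :
    LinBicategory k (KarBicat B) where
  homLinear _ _ := inferInstance
  whiskerLeft_smul _ _ _ r _ := ext_un (hh_smul_right k r _ _)
  smul_whiskerRight r _ _ := ext_un (hh_smul_left k r _ _)

end KarBicat

/-! ### Splitting the identity 1-morphisms -/

/-- Primitive idempotent endomorphisms: nonzero idempotents that are not the sum of two nonzero
orthogonal idempotents. -/
structure IsPrimitiveIdem {C : Type*} [Category C] [Preadditive C] {X : C} (e : X ⟶ X) :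
    Prop where
  idem : e ≫ e = e
  ne_zero : e ≠ 0
  primitive : ∀ f g : X ⟶ X, f ≫ f = f → g ≫ g = g → f ≫ g = 0 → g ≫ f = 0 → f + g = e →
    f = 0 ∨ g = 0

section Corner

variable {B : Type u} [Bicategory.{w, v} B] {a b c : B}

/-- The 2-endomorphism `id_F ∘₀ e` of `F : a ⟶ b`, for a 2-endomorphism `e` of the identity of
`a`. -/
def cutLeft (e : 𝟙 a ⟶ 𝟙 a) (F : a ⟶ b) : F ⟶ F := (λ_ F).inv ≫ e ▷ F ≫ (λ_ F).hom

/-- The 2-endomorphism `e ∘₀ id_F` of `F : a ⟶ b`, for a 2-endomorphism `e` of the identity of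
`b`. -/
def cutRight (F : a ⟶ b) (e : 𝟙 b ⟶ 𝟙 b) : F ⟶ F := (ρ_ F).inv ≫ F ◁ e ≫ (ρ_ F).hom

lemma cutLeft_naturality (e : 𝟙 a ⟶ 𝟙 a) {F G : a ⟶ b} (η : F ⟶ G) :
    cutLeft e F ≫ η = η ≫ cutLeft e G := by
  have h := whisker_exchange e η
  simp only [id_whiskerLeft, Category.assoc] at h
  simp only [cutLeft, Category.assoc]
  rw [← cancel_epi (λ_ F).hom, ← cancel_mono (λ_ G).inv]
  simpa using h.symm

lemma cutRight_naturality (e : 𝟙 b ⟶ 𝟙 b) {F G : a ⟶ b} (η : F ⟶ G) :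
    cutRight F e ≫ η = η ≫ cutRight G e := by
  have h := whisker_exchange η e
  simp only [whiskerRight_id, Category.assoc] at h
  simp only [cutRight, Category.assoc]
  rw [← cancel_epi (ρ_ F).hom, ← cancel_mono (ρ_ G).inv]
  simpa using h

lemma cutLeft_comp (e : 𝟙 a ⟶ 𝟙 a) (F : a ⟶ b) (G : b ⟶ c) :
    cutLeft e (F ≫ G) = cutLeft e F ▷ G := by
  simp [cutLeft]

lemma cutRight_comp (F : a ⟶ b) (G : b ⟶ c) (e : 𝟙 c ⟶ 𝟙 c) :
    cutRight (F ≫ G) e = F ◁ cutRight G e := by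
  simp [cutRight]

lemma cutLeft_id (e : 𝟙 a ⟶ 𝟙 a) : cutLeft e (𝟙 a) = e := by
  simp [cutLeft, unitors_equal, unitors_inv_equal]

lemma cutRight_id (e : 𝟙 a ⟶ 𝟙 a) : cutRight (𝟙 a) e = e := by
  simp [cutRight, ← unitors_equal, ← unitors_inv_equal]

lemma cutLeft_idem {e : 𝟙 a ⟶ 𝟙 a} (he : e ≫ e = e) (F : a ⟶ b) :
    cutLeft e F ≫ cutLeft e F = cutLeft e F := by
  simp only [cutLeft, Category.assoc, Iso.hom_inv_id_assoc]
  rw [← comp_whiskerRight_assoc, he]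

lemma cutRight_idem {e : 𝟙 b ⟶ 𝟙 b} (he : e ≫ e = e) (F : a ⟶ b) :
    cutRight F e ≫ cutRight F e = cutRight F e := by
  simp only [cutRight, Category.assoc, Iso.hom_inv_id_assoc]
  rw [← whiskerLeft_comp_assoc, he]

/-- `F : a ⟶ b` lives in the corner given by `e` and `e'`: `e' ∘₀ id_F ∘₀ e = id_F`. -/
def InCorner (e : 𝟙 a ⟶ 𝟙 a) (e' : 𝟙 b ⟶ 𝟙 b) : ObjectProperty (a ⟶ b) :=
  fun F => cutLeft e F ≫ cutRight F e' = 𝟙 F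

lemma InCorner.left {e : 𝟙 a ⟶ 𝟙 a} {e' : 𝟙 b ⟶ 𝟙 b} (he : e ≫ e = e) {F : a ⟶ b}
    (h : InCorner e e' F) : cutLeft e F = 𝟙 F := by
  have h1 : cutLeft e F ≫ cutLeft e F = cutLeft e F := by
    simp only [cutLeft, Category.assoc, Iso.hom_inv_id_assoc]
    rw [← comp_whiskerRight_assoc, he]
  have h2 : cutLeft e F ≫ cutRight F e' = 𝟙 F := h
  rw [← h2]
  conv_rhs => rw [← h1]
  rw [Category.assoc, h2, Category.comp_id]

lemma InCorner.right {e : 𝟙 a ⟶ 𝟙 a} {e' : 𝟙 b ⟶ 𝟙 b} (he : e ≫ e = e) {F : a ⟶ b}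
    (h : InCorner e e' F) : cutRight F e' = 𝟙 F := by
  have h2 : cutLeft e F ≫ cutRight F e' = 𝟙 F := h
  rwa [h.left he, Category.id_comp] at h2

lemma InCorner.comp {e : 𝟙 a ⟶ 𝟙 a} {e' : 𝟙 b ⟶ 𝟙 b} {e'' : 𝟙 c ⟶ 𝟙 c} (he : e ≫ e = e)
    (he' : e' ≫ e' = e') {F : a ⟶ b} {G : b ⟶ c} (hF : InCorner e e' F)
    (hG : InCorner e' e'' G) : InCorner e e'' (F ≫ G) := by
  change cutLeft e (F ≫ G) ≫ cutRight (F ≫ G) e'' = 𝟙 _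
  rw [cutLeft_comp, cutRight_comp, hF.left he, hG.right he', id_whiskerRight, whiskerLeft_id,
    Category.comp_id]

end Corner

/-- Objects of the 2-category obtained from `B` by splitting the identity 1-morphisms: pairs of
an object `i` of `B` and a primitive idempotent of the 2-endomorphism algebra of `𝟙 i`. -/
structure SplitBicat (B : Type u) [Bicategory.{w, v} B] [PreaddBicategory B] where
  /-- the underlying object -/
  obj : B
  /-- the idempotent -/
  e : 𝟙 obj ⟶ 𝟙 obj
  prim : IsPrimitiveIdem e

namespace SplitBicat

variable {B : Type u} [Bicategory.{w, v} B] [PreaddBicategory B]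
  [∀ a b : B, IsIdempotentComplete (a ⟶ b)]

lemma exists_split (a : SplitBicat B) :
    ∃ (Y : a.obj ⟶ a.obj) (i : Y ⟶ 𝟙 a.obj) (e : 𝟙 a.obj ⟶ Y), i ≫ e = 𝟙 Y ∧ e ≫ i = a.e :=
  IsIdempotentComplete.idempotents_split _ _ a.prim.idem

/-- The direct summand of the identity 1-morphism of `a.obj` given by the idempotent `a.e`. -/
def one (a : SplitBicat B) : a.obj ⟶ a.obj := a.exists_split.choose

/-- The inclusion of the direct summand. -/
def incl (a : SplitBicat B) : a.one ⟶ 𝟙 a.obj := a.exists_split.choose_spec.choose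

/-- The projection onto the direct summand. -/
def proj (a : SplitBicat B) : 𝟙 a.obj ⟶ a.one := a.exists_split.choose_spec.choose_spec.choose

lemma incl_proj (a : SplitBicat B) : a.incl ≫ a.proj = 𝟙 a.one :=
  a.exists_split.choose_spec.choose_spec.choose_spec.1

lemma proj_incl (a : SplitBicat B) : a.proj ≫ a.incl = a.e :=
  a.exists_split.choose_spec.choose_spec.choose_spec.2

lemma one_inCorner (a : SplitBicat B) : InCorner a.e a.e a.one := by
  have h1 : cutLeft a.e a.one = 𝟙 a.one := by
    rw [← Category.comp_id (cutLeft _ _), ← a.incl_proj, ← Category.assoc, cutLeft_naturality,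
      cutLeft_id, ← a.proj_incl, Category.assoc, Category.assoc, a.incl_proj, Category.comp_id, a.incl_proj]
  have h2 : cutRight a.one a.e = 𝟙 a.one := by
    rw [← Category.comp_id (cutRight _ _), ← a.incl_proj, ← Category.assoc, cutRight_naturality,
      cutRight_id, ← a.proj_incl, Category.assoc, Category.assoc, a.incl_proj, Category.comp_id, a.incl_proj]
  change cutLeft a.e a.one ≫ cutRight a.one a.e = 𝟙 _
  rw [h1, h2, Category.comp_id]

/-- Every 1-morphism `F` of `B` has a direct summand `F'` in the corner, the image of the idempotent
`e' ∘₀ id_F ∘₀ e`. Hence the category of all 1-morphisms `F : i ⟶ j` with the sets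
`e' ∘₀ Hom(F, G) ∘₀ e` as morphisms, in which `F` and `F'` are isomorphic, is equivalent to its
full subcategory of the 1-morphisms in the corner, which is what is used below. -/
lemma exists_corner (a b : SplitBicat B) (F : a.obj ⟶ b.obj) :
    ∃ (F' : a.obj ⟶ b.obj) (i : F' ⟶ F) (p : F ⟶ F'), InCorner a.e b.e F' ∧ i ≫ p = 𝟙 F' ∧
      p ≫ i = cutLeft a.e F ≫ cutRight F b.e := by
  set q := cutLeft a.e F ≫ cutRight F b.e with hq
  have h : q ≫ q = q := by
    conv_lhs => rhs; rw [hq]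
    rw [← Category.assoc, ← cutLeft_naturality, hq, ← Category.assoc (cutLeft _ _),
      cutLeft_idem a.prim.idem, Category.assoc, cutRight_idem b.prim.idem]
  obtain ⟨F', i, p, h1, h2⟩ := IsIdempotentComplete.idempotents_split _ q h
  refine ⟨F', i, p, ?_, h1, h2⟩
  change cutLeft a.e F' ≫ cutRight F' b.e = 𝟙 F'
  calc cutLeft a.e F' ≫ cutRight F' b.e
      = cutLeft a.e F' ≫ cutRight F' b.e ≫ i ≫ p := by rw [h1, Category.comp_id]
    _ = i ≫ q ≫ p := by
      rw [← Category.assoc (cutRight _ _), cutRight_naturality, ← Category.assoc,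
        ← Category.assoc, cutLeft_naturality, hq]
      simp only [Category.assoc]
    _ = (i ≫ p) ≫ i ≫ p := by rw [← h2]; simp only [Category.assoc]
    _ = 𝟙 F' := by rw [h1, Category.comp_id]

/-- The 1-morphisms from `(i, e)` to `(j, e')` are the 1-morphisms `F : i ⟶ j` with
`e' ∘₀ id_F ∘₀ e = id_F`, the composition is that of `B`, and the identity is the direct
summand of `𝟙 i` given by `e`. -/
instance : CategoryStruct.{v} (SplitBicat B) where
  Hom a b := (InCorner a.e b.e).FullSubcategory
  id a := ⟨a.one, a.one_inCorner⟩
  comp {a b _} F G := ⟨F.obj ≫ G.obj, F.property.comp a.prim.idem b.prim.idem G.property⟩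

/-- The 2-morphisms `F ⟶ G` are all 2-morphisms `F ⟶ G` in `B`; for 1-morphisms in the corner
these are exactly the 2-morphisms of the form `e' ∘₀ α ∘₀ e`. -/
instance (a b : SplitBicat B) : Category (a ⟶ b) :=
  inferInstanceAs (Category (InCorner a.e b.e).FullSubcategory)
instance (a b : SplitBicat B) : Preadditive (a ⟶ b) :=
  inferInstanceAs (Preadditive (InCorner a.e b.e).FullSubcategory)
instance (k : Type*) [Field k] [LinBicategory k B] (a b : SplitBicat B) : Linear k (a ⟶ b) :=
  inferInstanceAs (Linear k (InCorner a.e b.e).FullSubcategory)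

variable {a b c d : SplitBicat B}

/-- The 1-morphism of `B` underlying a 1-morphism. -/
def u1 (F : a ⟶ b) : a.obj ⟶ b.obj := ObjectProperty.FullSubcategory.obj F

/-- The 2-morphism of `B` underlying a 2-morphism. -/
def u2 {F G : a ⟶ b} (η : F ⟶ G) : u1 F ⟶ u1 G := InducedCategory.Hom.hom η

/-- A 2-morphism of `B` between 1-morphisms in the corner. -/
def mk2 {F G : a ⟶ b} (η : u1 F ⟶ u1 G) : F ⟶ G := InducedCategory.homMk η

lemma ext_u2 {F G : a ⟶ b} {η θ : F ⟶ G} (h : u2 η = u2 θ) : η = θ :=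
  InducedCategory.hom_ext h

/-- A 2-isomorphism of `B` between 1-morphisms in the corner. -/
def iso2 {F G : a ⟶ b} (e : u1 F ≅ u1 G) : F ≅ G where
  hom := mk2 e.hom
  inv := mk2 e.inv
  hom_inv_id := ext_u2 e.hom_inv_id
  inv_hom_id := ext_u2 e.inv_hom_id

/-- The left unitor of `B`, restricted to the direct summand. -/
def luB (F : a ⟶ b) : a.one ≫ u1 F ≅ u1 F where
  hom := a.incl ▷ u1 F ≫ (λ_ (u1 F)).hom
  inv := (λ_ (u1 F)).inv ≫ a.proj ▷ u1 F
  hom_inv_id := by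
    rw [Category.assoc, Iso.hom_inv_id_assoc, ← comp_whiskerRight, incl_proj, id_whiskerRight]
  inv_hom_id := by
    rw [Category.assoc, ← comp_whiskerRight_assoc, proj_incl]
    exact InCorner.left a.prim.idem F.property

/-- The right unitor of `B`, restricted to the direct summand. -/
def ruB (F : a ⟶ b) : u1 F ≫ b.one ≅ u1 F where
  hom := u1 F ◁ b.incl ≫ (ρ_ (u1 F)).hom
  inv := (ρ_ (u1 F)).inv ≫ u1 F ◁ b.proj
  hom_inv_id := by
    rw [Category.assoc, Iso.hom_inv_id_assoc, ← whiskerLeft_comp, incl_proj, whiskerLeft_id]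
  inv_hom_id := by
    rw [Category.assoc, ← whiskerLeft_comp_assoc, proj_incl]
    exact InCorner.right a.prim.idem F.property

lemma luB_nat {F G : a ⟶ b} (η : F ⟶ G) :
    a.one ◁ u2 η = (luB F).hom ≫ u2 η ≫ (luB G).inv := by
  rw [← Category.assoc, Iso.eq_comp_inv]
  simp only [luB, Category.assoc]
  rw [whisker_exchange_assoc, id_whiskerLeft]
  simp

lemma ruB_nat {F G : a ⟶ b} (η : F ⟶ G) :
    u2 η ▷ b.one = (ruB F).hom ≫ u2 η ≫ (ruB G).inv := by
  rw [← Category.assoc, Iso.eq_comp_inv]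
  simp only [ruB, Category.assoc]
  rw [← whisker_exchange_assoc, whiskerRight_id]
  simp

lemma triB (F : a ⟶ b) (G : b ⟶ c) :
    (α_ (u1 F) b.one (u1 G)).hom ≫ u1 F ◁ (luB G).hom = (ruB F).hom ▷ u1 G := by
  simp [luB, ruB]

instance : Bicategory (SplitBicat B) where
  homCategory _ _ := inferInstance
  whiskerLeft F G H η := mk2 (F := F ≫ G) (G := F ≫ H) (u1 F ◁ u2 η)
  whiskerRight {_ _ _ F G} η H := mk2 (F := F ≫ H) (G := G ≫ H) (u2 η ▷ u1 H)
  associator F G H :=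
    iso2 (F := (F ≫ G) ≫ H) (G := F ≫ G ≫ H) (α_ (u1 F) (u1 G) (u1 H))
  leftUnitor F := iso2 (F := 𝟙 _ ≫ F) (G := F) (luB F)
  rightUnitor F := iso2 (F := F ≫ 𝟙 _) (G := F) (ruB F)
  whiskerLeft_id F G := ext_u2 (whiskerLeft_id (u1 F) (u1 G))
  id_whiskerRight F G := ext_u2 (id_whiskerRight (u1 F) (u1 G))
  whiskerLeft_comp F _ _ _ η θ := ext_u2 (whiskerLeft_comp (u1 F) (u2 η) (u2 θ))
  comp_whiskerRight η θ H := ext_u2 (comp_whiskerRight (u2 η) (u2 θ) (u1 H))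
  id_whiskerLeft η := ext_u2 (luB_nat η)
  whiskerRight_id η := ext_u2 (ruB_nat η)
  comp_whiskerLeft F G _ _ η := ext_u2 (comp_whiskerLeft (u1 F) (u1 G) (u2 η))
  whiskerRight_comp η G H := ext_u2 (whiskerRight_comp (u2 η) (u1 G) (u1 H))
  whisker_assoc F _ _ η H := ext_u2 (whisker_assoc (u1 F) (u2 η) (u1 H))
  whisker_exchange η θ := ext_u2 (whisker_exchange (u2 η) (u2 θ))
  pentagon F G H I := ext_u2 (pentagon (u1 F) (u1 G) (u1 H) (u1 I))
  triangle F G := ext_u2 (triB F G)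

instance : PreaddBicategory (SplitBicat B) where
  homPreadditive _ _ := inferInstance
  whiskerLeft_add F _ _ η θ :=
    ext_u2 (PreaddBicategory.whiskerLeft_add (u1 F) (u2 η) (u2 θ))
  add_whiskerRight η θ H :=
    ext_u2 (PreaddBicategory.add_whiskerRight (u2 η) (u2 θ) (u1 H))

instance (k : Type*) [Field k] [LinBicategory k B] : LinBicategory k (SplitBicat B) where
  homLinear _ _ := inferInstance
  whiskerLeft_smul F _ _ r η :=
    ext_u2 (LinBicategory.whiskerLeft_smul (u1 F) r (u2 η))
  smul_whiskerRight r η H :=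
    ext_u2 (LinBicategory.smul_whiskerRight r (u2 η) (u1 H))

end SplitBicat

/-- The `k`-finitarisation of a 2-category: linearise the morphism categories, pass to additive
envelopes and then to idempotent completions. -/
abbrev Finitarization (k : Type*) [Field k] (B : Type u) [Bicategory.{w, v} B] :=
  KarBicat (MatBicat (LinBicat k B))

/-! ### Finitary and fiat 2-categories -/

/-- A `k`-linear category is finitary: additive, idempotent split, Krull-Schmidt, with finitely
many isomorphism classes of indecomposable objects, and with finite dimensional morphism
spaces. -/
structure IsFinitaryCat (k : Type*) [Field k] (C : Type*) [Category C] [Preadditive C]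
    [Linear k C] : Prop where
  additive : HasFiniteBiproducts C
  idempotentSplit : IsIdempotentComplete C
  krullSchmidt : ∀ X : C, ∃ (m : ℕ) (Y : Fin m → C),
    (∀ i, IsLocalRing (End (Y i))) ∧ Nonempty (X ≅ ⨁ Y)
  finiteIndecomposables : haveI := hasBinaryBiproducts_of_finite_biproducts C
    ∃ (m : ℕ) (Y : Fin m → C), ∀ X : C, Indecomposable X → ∃ i, Nonempty (X ≅ Y i)
  finiteHom : ∀ X Y : C, Module.Finite k (X ⟶ Y)

/-- Prefinitary 2-categories. Composition being `k`-bilinear is part of `LinBicategory`. -/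
structure IsPrefinitary (k : Type*) [Field k] (B : Type u) [Bicategory.{w, v} B]
    [PreaddBicategory B] [LinBicategory k B] : Prop where
  finiteObjects : Finite B
  finitaryHom : ∀ a b : B, IsFinitaryCat k (a ⟶ b)

/-- Finitary 2-categories: prefinitary with indecomposable identity 1-morphisms. -/
structure IsFinitary (k : Type*) [Field k] (B : Type u) [Bicategory.{w, v} B]
    [PreaddBicategory B] [LinBicategory k B] : Prop extends IsPrefinitary k B where
  indecomposableId : ∀ a : B,
    haveI := (finitaryHom a a).additive
    haveI := hasBinaryBiproducts_of_finite_biproducts (a ⟶ a)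
    Indecomposable (𝟙 a)

/-- A weak anti-involution of a linear 2-category: an object preserving, `k`-linear
pseudofunctor `⋆` to the 2-category in which both 1-morphisms and 2-morphisms are reversed,
together with an isomorphism `inv : Id ≅ ⋆⋆` of pseudofunctors. -/
structure WeakAntiInvolution (k : Type*) [Field k] (B : Type u) [Bicategory.{w, v} B]
    [PreaddBicategory B] [LinBicategory k B] where
  /-- the action on 1-morphisms -/
  star {a b : B} (F : a ⟶ b) : b ⟶ a
  /-- the action on 2-morphisms -/
  map {a b : B} {F G : a ⟶ b} (η : F ⟶ G) : star G ⟶ star F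
  map_id {a b : B} (F : a ⟶ b) : map (𝟙 F) = 𝟙 (star F)
  map_comp {a b : B} {F G H : a ⟶ b} (η : F ⟶ G) (θ : G ⟶ H) : map (η ≫ θ) = map θ ≫ map η
  map_add {a b : B} {F G : a ⟶ b} (η θ : F ⟶ G) : map (η + θ) = map η + map θ
  map_smul {a b : B} {F G : a ⟶ b} (r : k) (η : F ⟶ G) : map (r • η) = r • map η
  /-- compatibility with composition of 1-morphisms -/
  mul {a b c : B} (F : a ⟶ b) (G : b ⟶ c) : star G ≫ star F ≅ star (F ≫ G)
  /-- compatibility with identity 1-morphisms -/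
  unit (a : B) : 𝟙 a ≅ star (𝟙 a)
  mul_whiskerRight {a b c : B} {F F' : a ⟶ b} (η : F ⟶ F') (G : b ⟶ c) :
    (mul F' G).hom ≫ map (η ▷ G) = star G ◁ map η ≫ (mul F G).hom
  mul_whiskerLeft {a b c : B} (F : a ⟶ b) {G G' : b ⟶ c} (η : G ⟶ G') :
    (mul F G').hom ≫ map (F ◁ η) = map η ▷ star F ≫ (mul F G).hom
  mul_assoc {a b c d : B} (F : a ⟶ b) (G : b ⟶ c) (H : c ⟶ d) :
    (mul G H).hom ▷ star F ≫ (mul F (G ≫ H)).hom ≫ map (α_ F G H).hom =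
      (α_ (star H) (star G) (star F)).hom ≫ star H ◁ (mul F G).hom ≫ (mul (F ≫ G) H).hom
  unit_mul {a b : B} (F : a ⟶ b) :
    (ρ_ (star F)).inv ≫ star F ◁ (unit a).hom ≫ (mul (𝟙 a) F).hom = map (λ_ F).hom
  mul_unit {a b : B} (F : a ⟶ b) :
    (λ_ (star F)).inv ≫ (unit b).hom ▷ star F ≫ (mul F (𝟙 b)).hom = map (ρ_ F).hom
  /-- the isomorphism `Id ≅ ⋆⋆` -/
  inv {a b : B} (F : a ⟶ b) : F ≅ star (star F)
  inv_naturality {a b : B} {F G : a ⟶ b} (η : F ⟶ G) :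
    η ≫ (inv G).hom = (inv F).hom ≫ map (map η)
  inv_mul {a b c : B} (F : a ⟶ b) (G : b ⟶ c) :
    (inv F).hom ▷ G ≫ star (star F) ◁ (inv G).hom ≫ (mul (star G) (star F)).hom ≫
      map (mul F G).inv = (inv (F ≫ G)).hom
  inv_unit (a : B) : (unit a).hom ≫ map (unit a).inv = (inv (𝟙 a)).hom

/-- Fiat 2-categories: finitary, with a weak anti-involution `⋆` such that for every 1-morphism
`F : a ⟶ b` there are adjunction 2-morphisms `𝟙 a ⟶ F ≫ ⋆F` and `⋆F ≫ F ⟶ 𝟙 b` satisfying the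
triangle identities. (Here `F ≫ ⋆F` is first `F`, then `⋆F`.) -/
def IsFiat (k : Type*) [Field k] (B : Type u) [Bicategory.{w, v} B] [PreaddBicategory B]
    [LinBicategory k B] : Prop :=
  IsFinitary k B ∧ ∃ S : WeakAntiInvolution k B,
    ∀ (a b : B) (F : a ⟶ b), Nonempty (Bicategory.Adjunction F (S.star F))

/-! ### The 2-category `A_n` -/

/-- The type with one element, the object of the first 2-category extending the symmetric
group. -/
structure ACat (n : ℕ) where

namespace ACat

variable {n : ℕ}

/-- 1-morphisms: elements of the symmetric group. -/
structure Mor1 (n : ℕ) where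
  /-- the permutation -/
  perm : Equiv.Perm (Fin n)

/-- A permutation as a binary relation; a pair `(x, y)` means that `x` is mapped to `y`. -/
def rel (π : Equiv.Perm (Fin n)) : SetRel (Fin n) (Fin n) := {p | π p.1 = p.2}

/-- 2-morphisms from `f` to `g`: binary relations contained in both `f` and `g`. -/
@[ext]
structure Mor2 (f g : Mor1 n) where
  /-- the binary relation -/
  val : SetRel (Fin n) (Fin n)
  le_left : val ⊆ rel f.perm
  le_right : val ⊆ rel g.perm

/-- Composition of 1-morphisms, in diagrammatic order. -/
instance : CategoryStruct (ACat n) where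
  Hom _ _ := Mor1 n
  id _ := ⟨1⟩
  comp f g := ⟨g.perm * f.perm⟩

/-- Vertical composition is intersection. -/
instance (a b : ACat n) : Category (a ⟶ b) where
  Hom f g := Mor2 f g
  id f := ⟨rel f.perm, subset_rfl, subset_rfl⟩
  comp α β := ⟨β.val ∩ α.val, fun _ h => α.le_left h.2, fun _ h => β.le_right h.1⟩
  id_comp α := Mor2.ext (Set.inter_eq_left.mpr α.le_left)
  comp_id α := Mor2.ext (Set.inter_eq_right.mpr α.le_right)
  assoc α β γ := Mor2.ext (by
    ext; simp only [Set.mem_inter_iff]; tauto)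

variable {a b c d : ACat n}

/-- The binary relation underlying a 2-morphism. -/
def val {f g : a ⟶ b} (α : f ⟶ g) : SetRel (Fin n) (Fin n) := Mor2.val α

/-- The permutation underlying a 1-morphism. -/
def perm (f : a ⟶ b) : Equiv.Perm (Fin n) := Mor1.perm f

lemma ext_val {f g : a ⟶ b} {α β : f ⟶ g} (h : ∀ x y, (x, y) ∈ val α ↔ (x, y) ∈ val β) : α = β :=
  Mor2.ext (Set.ext fun p => h p.1 p.2)

lemma perm_comp (f : a ⟶ b) (g : b ⟶ c) (x : Fin n) : perm (f ≫ g) x = perm g (perm f x) := rfl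

lemma mem_left {f g : a ⟶ b} (α : f ⟶ g) {x y : Fin n} (h : (x, y) ∈ val α) : perm f x = y :=
  Mor2.le_left α h

lemma mem_right {f g : a ⟶ b} (α : f ⟶ g) {x y : Fin n} (h : (x, y) ∈ val α) : perm g x = y :=
  Mor2.le_right α h

lemma mem_id {f : a ⟶ b} {x y : Fin n} : (x, y) ∈ val (𝟙 f) ↔ perm f x = y := Iff.rfl

lemma mem_comp {f g h : a ⟶ b} (α : f ⟶ g) (β : g ⟶ h) {x y : Fin n} :
    (x, y) ∈ val (α ≫ β) ↔ (x, y) ∈ val α ∧ (x, y) ∈ val β := and_comm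

/-- Horizontal composition is composition of binary relations. -/
def hc {f f' : a ⟶ b} {g g' : b ⟶ c} (α : f ⟶ f') (β : g ⟶ g') : f ≫ g ⟶ f' ≫ g' :=
  Mor2.mk (SetRel.comp (val α) (val β))
    (by
      rintro ⟨x, z⟩ ⟨y, h, h'⟩
      change perm g (perm f x) = z
      rw [mem_left α h, mem_left β h'])
    (by
      rintro ⟨x, z⟩ ⟨y, h, h'⟩
      change perm g' (perm f' x) = z
      rw [mem_right α h, mem_right β h'])

lemma mem_hc {f f' : a ⟶ b} {g g' : b ⟶ c} (α : f ⟶ f') (β : g ⟶ g') {x z : Fin n} :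
    (x, z) ∈ val (hc α β) ↔ ∃ y, (x, y) ∈ val α ∧ (y, z) ∈ val β := Iff.rfl

/-- The identity 2-isomorphism between equal 1-morphisms. -/
def isoOfEq {f g : a ⟶ b} (h : perm f = perm g) : f ≅ g where
  hom := Mor2.mk (rel (perm f)) subset_rfl (h ▸ subset_rfl)
  inv := Mor2.mk (rel (perm f)) (h ▸ subset_rfl) subset_rfl
  hom_inv_id := Mor2.ext (Set.inter_self _)
  inv_hom_id := Mor2.ext ((Set.inter_self _).trans (congrArg rel h))

lemma mem_isoOfEq {f g : a ⟶ b} (h : perm f = perm g) {x y : Fin n} :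
    (x, y) ∈ val (isoOfEq h).hom ↔ perm f x = y := Iff.rfl

/-- The associator, an identity. -/
def as' (f : a ⟶ b) (g : b ⟶ c) (h : c ⟶ d) : (f ≫ g) ≫ h ≅ f ≫ g ≫ h :=
  isoOfEq (mul_assoc (perm h) (perm g) (perm f)).symm

/-- The left unitor, an identity. -/
def lu (f : a ⟶ b) : 𝟙 a ≫ f ≅ f := isoOfEq (mul_one (perm f))

/-- The right unitor, an identity. -/
def ru (f : a ⟶ b) : f ≫ 𝟙 b ≅ f := isoOfEq (one_mul (perm f))

lemma mem_as (f : a ⟶ b) (g : b ⟶ c) (h : c ⟶ d) {x y : Fin n} :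
    (x, y) ∈ val (as' f g h).hom ↔ perm h (perm g (perm f x)) = y := Iff.rfl

lemma mem_lu (f : a ⟶ b) {x y : Fin n} : (x, y) ∈ val (lu f).hom ↔ perm f x = y := Iff.rfl

lemma mem_ru (f : a ⟶ b) {x y : Fin n} : (x, y) ∈ val (ru f).hom ↔ perm f x = y := Iff.rfl

lemma perm_id (x : Fin n) : perm (𝟙 a) x = x := rfl

instance : Bicategory (ACat n) :=
  bicategoryOfHComp (ACat n) (fun _ _ => inferInstance) hc as' lu ru
    (fun f g => ext_val fun x z => by
      simp only [mem_hc, mem_id, perm_comp]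
      simp)
    (fun η η' θ θ' => ext_val fun x z => by
      simp only [mem_hc, mem_comp]
      constructor
      · rintro ⟨y, ⟨h1, h2⟩, h3, h4⟩
        exact ⟨⟨y, h1, h3⟩, y, h2, h4⟩
      · rintro ⟨⟨y, h1, h3⟩, y', h2, h4⟩
        have : y = y' := (mem_right η h1).symm.trans (mem_left η' h2)
        subst this
        exact ⟨y, ⟨h1, h2⟩, h3, h4⟩)
    (fun η θ κ => ext_val fun x w => by
      simp only [mem_hc, mem_comp, mem_as]
      constructor
      · rintro ⟨⟨z, ⟨y, h1, h2⟩, h3⟩, -⟩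
        exact ⟨by rw [mem_left η h1, mem_left θ h2, mem_left κ h3], y, h1, z, h2, h3⟩
      · rintro ⟨-, y, h1, z, h2, h3⟩
        exact ⟨⟨z, ⟨y, h1, h2⟩, h3⟩, by rw [mem_right η h1, mem_right θ h2, mem_right κ h3]⟩)
    (fun η => ext_val fun x z => by
      simp only [mem_hc, mem_comp, mem_lu, mem_id, perm_id]
      constructor
      · rintro ⟨⟨y, rfl, h⟩, -⟩
        exact ⟨mem_left η h, h⟩
      · rintro ⟨-, h⟩
        exact ⟨⟨x, rfl, h⟩, mem_right η h⟩)
    (fun η => ext_val fun x z => by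
      simp only [mem_hc, mem_comp, mem_ru, mem_id, perm_id]
      constructor
      · rintro ⟨⟨y, h, rfl⟩, -⟩
        exact ⟨mem_left η h, h⟩
      · rintro ⟨-, h⟩
        exact ⟨⟨z, h, rfl⟩, mem_right η h⟩)
    (fun f g h i => ext_val fun x z => by
      simp only [mem_hc, mem_comp, mem_as, perm_comp, mem_id]
      simp)
    (fun f g => ext_val fun x z => by
      simp only [mem_hc, mem_comp, mem_as, mem_lu, mem_ru, mem_id, perm_id]
      simp)

lemma whiskerLeft_def (f : a ⟶ b) {g h : b ⟶ c} (η : g ⟶ h) : f ◁ η = hc (𝟙 f) η := rfl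

lemma whiskerRight_def {f g : a ⟶ b} (η : f ⟶ g) (h : b ⟶ c) : η ▷ h = hc η (𝟙 h) := rfl

end ACat

/-! ### The 2-category of an ordered monoid -/

/-- The type with one element, the object of the 2-category of the ordered monoid `S`. -/
structure OrdCat (S : Type u) where

namespace OrdCat

/-- 1-morphisms: elements of `S`. -/
structure Mor1 (S : Type u) where
  /-- the element -/
  elt : S

variable {S : Type u} [Monoid S] [PartialOrder S]

/-- Composition of 1-morphisms, in diagrammatic order. -/
instance : CategoryStruct.{u} (OrdCat S) where
  Hom _ _ := Mor1 S
  id _ := ⟨1⟩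
  comp f g := ⟨g.elt * f.elt⟩

/-- There is exactly one 2-morphism from `s` to `t` if `s ≤ t`, and none otherwise. -/
instance (a b : OrdCat S) : Category.{0} (a ⟶ b) where
  Hom f g := PLift (f.elt ≤ g.elt)
  id f := ⟨le_refl f.elt⟩
  comp α β := ⟨le_trans α.down β.down⟩

lemma hom_eq {a b : OrdCat S} {f g : a ⟶ b} (α β : f ⟶ g) : α = β := by
  have h : ∀ p q : PLift (Mor1.elt f ≤ Mor1.elt g), p = q := fun ⟨_⟩ ⟨_⟩ => rfl
  exact h α β

/-- The unique 2-isomorphism between equal 1-morphisms. -/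
def isoOfEq {a b : OrdCat S} {f g : a ⟶ b} (h : Mor1.elt f = Mor1.elt g) : f ≅ g where
  hom := ⟨le_of_eq h⟩
  inv := ⟨le_of_eq h.symm⟩
  hom_inv_id := hom_eq _ _
  inv_hom_id := hom_eq _ _

/-- The order has to be admissible: multiplication is monotone on both sides. -/
instance [MulLeftMono S] [MulRightMono S] : Bicategory.{0, u} (OrdCat S) :=
  bicategoryOfHComp (OrdCat S) (fun _ _ => inferInstance)
    (fun α β => ⟨mul_le_mul' β.down α.down⟩)
    (fun _ _ _ => isoOfEq (mul_assoc _ _ _).symm) (fun _ => isoOfEq (mul_one _))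
    (fun _ => isoOfEq (one_mul _)) (fun _ _ => hom_eq _ _) (fun _ _ _ _ => hom_eq _ _)
    (fun _ _ _ => hom_eq _ _) (fun _ => hom_eq _ _) (fun _ => hom_eq _ _)
    (fun _ _ _ _ => hom_eq _ _) (fun _ _ => hom_eq _ _)

end OrdCat

/-! ### The symmetric inverse monoid -/

/-- The symmetric inverse monoid: bijections between subsets of `Fin n`. -/
@[ext]
structure IS (n : ℕ) where
  /-- the partial bijection -/
  val : Fin n ≃. Fin n

namespace IS

variable {n : ℕ}

/-- The product `a * b` is first `b`, then `a`. -/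
instance : Monoid (IS n) where
  mul a b := ⟨b.val.trans a.val⟩
  one := ⟨PEquiv.refl _⟩
  mul_assoc a b c := IS.ext (PEquiv.trans_assoc c.val b.val a.val).symm
  one_mul a := IS.ext (PEquiv.trans_refl a.val)
  mul_one a := IS.ext (PEquiv.refl_trans a.val)

/-- The natural partial order: `s ≤ t` if and only if `s = e * t` for an idempotent `e`. -/
instance : LE (IS n) where
  le s t := ∃ e : IS n, IsIdempotentElem e ∧ s = e * t

lemma val_mul (a b : IS n) : (a * b).val = b.val.trans a.val := rfl

lemma mem_mul (a b : IS n) (x z : Fin n) :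
    z ∈ (a * b).val x ↔ ∃ y, y ∈ b.val x ∧ z ∈ a.val y := PEquiv.mem_trans _ _ _ _

lemma idem_iff (e : IS n) : IsIdempotentElem e ↔ ∀ x y, y ∈ e.val x → x = y := by
  constructor
  · intro h x y hxy
    have h1 : y ∈ (e * e).val x := by rw [h.eq]; exact hxy
    obtain ⟨z, hz, hy⟩ := (mem_mul e e x y).mp h1
    have : z = y := Option.mem_unique hz hxy
    subst this
    exact PEquiv.inj _ hxy hy
  · intro h
    refine IS.ext (PEquiv.ext fun x => Option.ext fun y => ?_)
    refine (mem_mul e e x y).trans ?_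
    constructor
    · rintro ⟨z, hz, hy⟩
      rwa [h x z hz]
    · intro hy
      have := h x y hy
      subst this
      exact ⟨x, hy, hy⟩

lemma le_iff (s t : IS n) : s ≤ t ↔ ∀ x y, y ∈ s.val x → y ∈ t.val x := by
  constructor
  · rintro ⟨e, he, rfl⟩ x y h
    obtain ⟨z, hz, hy⟩ := (mem_mul e t x y).mp h
    rwa [← (idem_iff e).mp he z y hy]
  · intro h
    refine ⟨⟨s.val.symm.trans s.val⟩, (idem_iff _).mpr ?_, ?_⟩
    · intro x y hxy
      obtain ⟨z, hz, hy⟩ := (PEquiv.mem_trans _ _ _ _).mp hxy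
      exact Option.mem_unique ((PEquiv.mem_iff_mem _).mp hz) hy
    · refine IS.ext (PEquiv.ext fun x => Option.ext fun y => ?_)
      refine Iff.trans ?_ (mem_mul _ t x y).symm
      constructor
      · intro hy
        exact ⟨y, h x y hy, (PEquiv.mem_trans _ _ _ _).mpr ⟨x, (PEquiv.mem_iff_mem _).mpr hy, hy⟩⟩
      · rintro ⟨z, hz, hy⟩
        obtain ⟨w, hw, hy⟩ := (PEquiv.mem_trans _ _ _ _).mp hy
        have hw : z ∈ s.val w := (PEquiv.mem_iff_mem _).mp hw
        have : w = x := PEquiv.inj _ (h w z hw) hz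
        subst this
        exact hy

instance : PartialOrder (IS n) where
  le_refl s := (le_iff s s).mpr fun _ _ h => h
  le_trans s t u h h' :=
    (le_iff s u).mpr fun x y hy => (le_iff t u).mp h' x y ((le_iff s t).mp h x y hy)
  le_antisymm s t h h' := IS.ext (PEquiv.ext fun x => Option.ext fun y =>
    ⟨fun hy => (le_iff s t).mp h x y hy, fun hy => (le_iff t s).mp h' x y hy⟩)

instance : MulLeftMono (IS n) where
  elim u s t h := (le_iff _ _).mpr fun x y hy => by
    obtain ⟨z, hz, hy⟩ := (mem_mul _ _ x y).mp hy
    exact (mem_mul _ _ x y).mpr ⟨z, (le_iff s t).mp h x z hz, hy⟩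

instance : MulRightMono (IS n) where
  elim u s t h := (le_iff _ _).mpr fun x y hy => by
    obtain ⟨z, hz, hy⟩ := (mem_mul _ _ x y).mp hy
    exact (mem_mul _ _ x y).mpr ⟨z, hz, (le_iff s t).mp h z y hy⟩

end IS

/-! ### Partitions -/

/-- Equivalence relations, i.e. partitions, of the disjoint union of two copies of `Fin n`;
`Sum.inl i` stands for `i` and `Sum.inr i` for `i'`. -/
abbrev Ptn (n : ℕ) : Type := Setoid (Fin n ⊕ Fin n)

namespace Ptn

variable {n : ℕ}

/-- The inclusion of the first and second layers into three layers. -/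
def i12 : Fin n ⊕ Fin n → Fin n ⊕ Fin n ⊕ Fin n := Sum.map id Sum.inl

/-- The inclusion of the second and third layers into three layers. -/
def i23 : Fin n ⊕ Fin n → Fin n ⊕ Fin n ⊕ Fin n := Sum.inr

/-- The inclusion of the first and third layers into three layers. -/
def i13 : Fin n ⊕ Fin n → Fin n ⊕ Fin n ⊕ Fin n := Sum.map id Sum.inr

/-- The finest partition of the three layers such that each part of `π` (on the first two layers)
and each part of `ρ` (on the last two layers) is contained in a part of it. -/
def glue (π ρ : Ptn n) : Setoid (Fin n ⊕ Fin n ⊕ Fin n) :=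
  sInf {t | (∀ x y, π x y → t (i12 x) (i12 y)) ∧ ∀ x y, ρ x y → t (i23 x) (i23 y)}

/-- Composition of partitions in diagrammatic order: `comp π ρ` is usually written `ρ π`. -/
def comp (π ρ : Ptn n) : Ptn n := Setoid.comap i13 (glue π ρ)

/-- The partition of a permutation `π`, with parts `{i, π(i)'}`. -/
def ofPerm (π : Equiv.Perm (Fin n)) : Ptn n := Setoid.ker (Sum.elim π id)

/-- All parts are propagating: they intersect both copies of `Fin n`. -/
def IsPropagating (α : Ptn n) : Prop :=
  ∀ u, (∃ x, α u (Sum.inl x)) ∧ ∃ y, α u (Sum.inr y)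

lemma glue_left (π ρ : Ptn n) {x y : Fin n ⊕ Fin n} (h : π x y) :
    glue π ρ (i12 x) (i12 y) := fun _ ht => ht.1 x y h

lemma glue_right (π ρ : Ptn n) {x y : Fin n ⊕ Fin n} (h : ρ x y) :
    glue π ρ (i23 x) (i23 y) := fun _ ht => ht.2 x y h

lemma glue_le {π ρ : Ptn n} {t : Setoid (Fin n ⊕ Fin n ⊕ Fin n)}
    (h : ∀ x y, π x y → t (i12 x) (i12 y)) (h' : ∀ x y, ρ x y → t (i23 x) (i23 y))
    {x y : Fin n ⊕ Fin n ⊕ Fin n} (hxy : glue π ρ x y) : t x y := hxy t ⟨h, h'⟩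

lemma comp_mono {π π' ρ ρ' : Ptn n} (h : π ≤ π') (h' : ρ ≤ ρ') : comp π ρ ≤ comp π' ρ' :=
  fun _ _ hxy => glue_le (fun _ _ e => glue_left _ _ (h e)) (fun _ _ e => glue_right _ _ (h' e)) hxy

/-- If `s` contains the restriction of `H`, then `H` and `s` together do not induce new
relations on the subset where `s` is defined. -/
lemma amalgam {K L S : Type} (H : Setoid K) (s : Setoid S) (j : K → L) (i : S → L)
    (hj : Function.Injective j)
    (hs : ∀ a b x y, j a = i x → j b = i y → H a b → s x y) :
    ∃ V : Setoid L, (∀ a b, H a b → V (j a) (j b)) ∧ (∀ x y, s x y → V (i x) (i y)) ∧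
      ∀ x y, V (i x) (i y) → i.Injective → s x y := by
  set r : L → L → Prop := fun p q => p = q ∨ ∃ a b, p = j a ∧ q = j b ∧ H a b with hr
  have rr : ∀ p, r p p := fun p => Or.inl rfl
  have rs : ∀ p q, r p q → r q p := by
    rintro p q (h | ⟨a, b, h1, h2, h⟩)
    · exact Or.inl h.symm
    · exact Or.inr ⟨b, a, h2, h1, H.symm h⟩
  have rt : ∀ p q t, r p q → r q t → r p t := by
    rintro p q t (rfl | ⟨a, b, h1, h2, h⟩) h'
    · exact h'
    · rcases h' with rfl | ⟨c, d, h3, h4, h'⟩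
      · exact Or.inr ⟨a, b, h1, h2, h⟩
      · have : b = c := hj (h2.symm.trans h3)
        subst this
        exact Or.inr ⟨a, d, h1, h4, H.trans h h'⟩
  have ri : i.Injective → ∀ x y, r (i x) (i y) → s x y := by
    rintro hi x y (h | ⟨a, b, h1, h2, h⟩)
    · exact hi h ▸ s.refl x
    · exact hs a b x y h1.symm h2.symm h
  by_cases hi : i.Injective
  · refine ⟨⟨fun u v => r u v ∨ ∃ x y, r u (i x) ∧ s x y ∧ r (i y) v, ⟨fun u => Or.inl (rr u),
      ?_, ?_⟩⟩, ?_, ?_, ?_⟩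
    · rintro u v (h | ⟨x, y, h1, h2, h3⟩)
      · exact Or.inl (rs _ _ h)
      · exact Or.inr ⟨y, x, rs _ _ h3, s.symm h2, rs _ _ h1⟩
    · rintro u v w (h | ⟨x, y, h1, h2, h3⟩) (h' | ⟨x', y', h1', h2', h3'⟩)
      · exact Or.inl (rt _ _ _ h h')
      · exact Or.inr ⟨x', y', rt _ _ _ h h1', h2', h3'⟩
      · exact Or.inr ⟨x, y, h1, h2, rt _ _ _ h3 h'⟩
      · exact Or.inr ⟨x, y', h1, s.trans h2 (s.trans (ri hi _ _ (rt _ _ _ h3 h1')) h2'), h3'⟩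
    · intro a b h
      exact Or.inl (Or.inr ⟨a, b, rfl, rfl, h⟩)
    · intro x y h
      exact Or.inr ⟨x, y, rr _, h, rr _⟩
    · rintro x y (h | ⟨x', y', h1, h2, h3⟩) -
      · exact ri hi _ _ h
      · exact s.trans (ri hi _ _ h1) (s.trans h2 (ri hi _ _ h3))
  · exact ⟨⊤, fun _ _ _ => trivial, fun _ _ _ => trivial, fun _ _ _ h => absurd h hi⟩

/-- The finest partition of four layers containing three given ones. -/
def glue3 (π ρ κ : Ptn n) : Setoid (Fin n ⊕ Fin n ⊕ Fin n ⊕ Fin n) :=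
  sInf {t | (∀ x y, π x y → t (Sum.map id Sum.inl x) (Sum.map id Sum.inl y)) ∧
    (∀ x y, ρ x y → t (Sum.inr (i12 x)) (Sum.inr (i12 y))) ∧
    ∀ x y, κ x y → t (Sum.inr (i23 x)) (Sum.inr (i23 y))}

lemma comp_comp_left (π ρ κ : Ptn n) :
    comp (comp π ρ) κ = Setoid.comap (Sum.map id (Sum.inr ∘ Sum.inr)) (glue3 π ρ κ) := by
  apply le_antisymm
  · intro x y h t ht
    have := glue_le (t := Setoid.comap (Sum.map id Sum.inr) t) (π := comp π ρ) (ρ := κ)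
      (x := i13 x) (y := i13 y) ?_ ?_ h
    · rcases x with x | x <;> rcases y with y | y <;> exact this
    · intro x y h
      have := glue_le (t := Setoid.comap (Sum.map id (Sum.map id Sum.inl)) t) (π := π) (ρ := ρ)
        (x := i13 x) (y := i13 y) ?_ ?_ h
      · rcases x with x | x <;> rcases y with y | y <;> exact this
      · intro x y h
        have := ht.1 x y h
        rcases x with x | x <;> rcases y with y | y <;> exact this
      · exact ht.2.1
    · exact ht.2.2
  · intro x y h
    obtain ⟨V, h1, h2, h3⟩ := amalgam (glue π ρ) (glue (comp π ρ) κ)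
      (Sum.map id (Sum.map id Sum.inl) : _ → Fin n ⊕ Fin n ⊕ Fin n ⊕ Fin n)
      (Sum.map id Sum.inr)
      (Sum.map_injective.mpr ⟨Function.injective_id,
        Sum.map_injective.mpr ⟨Function.injective_id, Sum.inl_injective⟩⟩) (by
        have key : ∀ (a : Fin n ⊕ Fin n ⊕ Fin n) (x : Fin n ⊕ Fin n ⊕ Fin n),
            (Sum.map id (Sum.map id Sum.inl) a : Fin n ⊕ Fin n ⊕ Fin n ⊕ Fin n) =
              Sum.map id Sum.inr x → ∃ z, a = i13 z ∧ x = i12 z := by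
          rintro (a | a | a) (x | x | x) h <;> simp at h
          · exact ⟨Sum.inl a, rfl, congrArg _ h.symm⟩
          · exact ⟨Sum.inr a, rfl, by rw [← h]; rfl⟩
        intro a b x y ha hb hab
        obtain ⟨z, rfl, rfl⟩ := key a x ha
        obtain ⟨w, rfl, rfl⟩ := key b y hb
        exact glue_left _ _ hab)
    refine h3 (i13 x) (i13 y) ?_ (Sum.map_injective.mpr ⟨Function.injective_id,
      Sum.inr_injective⟩)
    have := h V ⟨?_, ?_, ?_⟩
    · rcases x with x | x <;> rcases y with y | y <;> exact this
    · intro x y h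
      have := h1 _ _ (glue_left π ρ h)
      rcases x with x | x <;> rcases y with y | y <;> exact this
    · intro x y h
      exact h1 _ _ (glue_right π ρ h)
    · intro x y h
      exact h2 _ _ (glue_right (comp π ρ) κ h)

lemma comp_comp_right (π ρ κ : Ptn n) :
    comp π (comp ρ κ) = Setoid.comap (Sum.map id (Sum.inr ∘ Sum.inr)) (glue3 π ρ κ) := by
  apply le_antisymm
  · intro x y h t ht
    have := glue_le (t := Setoid.comap (Sum.map id i13) t) (π := π) (ρ := comp ρ κ)
      (x := i13 x) (y := i13 y) ?_ ?_ h
    · rcases x with x | x <;> rcases y with y | y <;> exact this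
    · intro x y h
      have := ht.1 x y h
      rcases x with x | x <;> rcases y with y | y <;> exact this
    · intro x y h
      exact glue_le (t := Setoid.comap Sum.inr t) (π := ρ) (ρ := κ)
        (x := i13 x) (y := i13 y) ht.2.1 ht.2.2 h
  · intro x y h
    obtain ⟨V, h1, h2, h3⟩ := amalgam (glue ρ κ) (glue π (comp ρ κ))
      (Sum.inr : _ → Fin n ⊕ Fin n ⊕ Fin n ⊕ Fin n) (Sum.map id i13) Sum.inr_injective (by
        have key : ∀ (a : Fin n ⊕ Fin n ⊕ Fin n) (x : Fin n ⊕ Fin n ⊕ Fin n),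
            (Sum.inr a : Fin n ⊕ Fin n ⊕ Fin n ⊕ Fin n) = Sum.map id i13 x →
              ∃ z, a = i13 z ∧ x = i23 z := by
          rintro a (x | x) h <;> simp at h
          exact ⟨x, h, rfl⟩
        intro a b x y ha hb hab
        obtain ⟨z, rfl, rfl⟩ := key a x ha
        obtain ⟨w, rfl, rfl⟩ := key b y hb
        exact glue_right _ _ hab)
    refine h3 (i13 x) (i13 y) ?_ (Sum.map_injective.mpr ⟨Function.injective_id,
      Sum.map_injective.mpr ⟨Function.injective_id, Sum.inr_injective⟩⟩)
    have := h V ⟨?_, ?_, ?_⟩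
    · rcases x with x | x <;> rcases y with y | y <;> exact this
    · intro x y h
      have := h2 _ _ (glue_left π (comp ρ κ) h)
      rcases x with x | x <;> rcases y with y | y <;> exact this
    · intro x y h
      exact h1 _ _ (glue_left ρ κ h)
    · intro x y h
      exact h1 _ _ (glue_right ρ κ h)

lemma comp_assoc (π ρ κ : Ptn n) : comp (comp π ρ) κ = comp π (comp ρ κ) := by
  rw [comp_comp_left, comp_comp_right]

lemma ofPerm_iff (π : Equiv.Perm (Fin n)) (u v : Fin n ⊕ Fin n) :
    ofPerm π u v ↔ Sum.elim π id u = Sum.elim π id v := Iff.rfl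

lemma ofPerm_le_iff (π : Equiv.Perm (Fin n)) (α : Ptn n) :
    ofPerm π ≤ α ↔ ∀ x, α (Sum.inl x) (Sum.inr (π x)) := by
  constructor
  · intro h x
    exact h ((ofPerm_iff _ _ _).mpr rfl)
  · intro h
    have key : ∀ u, α u (Sum.inr (Sum.elim π id u)) := by
      rintro (x | x)
      · exact h x
      · exact α.refl _
    intro u v huv
    have huv : Sum.elim π id u = Sum.elim π id v := huv
    exact α.trans (key u) (huv ▸ α.symm (key v))

lemma ofPerm_comp (π : Equiv.Perm (Fin n)) (α : Ptn n) :
    comp (ofPerm π) α = Setoid.comap (Sum.map π id) α := by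
  apply le_antisymm
  · intro u v h
    have := glue_le (t := Setoid.comap (Sum.elim (Sum.inl ∘ π) id) α) (π := ofPerm π) (ρ := α)
      (x := i13 u) (y := i13 v) ?_ ?_ h
    · rcases u with u | u <;> rcases v with v | v <;> exact this
    · intro x y h
      have h : Sum.elim π id x = Sum.elim π id y := h
      have h1 : ∀ x, Sum.elim (Sum.inl ∘ π) id (i12 x) =
          (Sum.inl (Sum.elim π id x) : Fin n ⊕ Fin n) := by
        rintro (x | x) <;> rfl
      change α _ _
      rw [h1, h1, h]
    · intro x y h
      exact h
  · intro u v h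
    have key : ∀ u, glue (ofPerm π) α (i13 u) (i23 (Sum.map π id u)) := by
      rintro (x | x)
      · exact glue_left (ofPerm π) α (x := Sum.inl x) (y := Sum.inr (π x)) rfl
      · exact Setoid.refl' _ _
    exact Setoid.trans' (glue (ofPerm π) α) (key u)
      (Setoid.trans' (glue (ofPerm π) α) (glue_right _ _ h) (Setoid.symm' _ (key v)))

lemma comp_ofPerm (α : Ptn n) (π : Equiv.Perm (Fin n)) :
    comp α (ofPerm π) = Setoid.comap (Sum.map id π.symm) α := by
  apply le_antisymm
  · intro u v h
    have := glue_le (t := Setoid.comap (Sum.map id (Sum.elim id π.symm)) α) (π := α)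
      (ρ := ofPerm π) (x := i13 u) (y := i13 v) ?_ ?_ h
    · rcases u with u | u <;> rcases v with v | v <;> exact this
    · intro x y h
      rcases x with x | x <;> rcases y with y | y <;> exact h
    · intro x y h
      have h : Sum.elim π id x = Sum.elim π id y := h
      have h1 : ∀ x, Sum.map id (Sum.elim id π.symm) (i23 x) =
          (Sum.inr (π.symm (Sum.elim π id x)) : Fin n ⊕ Fin n) := by
        rintro (x | x)
        · exact congrArg Sum.inr (π.symm_apply_apply x).symm
        · rfl
      change α _ _
      rw [h1, h1, h]
  · intro u v h
    have key : ∀ u, glue α (ofPerm π) (i13 u) (i12 (Sum.map id π.symm u)) := by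
      rintro (x | x)
      · exact Setoid.refl' _ _
      · exact glue_right α (ofPerm π) (x := Sum.inr x) (y := Sum.inl (π.symm x))
          (π.apply_symm_apply x).symm
    exact Setoid.trans' (glue α (ofPerm π)) (key u)
      (Setoid.trans' (glue α (ofPerm π)) (glue_left _ _ h) (Setoid.symm' _ (key v)))

lemma one_comp (α : Ptn n) : comp (ofPerm 1) α = α := by
  rw [ofPerm_comp]
  ext u v
  rcases u with u | u <;> rcases v with v | v <;> rfl

lemma comp_one (α : Ptn n) : comp α (ofPerm 1) = α := by
  rw [comp_ofPerm]
  ext u v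
  rcases u with u | u <;> rcases v with v | v <;> rfl

lemma ofPerm_comp_ofPerm (π σ : Equiv.Perm (Fin n)) :
    comp (ofPerm π) (ofPerm σ) = ofPerm (σ * π) := by
  rw [ofPerm_comp]
  ext u v
  rcases u with u | u <;> rcases v with v | v <;> rfl

lemma isPropagating_ofPerm (π : Equiv.Perm (Fin n)) : IsPropagating (ofPerm π) := by
  rintro (x | x)
  · exact ⟨⟨x, rfl⟩, π x, rfl⟩
  · exact ⟨⟨π.symm x, (π.apply_symm_apply x).symm⟩, x, rfl⟩

lemma IsPropagating.mono {α β : Ptn n} (h : α ≤ β) (hα : IsPropagating α) : IsPropagating β :=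
  fun u => ⟨(hα u).1.imp fun _ e => h e, (hα u).2.imp fun _ e => h e⟩

lemma IsPropagating.comp {α β : Ptn n} (hα : IsPropagating α) (hβ : IsPropagating β) :
    IsPropagating (comp α β) := by
  have key1 : ∀ x : Fin n, ∃ z, Ptn.comp α β (Sum.inl x) (Sum.inr z) := by
    intro x
    obtain ⟨y, hy⟩ := (hα (Sum.inl x)).2
    obtain ⟨z, hz⟩ := (hβ (Sum.inl y)).2
    exact ⟨z, Setoid.trans' (glue α β) (glue_left α β hy) (glue_right α β hz)⟩
  have key2 : ∀ z : Fin n, ∃ x, Ptn.comp α β (Sum.inr z) (Sum.inl x) := by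
    intro z
    obtain ⟨y, hy⟩ := (hβ (Sum.inr z)).1
    obtain ⟨x, hx⟩ := (hα (Sum.inr y)).1
    exact ⟨x, Setoid.trans' (glue α β) (glue_right α β hy) (glue_left α β hx)⟩
  rintro (x | x)
  · exact ⟨⟨x, Setoid.refl' _ _⟩, key1 x⟩
  · exact ⟨key2 x, x, Setoid.refl' _ _⟩

/-- The interchange law, for partitions `α`, `α'` coarser than a common permutation. -/
lemma comp_sup {α α' β β' : Ptn n} {f : Equiv.Perm (Fin n)} (h1 : ofPerm f ≤ α)
    (h2 : ofPerm f ≤ α') :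
    comp (α ⊔ α') (β ⊔ β') = comp α β ⊔ comp α' β' := by
  apply le_antisymm
  · set t := comp α β ⊔ comp α' β' with ht
    -- the third layer is kept, and the second one is identified with the first one along `f`
    have hα : ∀ γ δ : Ptn n, ofPerm f ≤ γ → comp γ δ ≤ t → γ ≤
        Setoid.comap (Sum.elim Sum.inl (Sum.inl ∘ f.symm)) t := by
      intro γ δ hf hle u v huv
      have key : ∀ u, glue γ δ (i12 u)
          (i13 (Sum.elim Sum.inl (Sum.inl ∘ f.symm) u)) := by
        rintro (x | x)
        · exact Setoid.refl' _ _
        · have := (ofPerm_le_iff f γ).mp hf (f.symm x)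
          rw [f.apply_symm_apply] at this
          exact glue_left _ _ (γ.symm this)
      exact hle (Setoid.trans' (glue γ δ) (Setoid.symm' _ (key u))
        (Setoid.trans' (glue γ δ) (glue_left _ _ huv) (key v)))
    have hβ : ∀ γ δ : Ptn n, ofPerm f ≤ γ → comp γ δ ≤ t → δ ≤
        Setoid.comap (Sum.map f.symm id) t := by
      intro γ δ hf hle u v huv
      have key : ∀ u, glue γ δ (i23 u) (i13 (Sum.map f.symm id u)) := by
        rintro (x | x)
        · have := (ofPerm_le_iff f γ).mp hf (f.symm x)
          rw [f.apply_symm_apply] at this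
          exact glue_left _ _ (γ.symm this)
        · exact Setoid.refl' _ _
      exact hle (Setoid.trans' (glue γ δ) (Setoid.symm' _ (key u))
        (Setoid.trans' (glue γ δ) (glue_right _ _ huv) (key v)))
    intro u v huv
    have := glue_le (t := Setoid.comap
      (Sum.elim Sum.inl (Sum.map f.symm id)) t) (π := α ⊔ α') (ρ := β ⊔ β')
      (x := i13 u) (y := i13 v) ?_ ?_ huv
    · rcases u with u | u <;> rcases v with v | v <;> exact this
    · intro x y h
      have := sup_le (hα α β h1 le_sup_left) (hα α' β' h2 le_sup_right) h
      rcases x with x | x <;> rcases y with y | y <;> exact this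
    · intro x y h
      exact sup_le (hβ α β h1 le_sup_left) (hβ α' β' h2 le_sup_right) h
  · exact sup_le (comp_mono le_sup_left le_sup_left) (comp_mono le_sup_right le_sup_right)

end Ptn

/-! ### The 2-category `B_n` -/

/-- The type with one element, the object of the second 2-category extending the symmetric
group. -/
structure BCat (n : ℕ) where

namespace BCat

variable {n : ℕ}

open Ptn

/-- 1-morphisms: elements of the symmetric group. -/
structure Mor1 (n : ℕ) where
  /-- the permutation -/
  perm : Equiv.Perm (Fin n)

/-- 2-morphisms from `f` to `g`: propagating partitions coarser than both `f` and `g`. -/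
@[ext]
structure Mor2 (f g : Mor1 n) where
  /-- the partition -/
  val : Ptn n
  propagating : IsPropagating val
  left_le : ofPerm f.perm ≤ val
  right_le : ofPerm g.perm ≤ val

/-- Composition of 1-morphisms, in diagrammatic order. -/
instance : CategoryStruct (BCat n) where
  Hom _ _ := Mor1 n
  id _ := ⟨1⟩
  comp f g := ⟨g.perm * f.perm⟩

/-- Vertical composition is the join. -/
instance (a b : BCat n) : Category (a ⟶ b) where
  Hom f g := Mor2 f g
  id f := ⟨ofPerm f.perm, isPropagating_ofPerm _, le_rfl, le_rfl⟩
  comp α β := ⟨β.val ⊔ α.val, α.propagating.mono le_sup_right, le_sup_of_le_right α.left_le,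
    le_sup_of_le_left β.right_le⟩
  id_comp α := Mor2.ext (sup_eq_left.mpr α.left_le)
  comp_id α := Mor2.ext (sup_eq_right.mpr α.right_le)
  assoc _ _ _ := Mor2.ext (sup_assoc _ _ _).symm

variable {a b c d : BCat n}

/-- The partition underlying a 2-morphism. -/
def val {f g : a ⟶ b} (α : f ⟶ g) : Ptn n := Mor2.val α

/-- The permutation underlying a 1-morphism. -/
def perm (f : a ⟶ b) : Equiv.Perm (Fin n) := Mor1.perm f

lemma ext_val {f g : a ⟶ b} {α β : f ⟶ g} (h : val α = val β) : α = β := Mor2.ext h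

lemma left_le {f g : a ⟶ b} (α : f ⟶ g) : ofPerm (perm f) ≤ val α := Mor2.left_le α

lemma right_le {f g : a ⟶ b} (α : f ⟶ g) : ofPerm (perm g) ≤ val α := Mor2.right_le α

lemma val_id (f : a ⟶ b) : val (𝟙 f) = ofPerm (perm f) := rfl

lemma val_comp {f g h : a ⟶ b} (α : f ⟶ g) (β : g ⟶ h) : val (α ≫ β) = val β ⊔ val α := rfl

lemma perm_id : perm (𝟙 a) = 1 := rfl

lemma perm_comp (f : a ⟶ b) (g : b ⟶ c) : perm (f ≫ g) = perm g * perm f := rfl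

/-- Horizontal composition is composition of partitions. -/
def hc {f f' : a ⟶ b} {g g' : b ⟶ c} (α : f ⟶ f') (β : g ⟶ g') : f ≫ g ⟶ f' ≫ g' :=
  Mor2.mk (Ptn.comp (val α) (val β))
    ((Mor2.propagating α).comp (Mor2.propagating β))
    ((ofPerm_comp_ofPerm (perm f) (perm g)).symm.le.trans (comp_mono (left_le α) (left_le β)))
    ((ofPerm_comp_ofPerm (perm f') (perm g')).symm.le.trans
      (comp_mono (right_le α) (right_le β)))

lemma val_hc {f f' : a ⟶ b} {g g' : b ⟶ c} (α : f ⟶ f') (β : g ⟶ g') :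
    val (hc α β) = Ptn.comp (val α) (val β) := rfl

/-- The identity 2-isomorphism between equal 1-morphisms. -/
def isoOfEq {f g : a ⟶ b} (h : perm f = perm g) : f ≅ g where
  hom := Mor2.mk (ofPerm (perm f)) (isPropagating_ofPerm _) le_rfl (by rw [h]; exact le_rfl)
  inv := Mor2.mk (ofPerm (perm f)) (isPropagating_ofPerm _) (by rw [h]; exact le_rfl) le_rfl
  hom_inv_id := Mor2.ext (sup_idem _)
  inv_hom_id := Mor2.ext ((sup_idem _).trans (congrArg ofPerm h))

lemma val_isoOfEq {f g : a ⟶ b} (h : perm f = perm g) :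
    val (isoOfEq h).hom = ofPerm (perm f) := rfl

/-- The associator, an identity. -/
def as' (f : a ⟶ b) (g : b ⟶ c) (h : c ⟶ d) : (f ≫ g) ≫ h ≅ f ≫ g ≫ h :=
  isoOfEq (mul_assoc (perm h) (perm g) (perm f)).symm

/-- The left unitor, an identity. -/
def lu (f : a ⟶ b) : 𝟙 a ≫ f ≅ f := isoOfEq (mul_one (perm f))

/-- The right unitor, an identity. -/
def ru (f : a ⟶ b) : f ≫ 𝟙 b ≅ f := isoOfEq (one_mul (perm f))

lemma val_as (f : a ⟶ b) (g : b ⟶ c) (h : c ⟶ d) :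
    val (as' f g h).hom = ofPerm (perm ((f ≫ g) ≫ h)) := rfl

lemma val_lu (f : a ⟶ b) : val (lu f).hom = ofPerm (perm f) := rfl

lemma val_ru (f : a ⟶ b) : val (ru f).hom = ofPerm (perm f) := rfl

instance : Bicategory (BCat n) :=
  bicategoryOfHComp (BCat n) (fun _ _ => inferInstance) hc as' lu ru
    (fun f g => ext_val (ofPerm_comp_ofPerm _ _))
    (fun η η' θ θ' => ext_val
      (comp_sup (left_le η') (right_le η)))
    (fun {_ _ _ _ f f' g g' h h'} η θ κ => ext_val (by
      rw [val_comp, val_comp, val_as, val_as, val_hc, val_hc, val_hc, val_hc,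
        ← comp_assoc]
      have h1 : ofPerm (perm ((f' ≫ g') ≫ h')) ≤
          Ptn.comp (Ptn.comp (val η) (val θ)) (val κ) := right_le (hc (hc η θ) κ)
      have h2 : ofPerm (perm ((f ≫ g) ≫ h)) ≤
          Ptn.comp (Ptn.comp (val η) (val θ)) (val κ) := left_le (hc (hc η θ) κ)
      rw [sup_eq_right.mpr h1, sup_eq_left.mpr h2]))
    (fun {_ _ f f'} η => ext_val (by
      rw [val_comp, val_comp, val_lu, val_lu, val_hc, val_id, perm_id, one_comp, sup_eq_right.mpr (right_le η),
        sup_eq_left.mpr (left_le η)]))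
    (fun {_ _ f f'} η => ext_val (by
      rw [val_comp, val_comp, val_ru, val_ru, val_hc, val_id, perm_id, comp_one, sup_eq_right.mpr (right_le η),
        sup_eq_left.mpr (left_le η)]))
    (fun f g h i => ext_val (by
      simp only [val_comp, val_hc, val_as, val_id, perm_comp, ofPerm_comp_ofPerm, mul_assoc,
        sup_idem]))
    (fun f g => ext_val (by
      simp only [val_comp, val_hc, val_as, val_lu, val_ru, val_id, perm_comp, perm_id, ofPerm_comp_ofPerm,
        one_mul, sup_idem]))

lemma whiskerLeft_def (f : a ⟶ b) {g h : b ⟶ c} (η : g ⟶ h) : f ◁ η = hc (𝟙 f) η := rfl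

lemma whiskerRight_def {f g : a ⟶ b} (η : f ⟶ g) (h : b ⟶ c) : η ▷ h = hc η (𝟙 h) := rfl

end BCat

/-! ### The maximal factorizable submonoid of the dual symmetric inverse monoid -/

/-- The dual symmetric inverse monoid: propagating partitions, i.e. bijections between quotients
of `Fin n`. -/
@[ext]
structure PP (n : ℕ) where
  /-- the partition -/
  val : Ptn n
  propagating : Ptn.IsPropagating val

namespace PP

variable {n : ℕ}

open Ptn

/-- The product `a * b` is first `b`, then `a`. -/
instance : Monoid (PP n) where
  mul a b := ⟨Ptn.comp b.val a.val, b.propagating.comp a.propagating⟩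
  one := ⟨ofPerm 1, isPropagating_ofPerm 1⟩
  mul_assoc a b c := PP.ext (comp_assoc c.val b.val a.val).symm
  one_mul a := PP.ext (comp_one a.val)
  mul_one a := PP.ext (one_comp a.val)

/-- A permutation as a propagating partition. -/
def ofPerm (σ : Equiv.Perm (Fin n)) : PP n := ⟨Ptn.ofPerm σ, isPropagating_ofPerm σ⟩

lemma val_mul (a b : PP n) : (a * b).val = Ptn.comp b.val a.val := rfl

lemma val_one : (1 : PP n).val = Ptn.ofPerm 1 := rfl

lemma ofPerm_mul (σ τ : Equiv.Perm (Fin n)) : ofPerm (σ * τ) = ofPerm σ * ofPerm τ :=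
  PP.ext (ofPerm_comp_ofPerm τ σ).symm

lemma ofPerm_one : ofPerm (1 : Equiv.Perm (Fin n)) = 1 := rfl

lemma le_comp_left {α β : Ptn n} (h : Ptn.ofPerm 1 ≤ β) : α ≤ Ptn.comp α β := by
  conv_lhs => rw [← comp_one α]
  exact comp_mono le_rfl h

lemma le_comp_right {α β : Ptn n} (h : Ptn.ofPerm 1 ≤ α) : β ≤ Ptn.comp α β := by
  conv_lhs => rw [← one_comp β]
  exact comp_mono h le_rfl

/-- For partitions coarser than the identity, the product is the join. -/
lemma comp_eq_sup {α β : Ptn n} (h : Ptn.ofPerm 1 ≤ α) (h' : Ptn.ofPerm 1 ≤ β) :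
    Ptn.comp α β = α ⊔ β := by
  apply le_antisymm
  · have := comp_sup (β := Ptn.ofPerm 1) (β' := β) h le_rfl
    rw [comp_one, one_comp] at this
    exact (comp_mono le_sup_left le_sup_right).trans this.le
  · exact sup_le (le_comp_left h') (le_comp_right h)

lemma idem_iff (e : PP n) : IsIdempotentElem e ↔ Ptn.ofPerm 1 ≤ e.val := by
  constructor
  · intro he
    have he : Ptn.comp e.val e.val = e.val := congrArg PP.val he.eq
    refine (ofPerm_le_iff _ _).mpr fun z => ?_
    obtain ⟨v, hv⟩ := (e.propagating (Sum.inr z)).1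
    obtain ⟨w, hw⟩ := (e.propagating (Sum.inl z)).2
    have h : Ptn.comp e.val e.val (Sum.inl v) (Sum.inr w) :=
      Setoid.trans' (glue e.val e.val) (glue_left _ _ (Setoid.symm' _ hv)) (glue_right _ _ hw)
    rw [he] at h
    exact Setoid.trans' _ hw (Setoid.trans' _ (Setoid.symm' _ h) (Setoid.symm' _ hv))
  · intro h
    refine PP.ext ?_
    rw [val_mul, comp_eq_sup h h, sup_idem]

lemma ofPerm_inv_mul (σ : Equiv.Perm (Fin n)) (a : PP n) : ofPerm σ * (ofPerm σ⁻¹ * a) = a := by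
  rw [← mul_assoc, ← ofPerm_mul, mul_inv_cancel, ofPerm_one, one_mul]

lemma exists_perm_iff (a : PP n) :
    (∃ (σ : Equiv.Perm (Fin n)) (e : PP n), IsIdempotentElem e ∧ a = ofPerm σ * e) ↔
      ∃ σ : Equiv.Perm (Fin n), Ptn.ofPerm σ ≤ a.val := by
  constructor
  · rintro ⟨σ, e, he, rfl⟩
    exact ⟨σ, le_comp_right ((idem_iff e).mp he)⟩
  · rintro ⟨σ, h⟩
    refine ⟨σ, ofPerm σ⁻¹ * a, (idem_iff _).mpr ?_, (ofPerm_inv_mul σ a).symm⟩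
    have := comp_mono h (le_refl (Ptn.ofPerm σ⁻¹))
    rwa [ofPerm_comp_ofPerm, inv_mul_cancel] at this

end PP

/-- The maximal factorizable submonoid of the dual symmetric inverse monoid: products of a
permutation and an idempotent. -/
def Fstar (n : ℕ) : Submonoid (PP n) where
  carrier := {a | ∃ (σ : Equiv.Perm (Fin n)) (e : PP n), IsIdempotentElem e ∧ a = PP.ofPerm σ * e}
  mul_mem' {a b} ha hb := by
    obtain ⟨σ, hσ⟩ := (PP.exists_perm_iff a).mp ha
    obtain ⟨τ, hτ⟩ := (PP.exists_perm_iff b).mp hb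
    refine (PP.exists_perm_iff _).mpr ⟨σ * τ, ?_⟩
    rw [← Ptn.ofPerm_comp_ofPerm]
    exact Ptn.comp_mono hτ hσ
  one_mem' := (PP.exists_perm_iff 1).mpr ⟨1, le_rfl⟩

namespace Fstar

variable {n : ℕ}

/-- The natural partial order: `s ≤ t` if and only if `s = e * t` for an idempotent `e`. -/
instance : LE (Fstar n) where
  le s t := ∃ e : Fstar n, IsIdempotentElem e ∧ s = e * t

/-- The partition underlying an element. -/
def part (s : Fstar n) : Ptn n := PP.val s.1

lemma ext_part {s t : Fstar n} (h : part s = part t) : s = t := Subtype.ext (PP.ext h)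

lemma part_mul (s t : Fstar n) : part (s * t) = Ptn.comp (part t) (part s) := rfl

lemma idem_iff (e : Fstar n) : IsIdempotentElem e ↔ Ptn.ofPerm 1 ≤ part e :=
  Subtype.ext_iff.trans (PP.idem_iff e.1)

/-- The natural partial order is reverse refinement. -/
lemma le_iff (s t : Fstar n) : s ≤ t ↔ part t ≤ part s := by
  constructor
  · rintro ⟨e, he, rfl⟩
    exact PP.le_comp_left ((idem_iff e).mp he)
  · intro h
    obtain ⟨σ, hσ⟩ := (PP.exists_perm_iff t.1).mp t.2
    have hσ : Ptn.ofPerm σ ≤ part t := hσ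
    have h1 : Ptn.ofPerm 1 ≤ Ptn.comp (Ptn.ofPerm σ⁻¹) (part t) := by
      have := Ptn.comp_mono (le_refl (Ptn.ofPerm σ⁻¹)) hσ
      rwa [Ptn.ofPerm_comp_ofPerm, mul_inv_cancel] at this
    have h2 : Ptn.comp (Ptn.ofPerm σ⁻¹) (part t) ≤ Ptn.comp (Ptn.ofPerm σ⁻¹) (part s) :=
      Ptn.comp_mono le_rfl h
    have hm : PP.mk (Ptn.comp (Ptn.ofPerm σ⁻¹) (part s))
        ((Ptn.isPropagating_ofPerm _).comp s.1.propagating) ∈ Fstar n :=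
      (PP.exists_perm_iff _).mpr ⟨1, h1.trans h2⟩
    refine ⟨⟨_, hm⟩, (idem_iff _).mpr (h1.trans h2), ext_part ?_⟩
    have h3 : ∀ α : Ptn n, Ptn.comp (Ptn.ofPerm σ) (Ptn.comp (Ptn.ofPerm σ⁻¹) α) = α := by
      intro α
      rw [← Ptn.comp_assoc, Ptn.ofPerm_comp_ofPerm, inv_mul_cancel, Ptn.one_comp]
    change part s = Ptn.comp (part t) (Ptn.comp (Ptn.ofPerm σ⁻¹) (part s))
    conv_rhs => rw [← h3 (part t)]
    rw [Ptn.comp_assoc, PP.comp_eq_sup h1 (h1.trans h2), sup_eq_right.mpr h2, h3]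

instance : PartialOrder (Fstar n) where
  le_refl s := (le_iff s s).mpr le_rfl
  le_trans s t u h h' := (le_iff s u).mpr (((le_iff t u).mp h').trans ((le_iff s t).mp h))
  le_antisymm s t h h' := ext_part (le_antisymm ((le_iff t s).mp h') ((le_iff s t).mp h))

instance : MulLeftMono (Fstar n) where
  elim _ s t h := (le_iff _ _).mpr (Ptn.comp_mono ((le_iff s t).mp h) le_rfl)

instance : MulRightMono (Fstar n) where
  elim _ s t h := (le_iff _ _).mpr (Ptn.comp_mono le_rfl ((le_iff s t).mp h))

end Fstar

end TwoCat
end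

noncomputable section

namespace TwoCat

universe w v u

/-! The fiat half. In `ACat n` and `BCat n` there is an obvious `⋆`: invert permutations, and
transpose relations or exchange the two rows of partitions. A permutation is an invertible
1-morphism, so identity 2-morphisms serve as unit and counit of an adjunction between `f` and its
inverse. The work lies in carrying this structure through linearisation, additive envelope,
idempotent completion and splitting of identities.

For this to be possible, `Duality` demands more than fiatness does. First, `⋆` of a 2-morphism must
be its mate under the chosen adjunctions (`coev_nat`, `ev_nat`). This allows the adjunction of `F`
to be cut down by an idempotent `p` of `F` and the idempotent `⋆p` of `⋆F` (`Duality.coev_idem`,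
`Duality.left_triangle_comp`). Secondly, `⋆` must act trivially on the 2-endomorphisms of
identities, up to the unit constraint (`map_unit`). Then `⋆` takes a corner to the opposite corner
with the same idempotents (`Duality.inCorner_star`), so it still preserves objects after the
identities are split.

The finitary half. Morphism spaces are finite dimensional, so by Fitting's lemma an endomorphism
ring without nontrivial idempotents is local (`isLocalRing_of_idem`). Splitting idempotents, by
induction on the dimension of the endomorphism algebra, yields Krull-Schmidt decompositions
(`hasLocalDecomposition`). Finiteness of the set of indecomposables follows once every object is a
retract of a finite direct sum of objects from a finite list (`isFinitaryCat_of_generators`). For a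
finitarisation the list consists of the original 1-morphisms; for a corner it consists of the corner
parts of a list for the whole morphism category. Splitting creates only finitely many objects: the
algebra of 2-endomorphisms of an identity is commutative, so distinct primitive idempotents are
orthogonal and therefore linearly independent. The new identities are indecomposable because the
idempotents are primitive; for an ordered monoid the 2-endomorphism algebra of the identity is
already `k`.

The negative half. Both monoids contain an element `z` with `t * z = z` for all `t` and not `1 ≤ z`:
the empty partial bijection, and the one-block partition when `n ≥ 2`. A unit of an adjunction for
`z` would have entries spanned by 2-morphisms `1 ⟶ t * z = z`, of which there are none. Hence it is
zero, and the triangle identity makes the identity 2-morphism of `z` vanish, which is false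
(`OrdCat.not_isFiat`). -/

/-! ### Finite dimensional algebras without nontrivial idempotents -/

/-- Fitting's lemma for elements of a finite dimensional algebra. -/
lemma exists_idem_of_finite (k : Type*) [Field k] {A : Type*} [Ring A] [Algebra k A]
    [Module.Finite k A] (a : A) :
    ∃ (m : ℕ) (y : A), Commute a y ∧ IsIdempotentElem (a ^ m * y ^ m) ∧
      a ^ m * (a ^ m * y ^ m) = a ^ m ∧ a ^ (m + 1) * y = a ^ m := by
  -- Inside the commutative subalgebra generated by `a` the computations are ring identities, and
  -- the element `y` found below commutes with `a`.
  let S := Algebra.adjoin k {a}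
  have : IsMulCommutative S := Algebra.isMulCommutative_adjoin k (by simp)
  have : IsArtinianRing S := IsArtinianRing.of_finite k S
  let b : S := ⟨a, Algebra.subset_adjoin rfl⟩
  -- The ideals generated by the powers of `b` form a descending chain, which stabilises: `b ^ m` is
  -- a multiple of `b ^ (m + 1)`.
  obtain ⟨m, y, hy⟩ := IsArtinian.exists_pow_succ_smul_dvd (M := S) b 1
  have hy : b ^ (m + 1) * y = b ^ m := by simpa [smul_eq_mul] using hy
  have key : ∀ j, b ^ (m + j) * y ^ j = b ^ m := by
    intro j
    induction j with
    | zero => simp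
    | succ j ih =>
      calc b ^ (m + (j + 1)) * y ^ (j + 1) = b ^ j * y ^ j * (b ^ (m + 1) * y) := by ring
        _ = b ^ (m + j) * y ^ j := by rw [hy]; ring
        _ = _ := ih
  have h1 : b ^ m * (b ^ m * y ^ m) = b ^ m := by
    rw [← mul_assoc, ← pow_add, key]
  have h2 : (b ^ m * y ^ m) * (b ^ m * y ^ m) = b ^ m * y ^ m := by
    calc (b ^ m * y ^ m) * (b ^ m * y ^ m) = b ^ m * (b ^ m * y ^ m) * y ^ m := by ring
      _ = _ := by rw [h1]
  refine ⟨m, y, congrArg Subtype.val (mul_comm b y), ?_, ?_, ?_⟩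
  · exact congrArg Subtype.val h2
  · exact congrArg Subtype.val h1
  · exact congrArg Subtype.val hy

/-- Fitting's idempotent attached to `a` is `0` or `1`. In the first case `a` is nilpotent and `1 -
a` is a unit; in the second a power of `a`, hence `a` itself, is invertible. -/
lemma isLocalRing_of_idem (k : Type*) [Field k] {A : Type*} [Ring A] [Algebra k A]
    [Module.Finite k A] [Nontrivial A] (h : ∀ e : A, IsIdempotentElem e → e = 0 ∨ e = 1) :
    IsLocalRing A where
  isUnit_or_isUnit_of_add_one {a b} hab := by
    obtain ⟨m, y, hc, hi, h1, h2⟩ := exists_idem_of_finite k a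
    rcases h _ hi with h0 | h0
    · right
      rw [h0, mul_zero] at h1
      have : IsNilpotent a := ⟨m, h1.symm⟩
      rw [← sub_eq_iff_eq_add'.mpr hab.symm]
      exact this.isUnit_one_sub
    · left
      have hu : IsUnit (a ^ m) := by
        have hc' : Commute (a ^ m) (y ^ m) := hc.pow_pow m m
        exact ⟨⟨a ^ m, y ^ m, h0, by rw [← hc'.eq, h0]⟩, rfl⟩
      have h3 : a * y = 1 := by
        rw [pow_succ, mul_assoc] at h2
        exact hu.mul_left_cancel (by rw [h2, mul_one])
      exact ⟨⟨a, y, h3, by rw [← hc.eq, h3]⟩, rfl⟩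

lemma comp_sum_comp {C : Type u} [Category.{v} C] [Preadditive C] {X Y Z : C} {J : Type*}
    (s : Finset J) {W : J → C} (f : X ⟶ Y) (g : ∀ j, Y ⟶ W j) (h : ∀ j, W j ⟶ Y) (l : Y ⟶ Z) :
    ∑ j ∈ s, (f ≫ g j) ≫ h j ≫ l = f ≫ (∑ j ∈ s, g j ≫ h j) ≫ l := by
  simp [Preadditive.sum_comp, Preadditive.comp_sum]

/-! ### Krull-Schmidt decompositions -/

section KrullSchmidt

variable {C : Type u} [Category.{v} C] [Preadditive C]

/-- The object is a finite direct sum of objects with local endomorphism rings. -/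
def HasLocalDecomposition (X : C) : Prop :=
  ∃ (J : Type) (_ : Fintype J) (Y : J → C) (i : ∀ j, Y j ⟶ X) (p : ∀ j, X ⟶ Y j),
    (∀ j, IsLocalRing (End (Y j))) ∧ (∀ j, i j ≫ p j = 𝟙 _) ∧
    (∀ j l, j ≠ l → i j ≫ p l = 0) ∧ ∑ j, p j ≫ i j = 𝟙 X

lemma HasLocalDecomposition.sum {X Y Z : C} {i : Y ⟶ X} {p : X ⟶ Y} {i' : Z ⟶ X} {p' : X ⟶ Z}
    (h : i ≫ p = 𝟙 Y) (h' : i' ≫ p' = 𝟙 Z) (h0 : i ≫ p' = 0) (h0' : i' ≫ p = 0)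
    (hs : p ≫ i + p' ≫ i' = 𝟙 X) (hY : HasLocalDecomposition Y) (hZ : HasLocalDecomposition Z) :
    HasLocalDecomposition X := by
  obtain ⟨J, _, U, a, b, h1, h2, h3, h4⟩ := hY
  obtain ⟨K, _, V, c, d, g1, g2, g3, g4⟩ := hZ
  refine ⟨J ⊕ K, inferInstance, Sum.elim U V,
    fun j => Sum.rec (motive := fun j => Sum.elim U V j ⟶ X) (fun j => a j ≫ i) (fun j => c j ≫ i') j,
    fun j => Sum.rec (motive := fun j => X ⟶ Sum.elim U V j) (fun j => p ≫ b j) (fun j => p' ≫ d j) j,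
    ?_, ?_, ?_, ?_⟩
  · rintro (j | j)
    exacts [h1 j, g1 j]
  · rintro (j | j)
    · change (a j ≫ i) ≫ p ≫ b j = 𝟙 _
      rw [Category.assoc, reassoc_of% h, h2]
    · change (c j ≫ i') ≫ p' ≫ d j = 𝟙 _
      rw [Category.assoc, reassoc_of% h', g2]
  · rintro (j | j) (l | l) hjl
    · change (a j ≫ i) ≫ p ≫ b l = 0
      rw [Category.assoc, reassoc_of% h, h3 _ _ fun e => hjl (congrArg _ e)]
    · change (a j ≫ i) ≫ p' ≫ d l = 0
      rw [Category.assoc, reassoc_of% h0, zero_comp, comp_zero]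
    · change (c j ≫ i') ≫ p ≫ b l = 0
      rw [Category.assoc, reassoc_of% h0', zero_comp, comp_zero]
    · change (c j ≫ i') ≫ p' ≫ d l = 0
      rw [Category.assoc, reassoc_of% h', g3 _ _ fun e => hjl (congrArg _ e)]
  · rw [Fintype.sum_sum_type]
    change ∑ j, (p ≫ b j) ≫ a j ≫ i + ∑ j, (p' ≫ d j) ≫ c j ≫ i' = _
    have e1 : ∑ j, (p ≫ b j) ≫ a j ≫ i = p ≫ i := by
      rw [comp_sum_comp, h4, Category.id_comp]
    have e2 : ∑ j, (p' ≫ d j) ≫ c j ≫ i' = p' ≫ i' := by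
      rw [comp_sum_comp, g4, Category.id_comp]
    rw [e1, e2, hs]

/-- Both `e` and `1 - e` split. The mixed composites vanish because inserting the two idempotents
between them produces `e (1 - e) = 0`. -/
lemma exists_split_pair [IsIdempotentComplete C] {X : C} (e : X ⟶ X) (he : e ≫ e = e) :
    ∃ (Y Z : C) (i : Y ⟶ X) (p : X ⟶ Y) (i' : Z ⟶ X) (p' : X ⟶ Z), i ≫ p = 𝟙 Y ∧ i' ≫ p' = 𝟙 Z ∧
      i ≫ p' = 0 ∧ i' ≫ p = 0 ∧ p ≫ i = e ∧ p' ≫ i' = 𝟙 X - e := by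
  obtain ⟨Y, i, p, h1, h2⟩ := IsIdempotentComplete.idempotents_split _ e he
  obtain ⟨Z, i', p', h3, h4⟩ := IsIdempotentComplete.idempotents_split _ (𝟙 X - e) (by
    simp [he])
  refine ⟨Y, Z, i, p, i', p', h1, h3, ?_, ?_, h2, h4⟩
  · have : i ≫ p' = (i ≫ p) ≫ (i ≫ p') ≫ i' ≫ p' := by rw [h1, h3]; simp
    rw [this]
    simp only [Category.assoc]
    rw [reassoc_of% h4, Preadditive.sub_comp, Preadditive.comp_sub, ← h2]
    simp [reassoc_of% h1]
  · have : i' ≫ p = (i' ≫ p') ≫ (i' ≫ p) ≫ i ≫ p := by rw [h1, h3]; simp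
    rw [this]
    simp only [Category.assoc]
    rw [reassoc_of% h4, reassoc_of% h2, Preadditive.sub_comp, Preadditive.comp_sub, ← h2]
    simp [h1]

/-- Conjugation `f ↦ p ≫ f ≫ i` embeds the endomorphisms of `Y` into those of `X`, and its image
misses the identity: if `p ≫ f ≫ i = 𝟙 X`, then multiplying by `p ≫ i` gives `p ≫ i = 𝟙 X`. This
strict drop is what makes the splitting process terminate. -/
lemma finrank_end_lt (k : Type*) [Field k] [Linear k C] {X Y : C} [Module.Finite k (X ⟶ X)]
    (i : Y ⟶ X) (p : X ⟶ Y) (h : i ≫ p = 𝟙 Y) (hne : p ≫ i ≠ 𝟙 X) :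
    Module.finrank k (Y ⟶ Y) < Module.finrank k (X ⟶ X) := by
  let φ : (Y ⟶ Y) →ₗ[k] (X ⟶ X) :=
    { toFun := fun f => p ≫ f ≫ i
      map_add' := fun f g => by simp
      map_smul' := fun r f => by simp }
  have hφ : Function.Injective φ := by
    intro f g hfg
    have hfg : p ≫ f ≫ i = p ≫ g ≫ i := hfg
    have := congrArg (fun t => i ≫ t ≫ p) hfg
    simpa [h, reassoc_of% h] using this
  rw [← LinearMap.finrank_range_of_inj hφ]
  apply Submodule.finrank_lt
  intro htop
  have h1 : 𝟙 X ∈ LinearMap.range φ := htop ▸ Submodule.mem_top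
  obtain ⟨f, hf⟩ := h1
  have hf : p ≫ f ≫ i = 𝟙 X := hf
  apply hne
  calc p ≫ i = (p ≫ i) ≫ p ≫ f ≫ i := by rw [hf, Category.comp_id]
    _ = p ≫ f ≫ i := by rw [Category.assoc, reassoc_of% h]
    _ = 𝟙 X := hf

/-- Strong induction on the dimension of the endomorphism algebra: a nontrivial idempotent splits
`X` into two retracts with strictly smaller algebras, and without one the algebra is local. The zero
object is the empty sum. -/
lemma hasLocalDecomposition (k : Type*) [Field k] [Linear k C] [IsIdempotentComplete C]
    (hf : ∀ X Y : C, Module.Finite k (X ⟶ Y)) (X : C) : HasLocalDecomposition X := by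
  induction hn : Module.finrank k (X ⟶ X) using Nat.strong_induction_on generalizing X with
  | _ n ih =>
    by_cases h0 : 𝟙 X = 0
    · exact ⟨Empty, inferInstance, Empty.elim, fun j => j.elim, fun j => j.elim,
        fun j => j.elim, fun j => j.elim, fun j => j.elim, by simp [h0]⟩
    by_cases hid : ∀ e : X ⟶ X, e ≫ e = e → e = 0 ∨ e = 𝟙 X
    · have := hf X X
      have : Module.Finite k (End X) := hf X X
      have : Nontrivial (End X) := ⟨𝟙 X, 0, h0⟩
      refine ⟨PUnit, inferInstance, fun _ => X, fun _ => 𝟙 X, fun _ => 𝟙 X, fun _ => ?_, ?_, ?_, ?_⟩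
      · exact isLocalRing_of_idem k (A := End X) fun e he => hid e he
      · simp
      · intro j l hjl; exact absurd rfl hjl
      · simp
    · push Not at hid
      obtain ⟨e, he, hne, hne'⟩ := hid
      obtain ⟨Y, Z, i, p, i', p', h1, h2, h3, h4, h5, h6⟩ := exists_split_pair e he
      have := hf X X
      refine HasLocalDecomposition.sum h1 h2 h3 h4 (by rw [h5, h6]; abel) (ih _ ?_ Y rfl)
        (ih _ ?_ Z rfl)
      · rw [← hn]
        exact finrank_end_lt k i p h1 (by rwa [h5])
      · rw [← hn]
        exact finrank_end_lt k i' p' h2 (by rw [h6]; simpa using hne)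

/-- An object with a local endomorphism ring which is a retract of a finite direct sum is a retract
of a summand. -/
lemma exists_isUnit_of_sum_comp {X : C} [IsLocalRing (End X)] {J : Type*} [Fintype J] {Y : J → C}
    (i : ∀ j, X ⟶ Y j) (p : ∀ j, Y j ⟶ X) (h : IsIso (∑ j, i j ≫ p j)) :
    ∃ j, IsIso (i j ≫ p j) := by
  obtain ⟨j, -, hj⟩ := IsLocalRing.exists_of_isUnit_sum (R := End X) (s := Finset.univ)
    (f := fun j => i j ≫ p j) ((isUnit_iff_isIso _).mpr h)
  exact ⟨j, (isUnit_iff_isIso _).mp hj⟩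

/-- One of `e` and `1 - e` is a unit, and an invertible idempotent is the identity. -/
lemma idem_of_isLocalRing {X : C} [IsLocalRing (End X)] (e : X ⟶ X) (he : e ≫ e = e) :
    e = 0 ∨ e = 𝟙 X := by
  have h : e + (𝟙 X - e) = 𝟙 X := by abel
  rcases IsLocalRing.isUnit_or_isUnit_of_add_one (R := End X) h with h | h
  · right
    have := (isUnit_iff_isIso _).mp h
    rw [← cancel_epi e, he, Category.comp_id]
  · left
    have := (isUnit_iff_isIso _).mp h
    rw [← cancel_mono (𝟙 X - e), Preadditive.comp_sub, he]
    simp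

/-- A nonzero retract of an object with local endomorphism ring is isomorphic to it. -/
lemma nonempty_iso_of_isIso_comp {X Y : C} [IsLocalRing (End X)] [IsLocalRing (End Y)]
    (i : X ⟶ Y) (p : Y ⟶ X) (h : IsIso (i ≫ p)) : Nonempty (X ≅ Y) := by
  set q := p ≫ inv (i ≫ p) with hq
  have h1 : i ≫ q = 𝟙 X := by rw [hq, ← Category.assoc, IsIso.hom_inv_id]
  have h2 : (q ≫ i) ≫ (q ≫ i) = q ≫ i := by rw [Category.assoc, reassoc_of% h1]
  rcases idem_of_isLocalRing _ h2 with h3 | h3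
  · exfalso
    have : (𝟙 X : End X) = 0 := by
      rw [← Category.id_comp (𝟙 X), ← h1, Category.assoc, reassoc_of% h3]
      simp
    exact one_ne_zero (α := End X) this
  · exact ⟨⟨i, q, h1, h3⟩⟩

/-- A decomposition of `X` as a biproduct gives two orthogonal idempotents with sum `𝟙 X`, and a
summand whose idempotent vanishes is zero. The hypothesis has the shape of the primitivity condition
in `IsPrimitiveIdem`, so that it can be fed from there. -/
lemma indecomposable_of_idem [HasBinaryBiproducts C] {X : C} (h0 : 𝟙 X ≠ 0)
    (h : ∀ f g : X ⟶ X, f ≫ f = f → g ≫ g = g → f ≫ g = 0 → g ≫ f = 0 → f + g = 𝟙 X →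
      f = 0 ∨ g = 0) : Indecomposable X := by
  refine ⟨fun hz => h0 (hz.eq_of_src _ _), fun Y Z φ => ?_⟩
  have key : ∀ {W : C} (i : W ⟶ X) (p : X ⟶ W), i ≫ p = 𝟙 W → p ≫ i = 0 → IsZero W := by
    intro W i p h1 h2
    rw [IsZero.iff_id_eq_zero, ← Category.id_comp (𝟙 W), ← h1, Category.assoc, reassoc_of% h2]
    simp
  rcases h (φ.hom ≫ biprod.fst ≫ biprod.inl ≫ φ.inv) (φ.hom ≫ biprod.snd ≫ biprod.inr ≫ φ.inv)
    (by simp) (by simp) (by simp) (by simp) (by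
      have : biprod.fst ≫ biprod.inl + biprod.snd ≫ biprod.inr = 𝟙 (Y ⊞ Z) := biprod.total
      rw [← Preadditive.comp_add, ← φ.hom_inv_id]
      congr 1
      rw [← Category.assoc biprod.fst, ← Category.assoc biprod.snd, ← Preadditive.add_comp, this,
        Category.id_comp]) with h1 | h1
  · exact Or.inl (key (biprod.inl ≫ φ.inv) (φ.hom ≫ biprod.fst) (by simp) (by simpa using h1))
  · exact Or.inr (key (biprod.inr ≫ φ.inv) (φ.hom ≫ biprod.snd) (by simp) (by simpa using h1))

/-- An idempotent `e` splits `X` into the images of `e` and `1 - e`. One of them is zero by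
indecomposability, so `e` is `0` or `1`, and Fitting's lemma applies. -/
lemma isLocalRing_end_of_indecomposable (k : Type*) [Field k] [Linear k C]
    [IsIdempotentComplete C] [HasBinaryBiproducts C] {X : C} [Module.Finite k (X ⟶ X)]
    (hX : Indecomposable X) : IsLocalRing (End X) := by
  have : Module.Finite k (End X) := inferInstanceAs (Module.Finite k (X ⟶ X))
  have : Nontrivial (End X) := ⟨𝟙 X, 0, fun h => hX.1 ((IsZero.iff_id_eq_zero X).mpr h)⟩
  refine isLocalRing_of_idem k (A := End X) fun e he => ?_
  obtain ⟨Y, Z, i, p, i', p', h1, h2, h3, h4, h5, h6⟩ := exists_split_pair (X := X) e he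
  have hs : p ≫ i + p' ≫ i' = 𝟙 X := by rw [h5, h6]; exact add_sub_cancel _ _
  rcases hX.2 Y Z ⟨biprod.lift p p', biprod.desc i i', by simp [hs],
    by ext <;> simp [h1, h2, h3, h4]⟩ with h | h
  · left
    change (e : X ⟶ X) = 0
    rw [← h5, h.eq_of_src i 0, comp_zero]
  · right
    change (e : X ⟶ X) = 𝟙 X
    rw [← hs, h5, h.eq_of_src i' 0, comp_zero, add_zero]

/-- A hom-finite linear category with split idempotents and finite biproducts is finitary as soon
as all objects are retracts of finite direct sums of objects from a finite list. -/
theorem isFinitaryCat_of_generators (k : Type*) [Field k] [Linear k C] [HasFiniteBiproducts C]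
    [IsIdempotentComplete C] (hf : ∀ X Y : C, Module.Finite k (X ⟶ Y)) {ι : Type*} [Finite ι]
    (c : ι → C)
    (hc : ∀ X : C, ∃ (J : Type) (_ : Fintype J) (f : J → ι) (i : ∀ j, X ⟶ c (f j))
      (p : ∀ j, c (f j) ⟶ X), ∑ j, i j ≫ p j = 𝟙 X) : IsFinitaryCat k C where
  additive := inferInstance
  idempotentSplit := inferInstance
  krullSchmidt X := by
    obtain ⟨J, _, Y, i, p, h1, h2, h3, h4⟩ := hasLocalDecomposition k hf X
    let e := (Fintype.equivFin J).symm
    refine ⟨Fintype.card J, fun j => Y (e j), fun j => h1 _, ⟨biproduct.lift fun j => p (e j),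
      biproduct.desc fun j => i (e j), ?_, ?_⟩⟩
    · rw [biproduct.lift_desc, ← h4]
      exact Equiv.sum_comp e fun j => p j ≫ i j
    · ext j l
      by_cases h : j = l
      · subst h
        simp [h2]
      · simp [h3 _ _ fun h' => h (e.injective h').symm, biproduct.ι_π_ne _ (Ne.symm h)]
  finiteIndecomposables := by
    have := hasBinaryBiproducts_of_finite_biproducts C
    -- The finite list of candidates consists of all local summands of all generators.
    choose J inst Y i p h1 h2 h3 h4 using fun x => hasLocalDecomposition k hf (c x)
    let e := (Finite.equivFin (Σ x, J x)).symm
    refine ⟨_, fun l => Y (e l).1 (e l).2, fun X hX => ?_⟩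
    have := hf X X
    have hl := isLocalRing_end_of_indecomposable k hX
    obtain ⟨K, _, f, a, b, hab⟩ := hc X
    -- Locality is used twice: among the factorisations of `𝟙 X` through generators one is
    -- invertible, and when that generator is decomposed, one of the factorisations through its
    -- local summands is invertible too. This exhibits `X` as a retract of that summand.
    obtain ⟨j, hj⟩ := exists_isUnit_of_sum_comp a b (by rw [hab]; infer_instance)
    have hs : ∑ l, (a j ≫ p (f j) l) ≫ i (f j) l ≫ b j = a j ≫ b j := by
      rw [comp_sum_comp, h4, Category.id_comp]
    obtain ⟨l, hl⟩ := exists_isUnit_of_sum_comp (fun l => a j ≫ p (f j) l)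
      (fun l => i (f j) l ≫ b j) (by rw [hs]; exact hj)
    have := h1 (f j) l
    refine ⟨e.symm ⟨f j, l⟩, ?_⟩
    change Nonempty (X ≅ Y (e (e.symm ⟨f j, l⟩)).1 (e (e.symm ⟨f j, l⟩)).2)
    rw [Equiv.apply_symm_apply]
    exact nonempty_iso_of_isIso_comp _ _ hl
  finiteHom := hf

lemma indecomposable_of_isLocalRing [HasBinaryBiproducts C] {X : C} [IsLocalRing (End X)] :
    Indecomposable X := by
  refine indecomposable_of_idem (one_ne_zero (α := End X)) fun f g hf _ _ _ hs => ?_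
  rcases idem_of_isLocalRing f hf with h | h
  · exact Or.inl h
  · right
    rwa [h, add_eq_left] at hs

/-- Converse of `isFinitaryCat_of_generators`: Krull-Schmidt summands are indecomposable, hence
appear in the finite list. In the generator form the property transfers to corner categories. -/
lemma IsFinitaryCat.exists_generators {k : Type*} [Field k] [Linear k C] (h : IsFinitaryCat k C) :
    ∃ (m : ℕ) (c : Fin m → C), ∀ X : C, ∃ (J : Type) (_ : Fintype J) (f : J → Fin m)
      (i : ∀ j, X ⟶ c (f j)) (p : ∀ j, c (f j) ⟶ X), ∑ j, i j ≫ p j = 𝟙 X := by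
  have := h.additive
  have := hasBinaryBiproducts_of_finite_biproducts C
  obtain ⟨m, c, hc⟩ := h.finiteIndecomposables
  refine ⟨m, c, fun X => ?_⟩
  obtain ⟨r, Y, hY, ⟨φ⟩⟩ := h.krullSchmidt X
  choose f hf using fun j => hc (Y j) (have := hY j; indecomposable_of_isLocalRing)
  have e := fun j => (hf j).some
  refine ⟨Fin r, inferInstance, f, fun j => φ.hom ≫ biproduct.π Y j ≫ (e j).hom,
    fun j => (e j).inv ≫ biproduct.ι Y j ≫ φ.inv, ?_⟩
  have h1 := comp_sum_comp Finset.univ φ.hom (fun j => biproduct.π Y j)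
    (fun j => biproduct.ι Y j) φ.inv
  rw [biproduct.total, Category.id_comp, Iso.hom_inv_id] at h1
  simpa using h1

end KrullSchmidt

/-! ### Finitarisations are prefinitary -/

section

variable (k : Type*) [Field k] {C : Type u} [Category.{v} C] [Preadditive C] [Linear k C]

open CategoryTheory.Idempotents

instance MatAux.finite_hom [∀ X Y : C, Module.Finite k (X ⟶ Y)] (M N : Mat_ C) :
    Module.Finite k (M ⟶ N) :=
  inferInstanceAs (Module.Finite k (∀ (i : M.ι) (j : N.ι), M.X i ⟶ N.X j))

instance karoubi_finite_hom [∀ X Y : C, Module.Finite k (X ⟶ Y)] (P Q : Karoubi C) :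
    Module.Finite k (P ⟶ Q) := by
  let φ : (P ⟶ Q) →ₗ[k] (P.X ⟶ Q.X) :=
    { toFun := fun f => f.f
      map_add' := fun _ _ => rfl
      map_smul' := fun _ _ => rfl }
  exact Module.Finite.of_injective φ fun f g h => Karoubi.hom_ext _ _ h

/-- The object of the additive envelope given by an object. -/
def matSingle (X : C) : Mat_ C := ⟨PUnit.{1}, fun _ => X⟩

open Classical in
/-- The projection of a formal direct sum to one of its summands. -/
def matProj (M : Mat_ C) (j : M.ι) : M ⟶ matSingle (M.X j) :=
  fun i _ => if h : i = j then eqToHom (congrArg M.X h) else 0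

open Classical in
/-- The inclusion of a summand into a formal direct sum. -/
def matIncl (M : Mat_ C) (j : M.ι) : matSingle (M.X j) ⟶ M :=
  fun _ i => if h : j = i then eqToHom (congrArg M.X h) else 0

lemma matProj_matIncl (M : Mat_ C) : ∑ j, matProj M j ≫ matIncl M j = 𝟙 M := by
  classical
  ext i l
  have h1 : (∑ j, matProj M j ≫ matIncl M j) i l = ∑ j, (matProj M j ≫ matIncl M j) i l := by
    exact (congrFun (Finset.sum_apply (M := fun i => ∀ l, M.X i ⟶ M.X l) i Finset.univ
      (fun j => matProj M j ≫ matIncl M j)) l).trans (Finset.sum_apply _ _ _)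
  have h2 : ∀ j, (matProj M j ≫ matIncl M j) i l = matProj M j i PUnit.unit ≫
      matIncl M j PUnit.unit l := fun j =>
    Fintype.sum_unique (ι := PUnit.{1}) fun x => matProj M j i x ≫ matIncl M j x l
  rw [h1]
  simp only [h2]
  rw [Finset.sum_eq_single i]
  · by_cases h : i = l
    · subst h
      simp [matProj, matIncl, matSingle]
    · simp [matIncl, h, Mat_.id_apply_of_ne]
  · intro j _ hj
    simp [matProj, hj.symm]
  · simp

/-- The generators are the objects of `C`, seen as one-term sums with the identity idempotent; every
pair of a formal sum and an idempotent is a retract of a sum of these. -/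
theorem isFinitaryCat_karoubi_mat [Finite C] [∀ X Y : C, Module.Finite k (X ⟶ Y)] :
    IsFinitaryCat k (Karoubi (Mat_ C)) := by
  refine isFinitaryCat_of_generators k inferInstance
    (fun X : C => (⟨matSingle X, 𝟙 _, Category.comp_id _⟩ : Karoubi (Mat_ C))) fun P => ?_
  refine ⟨P.X.ι, inferInstance, P.X.X, fun j => ⟨P.p ≫ matProj P.X j, by simp [P.idem_assoc]⟩,
    fun j => ⟨matIncl P.X j ≫ P.p, by simp [P.idem]⟩, ?_⟩
  -- The identity of an object of the idempotent completion is its idempotent, so the claim is that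
  -- the identity matrix, written as the sum over the summands, sandwiched between two copies of
  -- `P.p`, gives `P.p`.
  ext1
  rw [Karoubi.sum_hom]
  change ∑ j, (P.p ≫ matProj P.X j) ≫ matIncl P.X j ≫ P.p = P.p
  rw [comp_sum_comp, matProj_matIncl, Category.id_comp, P.idem]

end

section

variable (k : Type*) [Field k]

instance Lin.finite {C : Type*} [Finite C] : Finite (Lin k C) :=
  Finite.of_injective (fun X : Lin k C => X.as) fun ⟨_⟩ ⟨_⟩ h => congrArg _ h

instance Lin.finite_hom {C : Type*} [Category C] [∀ X Y : C, Finite (X ⟶ Y)] (X Y : Lin k C) :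
    Module.Finite k (X ⟶ Y) :=
  inferInstanceAs (Module.Finite k ((X.as ⟶ Y.as) →₀ k))

variable (B : Type u) [Bicategory.{w, v} B]

theorem isPrefinitary_finitarization [Finite B] [∀ a b : B, Finite (a ⟶ b)]
    [∀ (a b : B) (f g : a ⟶ b), Finite (f ⟶ g)] : IsPrefinitary k (Finitarization k B) where
  finiteObjects := Finite.of_injective (fun a : Finitarization k B => a.as.as.as)
    fun ⟨⟨⟨_⟩⟩⟩ ⟨⟨⟨_⟩⟩⟩ h => by cases h; rfl
  finitaryHom a b :=
    isFinitaryCat_karoubi_mat k (C := Lin k (a.as.as.as ⟶ b.as.as.as))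

end

/-- Conjugation `f ↦ p ≫ f ≫ i` is injective and multiplicative and sends `𝟙 R` to `e`, so a
decomposition of `𝟙 R` into orthogonal idempotents becomes one of `e`. -/
lemma IsPrimitiveIdem.of_retract {C : Type u} [Category.{v} C] [Preadditive C] {X R : C}
    {e : X ⟶ X} (he : IsPrimitiveIdem e) (i : R ⟶ X) (p : X ⟶ R) (h : i ≫ p = 𝟙 R)
    (h' : p ≫ i = e) : 𝟙 R ≠ 0 ∧ ∀ f g : R ⟶ R, f ≫ f = f → g ≫ g = g → f ≫ g = 0 →
      g ≫ f = 0 → f + g = 𝟙 R → f = 0 ∨ g = 0 := by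
  constructor
  · intro h0
    apply he.ne_zero
    rw [← h', ← Category.id_comp i, h0, zero_comp, comp_zero]
  · intro f g hf hg hfg hgf hs
    have hT : ∀ f g : R ⟶ R, (p ≫ f ≫ i) ≫ p ≫ g ≫ i = p ≫ (f ≫ g) ≫ i := fun f g => by
      simp only [Category.assoc, reassoc_of% h]
    have hT0 : ∀ f : R ⟶ R, p ≫ f ≫ i = 0 → f = 0 := by
      intro f hf
      have : i ≫ (p ≫ f ≫ i) ≫ p = f := by simp [h, reassoc_of% h]
      rw [← this, hf, zero_comp, comp_zero]
    refine (he.primitive (p ≫ f ≫ i) (p ≫ g ≫ i) (by rw [hT, hf]) (by rw [hT, hg])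
      (by rw [hT, hfg, zero_comp, comp_zero]) (by rw [hT, hgf, zero_comp, comp_zero]) ?_).imp
      (hT0 f) (hT0 g)
    rw [← Preadditive.comp_add, ← Preadditive.add_comp, hs, Category.id_comp, h']

/-! ### Splitting identities in a prefinitary 2-category -/

namespace SplitBicat

variable {B : Type u} [Bicategory.{w, v} B]

/-- Eckmann-Hilton: cutting by `f` is natural in 2-morphisms, and on the identity 1-morphism it is
`f` itself. -/
lemma end_id_comm {a : B} (f g : 𝟙 a ⟶ 𝟙 a) : f ≫ g = g ≫ f := by
  have := cutLeft_naturality f g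
  rwa [cutLeft_id] at this

/-- The cutting 2-endomorphisms are natural, so they can be slid along `i` onto `F`, where they act
as the identity. -/
lemma inCorner_of_retract {a b : B} {e : 𝟙 a ⟶ 𝟙 a} {e' : 𝟙 b ⟶ 𝟙 b} {F G : a ⟶ b} (i : G ⟶ F)
    (p : F ⟶ G) (h : i ≫ p = 𝟙 G) (hF : InCorner e e' F) : InCorner e e' G := by
  have hF : cutLeft e F ≫ cutRight F e' = 𝟙 F := hF
  change cutLeft e G ≫ cutRight G e' = 𝟙 G
  rw [← Category.comp_id (cutRight G e'), ← h, ← Category.assoc (cutRight G e'),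
    cutRight_naturality, Category.assoc, ← Category.assoc, cutLeft_naturality, Category.assoc,
    reassoc_of% hF]

variable (k : Type*) [Field k] [PreaddBicategory B] [LinBicategory k B]

/-- By commutativity `e = e f + (e - e f)` is a decomposition into orthogonal idempotents, so
primitivity of `e` leaves `e f = 0` or `e f = e`. Exchanging the roles gives `e f = 0` or `e f = f`.
-/
lemma eq_or_comp_eq_zero {a : B} {e f : 𝟙 a ⟶ 𝟙 a} (he : IsPrimitiveIdem e)
    (hf : IsPrimitiveIdem f) : e = f ∨ e ≫ f = 0 := by
  have key : ∀ {e f : 𝟙 a ⟶ 𝟙 a}, IsPrimitiveIdem e → IsPrimitiveIdem f → e ≫ f = 0 ∨ e ≫ f = e := by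
    intro e f he hf
    have h1 : e ≫ f ≫ e = e ≫ f := by rw [end_id_comm f e, ← Category.assoc, he.idem]
    have h2 : (e ≫ f) ≫ e ≫ f = e ≫ f := by
      rw [Category.assoc, ← Category.assoc f, end_id_comm f e, Category.assoc, hf.idem,
        ← Category.assoc, he.idem]
    rcases he.primitive (e ≫ f) (e - e ≫ f) h2
      (by simp [he.idem, h1, h2, reassoc_of% he.idem])
      (by simp [h1, h2]) (by simp [h2, reassoc_of% he.idem]) (by abel) with h | h
    · exact Or.inl h
    · exact Or.inr (sub_eq_zero.mp h).symm
  rcases key he hf with h | h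
  · exact Or.inr h
  · rcases key hf he with h' | h'
    · exact Or.inr (by rw [end_id_comm, h'])
    · exact Or.inl (by rw [← h, end_id_comm, h'])

/-- Distinct primitive idempotents are orthogonal, so multiplying a linear relation by one of them
isolates its coefficient. They are linearly independent in a finite dimensional space. -/
lemma finite_primitive (a : B) [Module.Finite k (𝟙 a ⟶ 𝟙 a)] :
    Finite {e : 𝟙 a ⟶ 𝟙 a // IsPrimitiveIdem e} := by
  have h : LinearIndependent k fun e : {e : 𝟙 a ⟶ 𝟙 a // IsPrimitiveIdem e} => e.1 := by
    rw [linearIndependent_iff']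
    intro s c hc e he
    have h1 : (∑ f ∈ s, c f • f.1) ≫ e.1 = c e • e.1 := by
      rw [Preadditive.sum_comp, Finset.sum_eq_single e]
      · rw [Linear.smul_comp, e.2.idem]
      · intro f _ hf
        rw [Linear.smul_comp, (eq_or_comp_eq_zero f.2 e.2).resolve_left
          (fun h => hf (Subtype.ext h)), smul_zero]
      · exact fun h => absurd he h
    rw [hc, zero_comp] at h1
    exact (smul_eq_zero.mp h1.symm).resolve_right e.2.ne_zero
  exact h.finite

variable [∀ a b : B, IsIdempotentComplete (a ⟶ b)]

/-- The corner category inherits finite biproducts. -/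
lemma hasFiniteBiproducts (a b : SplitBicat B) [HasFiniteBiproducts (a.obj ⟶ b.obj)] :
    HasFiniteBiproducts (a ⟶ b) where
  out n := ⟨fun X => by
    -- The biproduct is formed in the ambient category. By naturality of the cuts, membership in the
    -- corner can be tested after each projection.
    have hc : InCorner a.e b.e (⨁ fun j => u1 (X j)) := by
      change cutLeft a.e _ ≫ cutRight _ b.e = 𝟙 _
      refine biproduct.hom_ext _ _ fun j => ?_
      have hX : cutLeft a.e (u1 (X j)) ≫ cutRight (u1 (X j)) b.e = 𝟙 (u1 (X j)) := (X j).property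
      rw [Category.assoc, cutRight_naturality, ← Category.assoc, cutLeft_naturality,
        Category.assoc, hX, Category.comp_id, Category.id_comp]
    let Y : a ⟶ b := ⟨_, hc⟩
    exact hasBiproduct_of_total (f := X)
      { pt := Y
        π := fun j => mk2 (F := Y) (G := X j) (biproduct.π (fun j => u1 (X j)) j)
        ι := fun j => mk2 (F := X j) (G := Y) (biproduct.ι (fun j => u1 (X j)) j)
        ι_π := fun j j' => by
          by_cases h : j = j'
          · subst h
            rw [dif_pos rfl]
            exact ext_u2 (biproduct.ι_π_self (fun j => u1 (X j)) j)
          · rw [dif_neg h]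
            exact ext_u2 (biproduct.ι_π_ne (fun j => u1 (X j)) h) } (by
        let φ : (Y ⟶ Y) →+ (u1 Y ⟶ u1 Y) := AddMonoidHom.mk' u2 fun _ _ => rfl
        refine ext_u2 ((map_sum φ _ _).trans ?_)
        exact biproduct.total (f := fun j => u1 (X j)))⟩

lemma isIdempotentComplete_hom (a b : SplitBicat B) : IsIdempotentComplete (a ⟶ b) where
  idempotents_split F e he := by
    obtain ⟨Y, i, p, h1, h2⟩ := IsIdempotentComplete.idempotents_split (u1 F) (u2 e)
      (congrArg u2 he)
    exact ⟨⟨Y, inCorner_of_retract i p h1 F.property⟩, mk2 i, mk2 p, ext_u2 h1, ext_u2 h2⟩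

lemma finite_hom (a b : SplitBicat B) (hf : ∀ F G : a.obj ⟶ b.obj, Module.Finite k (F ⟶ G))
    (F G : a ⟶ b) : Module.Finite k (F ⟶ G) := by
  let φ : (F ⟶ G) →ₗ[k] (u1 F ⟶ u1 G) :=
    { toFun := u2
      map_add' := fun _ _ => rfl
      map_smul' := fun _ _ => rfl }
  have := hf (u1 F) (u1 G)
  exact Module.Finite.of_injective φ fun f g h => ext_u2 h

/-- The corner parts of a list of generators of the ambient category generate the corner category.
-/
theorem isFinitaryCat_hom (a b : SplitBicat B) (h : IsFinitaryCat k (a.obj ⟶ b.obj)) :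
    IsFinitaryCat k (a ⟶ b) := by
  have := h.additive
  have := hasFiniteBiproducts a b
  have := isIdempotentComplete_hom a b
  obtain ⟨m, c, hc⟩ := h.exists_generators
  choose c' i p h1 h2 h3 using fun x => exists_corner a b (c x)
  refine isFinitaryCat_of_generators k (finite_hom k a b h.finiteHom)
    (fun x => (⟨c' x, h1 x⟩ : a ⟶ b)) fun X => ?_
  obtain ⟨J, _, f, r, s, hrs⟩ := hc (u1 X)
  refine ⟨J, inferInstance, f, fun j => mk2 (r j ≫ p (f j)), fun j => mk2 (i (f j) ≫ s j), ?_⟩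
  let φ : (X ⟶ X) →+ (u1 X ⟶ u1 X) := AddMonoidHom.mk' u2 fun _ _ => rfl
  refine ext_u2 ((map_sum φ _ _).trans ?_)
  change ∑ j, (r j ≫ p (f j)) ≫ i (f j) ≫ s j = 𝟙 _
  have hX : cutLeft a.e (u1 X) ≫ cutRight (u1 X) b.e = 𝟙 _ := X.property
  -- Passing through the corner part of a generator inserts the cutting idempotent in the middle. By
  -- naturality it slides back to `X`, where it is the identity because `X` lies in the corner.
  have key : ∀ j, (r j ≫ p (f j)) ≫ i (f j) ≫ s j = r j ≫ s j := by
    intro j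
    rw [Category.assoc, reassoc_of% h3, ← Category.assoc, ← cutLeft_naturality, Category.assoc,
      ← reassoc_of% cutRight_naturality, reassoc_of% hX]
  simp only [key, hrs]

/-- The identity 1-morphism is the image of a primitive idempotent, so its endomorphism algebra
admits no nontrivial orthogonal decomposition of the identity. -/
lemma indecomposable_one (a : SplitBicat B) [HasBinaryBiproducts (a ⟶ a)] :
    Indecomposable (𝟙 a) := by
  have h := a.prim.of_retract a.incl a.proj a.incl_proj a.proj_incl
  refine indecomposable_of_idem (fun h0 => h.1 (congrArg u2 h0)) fun f g hf hg hfg hgf hs => ?_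
  exact (h.2 (u2 f) (u2 g) (congrArg u2 hf) (congrArg u2 hg) (congrArg u2 hfg)
    (congrArg u2 hgf) (congrArg u2 hs)).imp ext_u2 ext_u2

/-- Finiteness of the set of objects combines finitely many original objects with `finite_primitive`
for each of them; the other two conditions are checked in the corners. -/
theorem isFinitary (hB : IsPrefinitary k B) : IsFinitary k (SplitBicat B) where
  finiteObjects := by
    have := hB.finiteObjects
    have : ∀ a : B, Finite {e : 𝟙 a ⟶ 𝟙 a // IsPrimitiveIdem e} := fun a =>
      have := (hB.finitaryHom a a).finiteHom (𝟙 a) (𝟙 a)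
      finite_primitive k a
    exact Finite.of_injective
      (fun a : SplitBicat B => (⟨a.obj, a.e, a.prim⟩ : Σ a : B, {e : 𝟙 a ⟶ 𝟙 a // IsPrimitiveIdem e}))
      fun ⟨_, _, _⟩ ⟨_, _, _⟩ h => by cases h; rfl
  finitaryHom a b := isFinitaryCat_hom k a b (hB.finitaryHom a.obj b.obj)
  indecomposableId a := by
    have := (isFinitaryCat_hom k a a (hB.finitaryHom a.obj a.obj)).additive
    have := hasBinaryBiproducts_of_finite_biproducts (a ⟶ a)
    exact indecomposable_one a

end SplitBicat

/-! ### The 2-categories of ordered monoids -/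

namespace OrdCat

variable {S : Type u} [Monoid S] [PartialOrder S]

instance : Finite (OrdCat S) :=
  Finite.of_injective (fun _ : OrdCat S => PUnit.unit) fun ⟨⟩ ⟨⟩ _ => rfl

instance [Finite S] (a b : OrdCat S) : Finite (a ⟶ b) :=
  Finite.of_injective (fun f : a ⟶ b => Mor1.elt f) fun ⟨_⟩ ⟨_⟩ h => congrArg _ h

instance {a b : OrdCat S} (f g : a ⟶ b) : Subsingleton (f ⟶ g) := ⟨hom_eq⟩

variable [MulLeftMono S] [MulRightMono S] (k : Type*) [Field k]

/-- A 1-morphism as a 1-morphism of the finitarisation. -/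
def single {a b : Finitarization k (OrdCat S)} (f : a.as.as.as ⟶ b.as.as.as) : a ⟶ b :=
  ⟨matSingle (C := Lin k (a.as.as.as ⟶ b.as.as.as)) ⟨f⟩, 𝟙 _, Category.comp_id _⟩

/-- The only matrix entry of this identity is a standard basis vector of the linearised morphism
space. -/
lemma id_ne_zero {a b : Finitarization k (OrdCat S)} (f : a.as.as.as ⟶ b.as.as.as) :
    𝟙 (single k f : a ⟶ b) ≠ 0 := by
  intro h
  have h1 : KarBicat.un (𝟙 (single k f : a ⟶ b)) = 0 :=
    congrArg KarBicat.un h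
  have h2 : (Finsupp.single (𝟙 f) (1 : k) : (f ⟶ f) →₀ k) = 0 :=
    (MatBicat.entry_id (B := LinBicat k (OrdCat S)) (a := a.as) (b := b.as)
      (single k f).X PUnit.unit).symm.trans (congrFun (congrFun h1 PUnit.unit) PUnit.unit)
  exact one_ne_zero (Finsupp.single_eq_zero.mp h2)

/-- The identity 1-morphism is a one-term sum with the identity idempotent, and `1 ≤ 1` provides
just one basis vector, so its endomorphism algebra is `k`. -/
lemma exists_smul_id {a : Finitarization k (OrdCat S)} (η : 𝟙 a ⟶ 𝟙 a) :
    ∃ r : k, η = r • 𝟙 (𝟙 a) := by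
  let x : (𝟙 a.as.as.as ⟶ 𝟙 a.as.as.as) →₀ k := KarBicat.un η PUnit.unit PUnit.unit
  refine ⟨x (𝟙 _), KarBicat.ext_un ?_⟩
  refine MatBicat.ext_entry (B := LinBicat k (OrdCat S)) (a := a.as) (b := a.as) ?_
  rintro ⟨⟩ ⟨⟩
  have h : x = x (𝟙 _) • Finsupp.single (𝟙 (𝟙 a.as.as.as)) (1 : k) := by
    ext y
    rw [Subsingleton.elim y (𝟙 _)]
    simp
  refine h.trans ?_
  exact congrArg (x (𝟙 _) • ·) (MatBicat.entry_id (𝟙 a.as) PUnit.unit).symm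

/-- The 2-endomorphisms of the identity are scalars, and two scalars with product zero are not both
nonzero; no splitting of identities is needed. -/
theorem isFinitary [Finite S] : IsFinitary k (Finitarization k (OrdCat S)) where
  toIsPrefinitary := isPrefinitary_finitarization k (OrdCat S)
  indecomposableId a := by
    have h := (isPrefinitary_finitarization k (OrdCat S)).finitaryHom a a
    have := h.additive
    have := hasBinaryBiproducts_of_finite_biproducts (a ⟶ a)
    have h0 : 𝟙 (𝟙 a) ≠ 0 := id_ne_zero k (a := a) (b := a) (𝟙 _)
    refine indecomposable_of_idem h0 fun f g _ _ hfg _ _ => ?_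
    obtain ⟨r, rfl⟩ := exists_smul_id k f
    obtain ⟨s, rfl⟩ := exists_smul_id k g
    rw [Linear.smul_comp, Category.id_comp, smul_smul] at hfg
    rcases mul_eq_zero.mp ((smul_eq_zero.mp hfg).resolve_right h0) with h | h
    · exact Or.inl (by rw [h, zero_smul])
    · exact Or.inr (by rw [h, zero_smul])

/-- An element `z` with `t * z = z` for all `t` has no right adjoint unless `1 ≤ z`. -/
theorem not_isFiat (z : S) (hz : ∀ t, t * z = z) (h1 : ¬ 1 ≤ z) :
    ¬ IsFiat k (Finitarization k (OrdCat S)) := by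
  rintro ⟨-, D, hD⟩
  let a : Finitarization k (OrdCat S) := ⟨⟨⟨⟨⟩⟩⟩⟩
  let f : a.as.as.as ⟶ a.as.as.as := Mor1.mk z
  let F : a ⟶ a := single k f
  obtain ⟨adj⟩ := hD a a F
  -- Each entry of the unit is a linear combination of 2-morphisms `1 ⟶ t * z`, where `t` is a
  -- summand of the formal sum underlying `⋆F`. Such a 2-morphism means `1 ≤ t * z = z`, so there is
  -- none and every coefficient vanishes.
  have hu : adj.unit = 0 := by
    refine KarBicat.ext_un ?_
    refine MatBicat.ext_entry (B := LinBicat k (OrdCat S)) (a := a.as) (b := a.as) ?_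
    rintro ⟨⟩ ⟨⟨⟩, j⟩
    refine Finsupp.ext fun x => (h1 ?_).elim
    have hx : 1 ≤ _ * z := PLift.down x
    rwa [hz] at hx
  have ht := adj.left_triangle
  rw [hu] at ht
  have h0 : leftZigzag (0 : 𝟙 a ⟶ F ≫ D.star F) adj.counit = 0 := by
    have : (0 : 𝟙 a ⟶ F ≫ D.star F) ▷ F = 0 :=
      (AddMonoidHom.mk' (fun η : 𝟙 a ⟶ F ≫ D.star F => η ▷ F)
        fun η θ => PreaddBicategory.add_whiskerRight η θ F).map_zero
    rw [leftZigzag, this, bicategoricalComp, zero_comp]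
  rw [h0] at ht
  apply id_ne_zero k (a := a) (b := a) f
  -- The left triangle identity equates the zero zigzag with the invertible 2-morphism composed of
  -- the unitors; conjugating it to an endomorphism of `F` gives `𝟙 F = 0`.
  have h2 : 𝟙 F = (λ_ F).inv ≫ ((λ_ F).hom ≫ (ρ_ F).inv) ≫ (ρ_ F).hom := by simp
  rw [← ht, zero_comp, comp_zero] at h2
  exact h2

end OrdCat

/-! ### Finiteness of the two monoids, and their elements without right adjoints -/

instance (n : ℕ) : Finite (IS n) :=
  Finite.of_injective (fun s : IS n => (s.val : Fin n → Option (Fin n))) fun _ _ h =>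
    IS.ext (PEquiv.ext fun x => congrFun h x)

instance (n : ℕ) : Finite (Ptn n) :=
  Finite.of_injective (fun α : Ptn n => (fun p : (Fin n ⊕ Fin n) × (Fin n ⊕ Fin n) => α p.1 p.2))
    fun _ _ h => Setoid.ext fun x y => iff_of_eq (congrFun h (x, y))

instance (n : ℕ) : Finite (Fstar n) :=
  Finite.of_injective Fstar.part fun _ _ => Fstar.ext_part

/-- The obstruction is the empty partial bijection: it absorbs every product, and it is not above
the identity because some point exists when `n ≥ 1`. -/
theorem IS.not_isFiat (k : Type*) [Field k] {n : ℕ} (hn : 1 ≤ n) :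
    ¬ IsFiat k (Finitarization k (OrdCat (IS n))) := by
  refine OrdCat.not_isFiat k (⟨⊥⟩ : IS n) (fun t => IS.ext ?_) fun h => ?_
  · exact PEquiv.bot_trans _
  · have := (IS.le_iff _ _).mp h ⟨0, hn⟩ ⟨0, hn⟩ rfl
    exact Option.some_ne_none _ this.symm

/-- The obstruction is the partition with a single block. The natural order is reverse refinement,
so being above the identity would force the identity partition to have a single block, which fails
once there are two points. -/
theorem Fstar.not_isFiat (k : Type*) [Field k] {n : ℕ} (hn : 2 ≤ n) :
    ¬ IsFiat k (Finitarization k (OrdCat (Fstar n))) := by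
  have hp : Ptn.IsPropagating (⊤ : Ptn n) := fun _ =>
    ⟨⟨⟨0, by omega⟩, trivial⟩, ⟨0, by omega⟩, trivial⟩
  refine OrdCat.not_isFiat k
    (⟨⟨⊤, hp⟩, (PP.exists_perm_iff _).mpr ⟨1, le_top⟩⟩ : Fstar n) (fun t => Fstar.ext_part ?_)
    fun h => ?_
  · change Ptn.comp ⊤ (part t) = ⊤
    refine eq_top_iff.mpr fun u v _ => ?_
    -- Every outer point is connected to the middle layer: on one side because the first factor is a
    -- single block, on the other because `t` is propagating. The middle layer itself lies in one
    -- block, so the composite has one block.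
    have key : ∀ u, ∃ x, Ptn.glue ⊤ (part t) (Ptn.i13 u) (Ptn.i12 (Sum.inr x)) := by
      rintro (x | x)
      · exact ⟨x, Ptn.glue_left _ _ (x := Sum.inl x) (y := Sum.inr x) trivial⟩
      · obtain ⟨y, hy⟩ := (t.1.propagating (Sum.inr x)).1
        exact ⟨y, Ptn.glue_right _ _ hy⟩
    obtain ⟨x, hx⟩ := key u
    obtain ⟨y, hy⟩ := key v
    have hxy : Ptn.glue ⊤ (part t) (Ptn.i12 (Sum.inr x)) (Ptn.i12 (Sum.inr y)) :=
      Ptn.glue_left _ _ trivial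
    exact Setoid.trans' (Ptn.glue _ _) hx
      (Setoid.trans' (Ptn.glue _ _) hxy (Setoid.symm' (Ptn.glue _ _) hy))
  · have h1 : (⊤ : Ptn n) ≤ Ptn.ofPerm 1 := (Fstar.le_iff _ _).mp h
    have h2 : Ptn.ofPerm 1 (Sum.inl (⟨0, by omega⟩ : Fin n)) (Sum.inl ⟨1, by omega⟩) := h1 trivial
    have h3 : (⟨0, by omega⟩ : Fin n) = ⟨1, by omega⟩ := h2
    simp at h3

/-! ### Duality structures -/

lemma hh_id_right {B : Type u} [Bicategory.{w, v} B] {a b c : B} {f f' : a ⟶ b} (η : f ⟶ f')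
    (g : b ⟶ c) : hh η (𝟙 g) = η ▷ g := by
  simp [hh]

lemma hh_id_left {B : Type u} [Bicategory.{w, v} B] {a b c : B} (f : a ⟶ b) {g g' : b ⟶ c}
    (θ : g ⟶ g') : hh (𝟙 f) θ = f ◁ θ := by
  simp [hh]

/-- A weak anti-involution of a 2-category together with adjunctions `F ⊣ ⋆F` such that the image
of a 2-morphism under `⋆` is its mate. -/
structure Duality (B : Type u) [Bicategory.{w, v} B] where
  /-- the action on 1-morphisms -/
  star {a b : B} (F : a ⟶ b) : b ⟶ a
  /-- the action on 2-morphisms -/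
  map {a b : B} {F G : a ⟶ b} (η : F ⟶ G) : star G ⟶ star F
  map_id {a b : B} (F : a ⟶ b) : map (𝟙 F) = 𝟙 (star F)
  map_comp {a b : B} {F G H : a ⟶ b} (η : F ⟶ G) (θ : G ⟶ H) : map (η ≫ θ) = map θ ≫ map η
  /-- compatibility with composition of 1-morphisms -/
  mul {a b c : B} (F : a ⟶ b) (G : b ⟶ c) : star G ≫ star F ≅ star (F ≫ G)
  /-- compatibility with identity 1-morphisms -/
  unit (a : B) : 𝟙 a ≅ star (𝟙 a)
  mul_hh {a b c : B} {F F' : a ⟶ b} {G G' : b ⟶ c} (η : F ⟶ F') (θ : G ⟶ G') :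
    (mul F' G').hom ≫ map (hh η θ) = hh (map θ) (map η) ≫ (mul F G).hom
  mul_assoc {a b c d : B} (F : a ⟶ b) (G : b ⟶ c) (H : c ⟶ d) :
    hh (mul G H).hom (𝟙 (star F)) ≫ (mul F (G ≫ H)).hom ≫ map (α_ F G H).hom =
      (α_ (star H) (star G) (star F)).hom ≫ hh (𝟙 (star H)) (mul F G).hom ≫ (mul (F ≫ G) H).hom
  unit_mul {a b : B} (F : a ⟶ b) :
    hh (𝟙 (star F)) (unit a).hom ≫ (mul (𝟙 a) F).hom = (ρ_ (star F)).hom ≫ map (λ_ F).hom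
  mul_unit {a b : B} (F : a ⟶ b) :
    hh (unit b).hom (𝟙 (star F)) ≫ (mul F (𝟙 b)).hom = (λ_ (star F)).hom ≫ map (ρ_ F).hom
  /-- the isomorphism `Id ≅ ⋆⋆` -/
  inv {a b : B} (F : a ⟶ b) : F ≅ star (star F)
  inv_naturality {a b : B} {F G : a ⟶ b} (η : F ⟶ G) :
    η ≫ (inv G).hom = (inv F).hom ≫ map (map η)
  inv_mul {a b c : B} (F : a ⟶ b) (G : b ⟶ c) :
    hh (inv F).hom (inv G).hom ≫ (mul (star G) (star F)).hom =
      (inv (F ≫ G)).hom ≫ map (mul F G).hom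
  inv_unit (a : B) : (unit a).hom = (inv (𝟙 a)).hom ≫ map (unit a).hom
  /-- the unit of the adjunction `F ⊣ ⋆F` -/
  coev {a b : B} (F : a ⟶ b) : 𝟙 a ⟶ F ≫ star F
  /-- the counit of the adjunction `F ⊣ ⋆F` -/
  ev {a b : B} (F : a ⟶ b) : star F ≫ F ⟶ 𝟙 b
  left_triangle {a b : B} (F : a ⟶ b) :
    hh (coev F) (𝟙 F) ≫ (α_ F (star F) F).hom ≫ hh (𝟙 F) (ev F) ≫ (ρ_ F).hom = (λ_ F).hom
  right_triangle {a b : B} (F : a ⟶ b) :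
    hh (𝟙 (star F)) (coev F) ≫ (α_ (star F) F (star F)).inv ≫ hh (ev F) (𝟙 (star F)) ≫
      (λ_ (star F)).hom = (ρ_ (star F)).hom
  -- This law and the next say that `map η` is the mate of `η`. They are what survives matrices and
  -- idempotents: they move a 2-morphism from one factor of the unit or counit to the other.
  coev_nat {a b : B} {F G : a ⟶ b} (η : F ⟶ G) :
    coev F ≫ hh η (𝟙 (star F)) = coev G ≫ hh (𝟙 G) (map η)
  ev_nat {a b : B} {F G : a ⟶ b} (η : F ⟶ G) :
    hh (𝟙 (star G)) η ≫ ev G = hh (map η) (𝟙 F) ≫ ev F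
  -- Needed when identities are split: `⋆` has to fix the idempotents that are the new objects.
  map_unit {a : B} (e : 𝟙 a ⟶ 𝟙 a) : (unit a).hom ≫ map e = e ≫ (unit a).hom

/-- A `k`-linear duality structure. -/
structure LinDuality (k : Type*) [Field k] (B : Type u) [Bicategory.{w, v} B]
    [PreaddBicategory B] [LinBicategory k B] extends Duality B where
  map_add {a b : B} {F G : a ⟶ b} (η θ : F ⟶ G) : map (η + θ) = map η + map θ
  map_smul {a b : B} {F G : a ⟶ b} (r : k) (η : F ⟶ G) : map (r • η) = r • map η

namespace Duality

variable {B : Type u} [Bicategory.{w, v} B] (D : Duality B)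

/-- The adjunction underlying a duality structure. -/
def adjunction {a b : B} (F : a ⟶ b) : Bicategory.Adjunction F (D.star F) where
  unit := D.coev F
  counit := D.ev F
  left_triangle := by
    have h := D.left_triangle F
    rw [hh_id_right, hh_id_left] at h
    rw [← h, leftZigzag, bicategoricalComp]
    simp
  right_triangle := by
    have h := D.right_triangle F
    rw [hh_id_right, hh_id_left] at h
    rw [← h, rightZigzag, bicategoricalComp]
    simp

end Duality

/-- The laws of `WeakAntiInvolution` are those of `Duality` with horizontal composites specialised
to whiskerings and invertible 2-morphisms moved to the other side. -/
theorem LinDuality.isFiat {k : Type*} [Field k] {B : Type u} [Bicategory.{w, v} B]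
    [PreaddBicategory B] [LinBicategory k B] (D : LinDuality k B) (hB : IsFinitary k B) :
    IsFiat k B := by
  refine ⟨hB, ⟨D.star, D.map, D.map_id, D.map_comp, D.map_add, D.map_smul, D.mul, D.unit, ?_, ?_,
    ?_, ?_, ?_, D.inv, D.inv_naturality, ?_, ?_⟩, fun a b F => ⟨D.adjunction F⟩⟩
  · intro a b c F F' η G
    have := D.mul_hh η (𝟙 G)
    rwa [D.map_id, hh_id_right, hh_id_left] at this
  · intro a b c F G G' η
    have := D.mul_hh (𝟙 F) η
    rwa [D.map_id, hh_id_right, hh_id_left] at this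
  · intro a b c d F G H
    have := D.mul_assoc F G H
    rwa [hh_id_right, hh_id_left] at this
  · intro a b F
    have := D.unit_mul F
    rw [hh_id_left] at this
    rw [this, Iso.inv_hom_id_assoc]
  · intro a b F
    have := D.mul_unit F
    rw [hh_id_right] at this
    rw [this, Iso.inv_hom_id_assoc]
  · intro a b c F G
    have := D.inv_mul F G
    rw [hh, Category.assoc] at this
    rw [reassoc_of% this, ← D.map_comp, Iso.inv_hom_id, D.map_id, Category.comp_id]
  · intro a
    conv_lhs => rw [D.inv_unit, Category.assoc, ← D.map_comp, Iso.inv_hom_id, D.map_id,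
      Category.comp_id]

/-! ### Dualities of linearisations -/

namespace LinBicat

open Lin

variable {k : Type*} [Field k] {B : Type u} [Bicategory.{w, v} B] {a b c : LinBicat k B}

/-- A 2-morphism of `B` as a 2-morphism of its linearisation. -/
def bb {f g : a ⟶ b} (x : f.as ⟶ g.as) : f ⟶ g := bas x

lemma bb_comp {f g h : a ⟶ b} (x : f.as ⟶ g.as) (y : g.as ⟶ h.as) :
    (bb x : f ⟶ g) ≫ (bb y : g ⟶ h) = bb (x ≫ y) := bas_comp x y

lemma hh_bb {f f' : a ⟶ b} {g g' : b ⟶ c} (x : f.as ⟶ f'.as) (y : g.as ⟶ g'.as) :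
    hh (bb x : f ⟶ f') (bb y : g ⟶ g') = (bb (hh x y) : f ≫ g ⟶ f' ≫ g') :=
  (congrArg₂ (· ≫ ·) (wr_bas x g) (wl_bas f' y)).trans (bc _ _)

lemma bb_id (f : a ⟶ b) : bb (𝟙 f.as) = 𝟙 f := rfl

/-- The identities checked below are additive and homogeneous in each 2-morphism, so this induction
reduces them to basis elements, where they are the corresponding laws of the original duality. -/
lemma ind_bb {f g : a ⟶ b} {p : (f ⟶ g) → Prop} (η : f ⟶ g) (zero : p 0)
    (hadd : ∀ x y, p x → p y → p (x + y)) (smul : ∀ (r : k) x, p x → p (r • x))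
    (basis : ∀ x : f.as ⟶ g.as, p (bb x)) : p η :=
  ind η zero hadd fun r x => smul r _ (basis x)

lemma bIso_hom_eq {f g : a ⟶ b} (e : f.as ≅ g.as) : (bIso e).hom = (bb e.hom : f ⟶ g) := rfl

variable (D : Duality B)

/-- The action of `⋆` on 1-morphisms. -/
abbrev starL (f : a ⟶ b) : b ⟶ a := ⟨D.star f.as⟩

/-- The linear extension of the action of `⋆` on 2-morphisms. -/
def mapL {f g : a ⟶ b} (η : f ⟶ g) : starL D g ⟶ starL D f :=
  ext (X := f) (Y := g) (X' := starL D g) (Y' := starL D f) D.map η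

lemma mapL_add {f g : a ⟶ b} (η θ : f ⟶ g) : mapL D (η + θ) = mapL D η + mapL D θ := ext_add _ _ _

lemma mapL_zero {f g : a ⟶ b} : mapL D (0 : f ⟶ g) = 0 := ext_zero _

lemma mapL_smul {f g : a ⟶ b} (r : k) (η : f ⟶ g) : mapL D (r • η) = r • mapL D η := ext_smul _ _ _

lemma mapL_bb {f g : a ⟶ b} (x : f.as ⟶ g.as) :
    mapL D (bb x : f ⟶ g) = (bb (D.map x) : starL D g ⟶ starL D f) :=
  ext_bas _ _

lemma mapL_comp {f g h : a ⟶ b} (η : f ⟶ g) (θ : g ⟶ h) :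
    mapL D (η ≫ θ) = mapL D θ ≫ mapL D η := by
  induction η using ind_bb with
  | zero => simp only [zero_comp, mapL_zero, comp_zero]
  | hadd x y hx hy => simp only [Preadditive.add_comp, mapL_add, Preadditive.comp_add, hx, hy]
  | smul r x hx => simp only [Linear.smul_comp, mapL_smul, Linear.comp_smul, hx]
  | basis x =>
    induction θ using ind_bb with
    | zero => simp only [zero_comp, mapL_zero, comp_zero]
    | hadd x y hx hy => simp only [Preadditive.add_comp, mapL_add, Preadditive.comp_add, hx, hy]
    | smul r x hx => simp only [Linear.smul_comp, mapL_smul, Linear.comp_smul, hx]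
    | basis y =>
      rw [bb_comp, mapL_bb, mapL_bb, mapL_bb, bb_comp]
      exact congrArg bb (D.map_comp x y)

/-- Compatibility of `⋆` with composition. -/
def mulL (f : a ⟶ b) (g : b ⟶ c) : starL D g ≫ starL D f ≅ starL D (f ≫ g) :=
  bIso (f := starL D g ≫ starL D f) (g := starL D (f ≫ g)) (D.mul f.as g.as)

lemma mulL_hh {f f' : a ⟶ b} {g g' : b ⟶ c} (η : f ⟶ f') (θ : g ⟶ g') :
    (mulL D f' g').hom ≫ mapL D (hh η θ) = hh (mapL D θ) (mapL D η) ≫ (mulL D f g).hom := by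
  induction η using ind_bb with
  | zero => simp only [hh_zero_left, hh_zero_right, mapL_zero, comp_zero, zero_comp]
  | hadd x y hx hy =>
    simp only [hh_add_left, hh_add_right, mapL_add, Preadditive.comp_add, Preadditive.add_comp,
      hx, hy]
  | smul r x hx =>
    simp only [hh_smul_left k, hh_smul_right k, mapL_smul, Linear.comp_smul, Linear.smul_comp, hx]
  | basis x =>
    induction θ using ind_bb with
    | zero => simp only [hh_zero_left, hh_zero_right, mapL_zero, comp_zero, zero_comp]
    | hadd x y hx hy =>
      simp only [hh_add_left, hh_add_right, mapL_add, Preadditive.comp_add, Preadditive.add_comp,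
        hx, hy]
    | smul r x hx =>
      simp only [hh_smul_left k, hh_smul_right k, mapL_smul, Linear.comp_smul, Linear.smul_comp,
        hx]
    | basis y =>
      rw [hh_bb, mapL_bb, mapL_bb, mapL_bb, hh_bb, mulL, mulL, bIso_hom_eq, bIso_hom_eq]
      refine (bb_comp _ _).trans (Eq.trans ?_ (bb_comp _ _).symm)
      exact congrArg bb (D.mul_hh x y)

/-- The counit of the adjunction. -/
def evL (f : a ⟶ b) : starL D f ≫ f ⟶ 𝟙 b := bb (f := starL D f ≫ f) (g := 𝟙 b) (D.ev f.as)

/-- The unit of the adjunction. -/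
def coevL (f : a ⟶ b) : 𝟙 a ⟶ f ≫ starL D f :=
  bb (f := 𝟙 a) (g := f ≫ starL D f) (D.coev f.as)

lemma coevL_nat {f g : a ⟶ b} (η : f ⟶ g) :
    coevL D f ≫ hh η (𝟙 (starL D f)) = coevL D g ≫ hh (𝟙 g) (mapL D η) := by
  induction η using ind_bb with
  | zero => simp only [hh_zero_left, hh_zero_right, mapL_zero, comp_zero]
  | hadd x y hx hy => simp only [hh_add_left, hh_add_right, mapL_add, Preadditive.comp_add, hx, hy]
  | smul r x hx => simp only [hh_smul_left k, hh_smul_right k, mapL_smul, Linear.comp_smul, hx]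
  | basis x =>
    rw [mapL_bb, ← bb_id, ← bb_id, hh_bb, hh_bb]
    refine (bb_comp _ _).trans (Eq.trans ?_ (bb_comp _ _).symm)
    exact congrArg bb (D.coev_nat x)

lemma evL_nat {f g : a ⟶ b} (η : f ⟶ g) :
    hh (𝟙 (starL D g)) η ≫ evL D g = hh (mapL D η) (𝟙 f) ≫ evL D f := by
  induction η using ind_bb with
  | zero => simp only [hh_zero_left, hh_zero_right, mapL_zero, zero_comp]
  | hadd x y hx hy => simp only [hh_add_left, hh_add_right, mapL_add, Preadditive.add_comp, hx, hy]
  | smul r x hx => simp only [hh_smul_left k, hh_smul_right k, mapL_smul, Linear.smul_comp, hx]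
  | basis x =>
    rw [mapL_bb, ← bb_id, ← bb_id, hh_bb, hh_bb]
    refine (bb_comp _ _).trans (Eq.trans ?_ (bb_comp _ _).symm)
    exact congrArg bb (D.ev_nat x)

/-- The isomorphism from a 1-morphism to its double dual. -/
def invL (f : a ⟶ b) : f ≅ starL D (starL D f) :=
  bIso (f := f) (g := starL D (starL D f)) (D.inv f.as)

lemma invL_nat {f g : a ⟶ b} (η : f ⟶ g) :
    η ≫ (invL D g).hom = (invL D f).hom ≫ mapL D (mapL D η) := by
  induction η using ind_bb with
  | zero => simp only [mapL_zero, zero_comp, comp_zero]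
  | hadd x y hx hy => simp only [mapL_add, Preadditive.add_comp, Preadditive.comp_add, hx, hy]
  | smul r x hx => simp only [mapL_smul, Linear.smul_comp, Linear.comp_smul, hx]
  | basis x =>
    rw [mapL_bb, mapL_bb]
    refine (bb_comp _ _).trans (Eq.trans ?_ (bb_comp _ _).symm)
    exact congrArg bb (D.inv_naturality x)

/-- Compatibility of `⋆` with identities. -/
def unitL (a : LinBicat k B) : 𝟙 a ≅ starL D (𝟙 a) :=
  bIso (f := 𝟙 a) (g := starL D (𝟙 a)) (D.unit a.as)

lemma mapL_unit (η : 𝟙 a ⟶ 𝟙 a) : (unitL D a).hom ≫ mapL D η = η ≫ (unitL D a).hom := by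
  induction η using ind_bb with
  | zero => simp only [mapL_zero, zero_comp, comp_zero]
  | hadd x y hx hy => simp only [mapL_add, Preadditive.add_comp, Preadditive.comp_add, hx, hy]
  | smul r x hx => simp only [mapL_smul, Linear.smul_comp, Linear.comp_smul, hx]
  | basis x =>
    rw [mapL_bb]
    refine (bb_comp _ _).trans (Eq.trans ?_ (bb_comp _ _).symm)
    exact congrArg bb (D.map_unit x)

lemma associator_bb {d : LinBicat k B} (f : a ⟶ b) (g : b ⟶ c) (h : c ⟶ d) :
    (α_ f g h).hom = (bb (α_ f.as g.as h.as).hom : (f ≫ g) ≫ h ⟶ f ≫ g ≫ h) := rfl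

lemma associator_inv_bb {d : LinBicat k B} (f : a ⟶ b) (g : b ⟶ c) (h : c ⟶ d) :
    (α_ f g h).inv = (bb (α_ f.as g.as h.as).inv : f ≫ g ≫ h ⟶ (f ≫ g) ≫ h) := rfl

lemma leftUnitor_bb (f : a ⟶ b) : (λ_ f).hom = (bb (λ_ f.as).hom : 𝟙 a ≫ f ⟶ f) := rfl

lemma rightUnitor_bb (f : a ⟶ b) : (ρ_ f).hom = (bb (ρ_ f.as).hom : f ≫ 𝟙 b ⟶ f) := rfl

/-- The duality structure of the linearisation. -/
def duality : LinDuality k (LinBicat k B) where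
  star := starL D
  map := mapL D
  map_id F := (mapL_bb D (𝟙 F.as)).trans (congrArg bb (D.map_id F.as))
  map_comp := mapL_comp D
  mul := mulL D
  unit := unitL D
  mul_hh := mulL_hh D
  mul_assoc F G H := by
    rw [associator_bb, associator_bb, mapL_bb, ← bb_id, ← bb_id, mulL, mulL, mulL, mulL,
      bIso_hom_eq, bIso_hom_eq, bIso_hom_eq, bIso_hom_eq, hh_bb, hh_bb]
    refine ((congrArg (_ ≫ ·) (bb_comp _ _)).trans (bb_comp _ _)).trans
      (Eq.trans ?_ ((congrArg (_ ≫ ·) (bb_comp _ _)).trans (bb_comp _ _)).symm)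
    exact congrArg bb (D.mul_assoc F.as G.as H.as)
  unit_mul F := by
    rw [rightUnitor_bb, leftUnitor_bb, mapL_bb, ← bb_id, mulL, unitL, bIso_hom_eq, bIso_hom_eq,
      hh_bb]
    refine (bb_comp _ _).trans (Eq.trans ?_ (bb_comp _ _).symm)
    exact congrArg bb (D.unit_mul F.as)
  mul_unit F := by
    rw [rightUnitor_bb, leftUnitor_bb, mapL_bb, ← bb_id, mulL, unitL, bIso_hom_eq, bIso_hom_eq,
      hh_bb]
    refine (bb_comp _ _).trans (Eq.trans ?_ (bb_comp _ _).symm)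
    exact congrArg bb (D.mul_unit F.as)
  inv := invL D
  inv_naturality := invL_nat D
  inv_mul F G := by
    rw [invL, invL, invL, mulL, mulL, bIso_hom_eq, bIso_hom_eq, bIso_hom_eq, bIso_hom_eq,
      bIso_hom_eq, hh_bb, mapL_bb]
    refine (bb_comp _ _).trans (Eq.trans ?_ (bb_comp _ _).symm)
    exact congrArg bb (D.inv_mul F.as G.as)
  inv_unit a := by
    rw [invL, unitL, bIso_hom_eq, bIso_hom_eq, mapL_bb]
    exact (congrArg bb (D.inv_unit a.as)).trans (bb_comp _ _).symm
  coev := coevL D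
  ev := evL D
  left_triangle F := by
    rw [associator_bb, leftUnitor_bb, rightUnitor_bb, ← bb_id, coevL, evL, hh_bb, hh_bb]
    refine ((congrArg (fun t => _ ≫ _ ≫ t) (bb_comp _ _)).trans
      ((congrArg (_ ≫ ·) (bb_comp _ _)).trans (bb_comp _ _))).trans ?_
    exact congrArg bb (D.left_triangle F.as)
  right_triangle F := by
    rw [associator_inv_bb, leftUnitor_bb, rightUnitor_bb, ← bb_id, coevL, evL, hh_bb, hh_bb]
    refine ((congrArg (fun t => _ ≫ _ ≫ t) (bb_comp _ _)).trans
      ((congrArg (_ ≫ ·) (bb_comp _ _)).trans (bb_comp _ _))).trans ?_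
    exact congrArg bb (D.right_triangle F.as)
  coev_nat := coevL_nat D
  ev_nat := evL_nat D
  map_unit := mapL_unit D
  map_add := mapL_add D
  map_smul := mapL_smul D

end LinBicat

/-! ### Dualities of additive envelopes -/

namespace MatBicat

open MatAux

variable {k : Type*} [Field k] {B : Type u} [Bicategory.{w, v} B] [PreaddBicategory B]

variable {a b c d : MatBicat B}

lemma hh_eq_hc {F F' : a ⟶ b} {G G' : b ⟶ c} (η : F ⟶ F') (θ : G ⟶ G') : hh η θ = hc η θ := by
  rw [hh, whiskerRight_def, whiskerLeft_def, ← hc_comp, Category.comp_id, Category.id_comp]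

lemma comp_ri_inv {F G H : a ⟶ b} (e : F.ι ≃ G.ι) (φ : ∀ i, F.X i ≅ G.X (e i)) (η : H ⟶ G)
    (l : H.ι) (i : F.ι) : entry (η ≫ (ri e φ).inv) l i = entry η l (e i) ≫ (φ i).inv :=
  comp_rinv e φ η l i

variable [LinBicategory k B] (D : LinDuality k B)

lemma map_zero' {a b : B} {F G : a ⟶ b} : D.map (0 : F ⟶ G) = 0 := by
  simpa using D.map_add (0 : F ⟶ G) 0

/-- The action of `⋆` on formal direct sums. -/
abbrev starM (F : a ⟶ b) : b ⟶ a := Mat_.mk F.ι fun i => D.star (F.X i)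

/-- The action of `⋆` on matrices of 2-morphisms. -/
def mapM {F G : a ⟶ b} (η : F ⟶ G) : starM D G ⟶ starM D F := fun j i => D.map (entry η i j)

lemma entry_mapM {F G : a ⟶ b} (η : F ⟶ G) (j : G.ι) (i : F.ι) :
    entry (mapM D η) j i = D.map (entry η i j) := rfl

lemma mapM_id (F : a ⟶ b) : mapM D (𝟙 F) = 𝟙 (starM D F) := by
  refine ext_entry fun i j => ?_
  rw [entry_mapM]
  by_cases h : j = i
  · subst h
    rw [entry_id, D.map_id]
    exact (entry_id (starM D F) j).symm
  · rw [entry_id_ne F h, map_zero']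
    exact (entry_id_ne (starM D F) (Ne.symm h)).symm

lemma mapM_comp {F G H : a ⟶ b} (η : F ⟶ G) (θ : G ⟶ H) :
    mapM D (η ≫ θ) = mapM D θ ≫ mapM D η := by
  refine ext_entry fun i j => ?_
  rw [entry_mapM, entry_comp, entry_comp]
  refine (map_sum (AddMonoidHom.mk' (fun η : F.X j ⟶ H.X i => D.map η) D.map_add) _ _).trans ?_
  exact Finset.sum_congr rfl fun l _ => D.map_comp _ _

/-- Compatibility of `⋆` with composition. -/
def mulM (F : a ⟶ b) (G : b ⟶ c) : starM D G ≫ starM D F ≅ starM D (F ≫ G) :=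
  ri (F := starM D G ≫ starM D F) (G := starM D (F ≫ G)) (Equiv.prodComm G.ι F.ι)
    fun p => D.mul (F.X p.2) (G.X p.1)

/-- Compatibility of `⋆` with identities. -/
def unitM (a : MatBicat B) : 𝟙 a ≅ starM D (𝟙 a) :=
  ri (F := 𝟙 a) (G := starM D (𝟙 a)) (Equiv.refl PUnit) fun _ => D.unit a.as

/-- The isomorphism from a 1-morphism to its double dual. -/
def invM (F : a ⟶ b) : F ≅ starM D (starM D F) :=
  ri (F := F) (G := starM D (starM D F)) (Equiv.refl F.ι) fun i => D.inv (F.X i)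

lemma comp_mapM_ri {F G : a ⟶ b} {H : b ⟶ a} (e : F.ι ≃ G.ι) (φ : ∀ i, F.X i ≅ G.X (e i))
    (η : H ⟶ starM D G) (l : H.ι) (i : F.ι) :
    entry (η ≫ mapM D (ri e φ).hom) l i = entry η l (e i) ≫ D.map (φ i).hom := by
  rw [entry_comp]
  refine (Finset.sum_eq_single (e i) ?_ ?_).trans ?_
  · intro j _ hj
    rw [entry_mapM, ri_ne e φ hj.symm, map_zero', comp_zero]
  · simp
  · rw [entry_mapM, ri_self]

/-- `⋆` turns a re-indexing matrix into one along the inverse bijection, so a re-indexing followed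
by it is again a re-indexing. Coherence laws thus reduce to a law for the bijections (`h`) and one
for each summand (`h'`). The latter is phrased with `entry` at `e' (e'' i)` because `φ i` has its
target at the only propositionally equal index `e i`. -/
lemma ri_comp_mapM {F G : a ⟶ b} {H : b ⟶ a} {e : H.ι ≃ (starM D G).ι}
    {φ : ∀ i, H.X i ≅ (starM D G).X (e i)} {e' : F.ι ≃ G.ι} {ψ : ∀ i, F.X i ≅ G.X (e' i)}
    {e'' : H.ι ≃ (starM D F).ι} {χ : ∀ i, H.X i ≅ (starM D F).X (e'' i)}
    (h : ∀ i, e i = e' (e'' i))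
    (h' : ∀ i, entry (ri (G := starM D G) e φ).hom i (e' (e'' i)) ≫ D.map (ψ (e'' i)).hom =
      (χ i).hom) :
    (ri (F := H) (G := starM D G) e φ).hom ≫ mapM D (ri e' ψ).hom =
      (ri (F := H) (G := starM D F) e'' χ).hom := by
  refine ext_entry fun i l => ?_
  obtain ⟨l, rfl⟩ := e''.surjective l
  refine (comp_mapM_ri D e' ψ _ i (e'' l)).trans ?_
  by_cases hil : i = l
  · subst hil
    exact (h' i).trans (ri_self (F := H) (G := starM D F) e'' χ i).symm
  · refine Eq.trans ?_ (ri_ne (F := H) (G := starM D F) e'' χ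
      (fun h => hil (e''.injective h))).symm
    have : e i ≠ e' (e'' l) := fun hh => hil (e''.injective (e'.injective ((h i).symm.trans hh)))
    exact (congrArg (· ≫ _) (ri_ne (F := H) (G := starM D G) e φ this)).trans zero_comp

lemma mulM_hc {F F' : a ⟶ b} {G G' : b ⟶ c} (η : F ⟶ F') (θ : G ⟶ G') :
    (mulM D F' G').hom ≫ mapM D (hc η θ) = hc (mapM D θ) (mapM D η) ≫ (mulM D F G).hom := by
  refine ext_entry ?_
  rintro p ⟨f, g⟩
  refine (ri_comp (F := starM D G' ≫ starM D F') (G := starM D (F' ≫ G')) _ _ _ p _).trans ?_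
  refine Eq.trans ?_ (comp_ri (F := starM D G ≫ starM D F) (G := starM D (F ≫ G))
    (Equiv.prodComm G.ι F.ι) _ _ p (g, f)).symm
  exact D.mul_hh _ _

lemma mulM_assoc (F : a ⟶ b) (G : b ⟶ c) (H : c ⟶ d) :
    hc (mulM D G H).hom (𝟙 (starM D F)) ≫ (mulM D F (G ≫ H)).hom ≫ mapM D (α_ F G H).hom =
      (α_ (starM D H) (starM D G) (starM D F)).hom ≫ hc (𝟙 (starM D H)) (mulM D F G).hom ≫
        (mulM D (F ≫ G) H).hom := by
  -- Identities are written as re-indexings so that every factor is one, and products and composites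
  -- of re-indexings are computed by `hc_ri` and `ri_trans`.
  rw [id_eq_ri (starM D F), id_eq_ri (starM D H), ← Category.assoc]
  change _ ≫ mapM D (as' F G H).hom = (as' _ _ _).hom ≫ _
  unfold mulM as'
  erw [hc_ri, hc_ri, ri_trans, ri_trans, ri_trans]
  refine ri_comp_mapM D (fun p => rfl) fun p => ?_
  refine (congrArg (· ≫ _) (ri_self (F := (starM D H ≫ starM D G) ≫ starM D F)
    (G := starM D (F ≫ G ≫ H)) _ _ p)).trans ?_
  exact (Category.assoc _ _ _).trans (D.mul_assoc _ _ _)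

lemma unitM_mul (F : a ⟶ b) :
    hc (𝟙 (starM D F)) (unitM D a).hom ≫ (mulM D (𝟙 a) F).hom =
      (ρ_ (starM D F)).hom ≫ mapM D (λ_ F).hom := by
  rw [id_eq_ri (starM D F)]
  change _ = (ru _).hom ≫ mapM D (lu F).hom
  unfold mulM unitM ru lu
  erw [hc_ri, ri_trans]
  refine (ri_comp_mapM D (fun p => rfl) fun p => ?_).symm
  refine (congrArg (· ≫ _) (ri_self (F := starM D F ≫ 𝟙 a) (G := starM D F) _ _ p)).trans ?_
  exact (D.unit_mul _).symm

lemma mulM_unit (F : a ⟶ b) :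
    hc (unitM D b).hom (𝟙 (starM D F)) ≫ (mulM D F (𝟙 b)).hom =
      (λ_ (starM D F)).hom ≫ mapM D (ρ_ F).hom := by
  rw [id_eq_ri (starM D F)]
  change _ = (lu _).hom ≫ mapM D (ru F).hom
  unfold mulM unitM ru lu
  erw [hc_ri, ri_trans]
  refine (ri_comp_mapM D (fun p => rfl) fun p => ?_).symm
  refine (congrArg (· ≫ _) (ri_self (F := 𝟙 b ≫ starM D F) (G := starM D F) _ _ p)).trans ?_
  exact (D.mul_unit _).symm

lemma invM_mul (F : a ⟶ b) (G : b ⟶ c) :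
    hc (invM D F).hom (invM D G).hom ≫ (mulM D (starM D G) (starM D F)).hom =
      (invM D (F ≫ G)).hom ≫ mapM D (mulM D F G).hom := by
  unfold mulM invM
  erw [hc_ri, ri_trans]
  refine (ri_comp_mapM D (fun p => rfl) fun p => ?_).symm
  refine (congrArg (· ≫ _) (ri_self (F := F ≫ G) (G := starM D (starM D (F ≫ G))) _ _ p)).trans ?_
  exact (D.inv_mul _ _).symm

lemma invM_unit (a : MatBicat B) :
    (unitM D a).hom = (invM D (𝟙 a)).hom ≫ mapM D (unitM D a).hom := by
  unfold unitM invM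
  refine (ri_comp_mapM D (fun p => rfl) fun p => ?_).symm
  refine (congrArg (· ≫ _) (ri_self (F := 𝟙 a) (G := starM D (starM D (𝟙 a))) _ _ p)).trans ?_
  exact (D.inv_unit _).symm

lemma invM_nat {F G : a ⟶ b} (η : F ⟶ G) :
    η ≫ (invM D G).hom = (invM D F).hom ≫ mapM D (mapM D η) := by
  refine ext_entry fun i j => ?_
  refine (comp_ri (F := G) (G := starM D (starM D G)) (Equiv.refl G.ι) _ _ i j).trans ?_
  refine Eq.trans ?_ (ri_comp (F := F) (G := starM D (starM D F)) _ _ _ i _).symm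
  exact D.inv_naturality _

lemma mapM_unit (η : 𝟙 a ⟶ 𝟙 a) : (unitM D a).hom ≫ mapM D η = η ≫ (unitM D a).hom := by
  refine ext_entry fun i j => ?_
  refine Eq.trans ?_ (comp_ri (F := 𝟙 a) (G := starM D (𝟙 a)) (Equiv.refl PUnit) _ _ i j).symm
  refine (ri_comp (F := 𝟙 a) (G := starM D (𝟙 a)) _ _ _ i _).trans ?_
  exact D.map_unit _

/-- The unit of the adjunction. -/
def coevM (F : a ⟶ b) : 𝟙 a ⟶ F ≫ starM D F := fun _ p =>
  D.coev (F.X p.1) ≫ hh (𝟙 (F.X p.1)) (D.map (entry (𝟙 F) p.2 p.1))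

/-- The counit of the adjunction. -/
def evM (F : a ⟶ b) : starM D F ≫ F ⟶ 𝟙 b := fun p _ =>
  hh (𝟙 (D.star (F.X p.1))) (entry (𝟙 F) p.2 p.1) ≫ D.ev (F.X p.1)

/-- The unit is a diagonal matrix. The entry of `𝟙 F` in its definition acts as a Kronecker delta,
which avoids transporting along equalities of indices. -/
lemma coevM_self (F : a ⟶ b) (x : PUnit) (i : F.ι) :
    entry (coevM D F) x (i, i) = D.coev (F.X i) := by
  change D.coev (F.X i) ≫ hh (𝟙 (F.X i)) (D.map (entry (𝟙 F) i i)) = _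
  rw [entry_id, D.map_id, hh_id, Category.comp_id]

lemma coevM_ne (F : a ⟶ b) (x : PUnit) {i j : F.ι} (h : i ≠ j) :
    entry (coevM D F) x (i, j) = 0 := by
  change D.coev (F.X i) ≫ hh (𝟙 (F.X i)) (D.map (entry (𝟙 F) j i)) = _
  rw [entry_id_ne F h.symm, map_zero', hh_zero_right, comp_zero]

lemma evM_self (F : a ⟶ b) (x : PUnit) (i : F.ι) :
    entry (evM D F) (i, i) x = D.ev (F.X i) := by
  change hh (𝟙 (D.star (F.X i))) (entry (𝟙 F) i i) ≫ D.ev (F.X i) = _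
  rw [entry_id, hh_id, Category.id_comp]

lemma evM_ne (F : a ⟶ b) (x : PUnit) {i j : F.ι} (h : i ≠ j) :
    entry (evM D F) (i, j) x = 0 := by
  change hh (𝟙 (D.star (F.X i))) (entry (𝟙 F) j i) ≫ D.ev (F.X i) = _
  rw [entry_id_ne F h.symm, hh_zero_right, zero_comp]

/-- In the entry at `(g, f)` diagonality of the unit and of the identity matrix leaves one term on
each side, through `(f, f)` on the left and `(g, g)` on the right. These two agree by naturality for
the single entry of `η` from `f` to `g`. -/
lemma coevM_nat {F G : a ⟶ b} (η : F ⟶ G) :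
    coevM D F ≫ hc η (𝟙 (starM D F)) = coevM D G ≫ hc (𝟙 G) (mapM D η) := by
  refine ext_entry ?_
  rintro x ⟨g, f⟩
  rw [entry_comp, entry_comp]
  refine (Finset.sum_eq_single (f, f) ?_ (by simp)).trans
    (Eq.trans ?_ (Finset.sum_eq_single (g, g) ?_ (by simp)).symm)
  · rintro ⟨i, j⟩ - h
    rw [entry_hc]
    by_cases hj : j = f
    · subst hj
      rw [coevM_ne D F x fun h' => h (by rw [h']), zero_comp]
    · rw [entry_id_ne (starM D F) hj, hh_zero_right, comp_zero]
  · rw [entry_hc, entry_hc, coevM_self, coevM_self, entry_id G, entry_id (starM D F)]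
    exact D.coev_nat _
  · rintro ⟨i, j⟩ - h
    rw [entry_hc]
    by_cases hi : i = g
    · subst hi
      rw [coevM_ne D G x fun h' => h (by rw [h']), zero_comp]
    · rw [entry_id_ne G hi, hh_zero_left, comp_zero]

lemma evM_nat {F G : a ⟶ b} (η : F ⟶ G) :
    hc (𝟙 (starM D G)) η ≫ evM D G = hc (mapM D η) (𝟙 F) ≫ evM D F := by
  refine ext_entry ?_
  rintro ⟨g, f⟩ x
  rw [entry_comp, entry_comp]
  refine (Finset.sum_eq_single (g, g) ?_ (by simp)).trans
    (Eq.trans ?_ (Finset.sum_eq_single (f, f) ?_ (by simp)).symm)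
  · rintro ⟨i, j⟩ - h
    rw [entry_hc]
    by_cases hi : g = i
    · subst hi
      rw [evM_ne D G x fun h' => h (by rw [h']), comp_zero]
    · rw [entry_id_ne (starM D G) hi, hh_zero_left, zero_comp]
  · rw [entry_hc, entry_hc, evM_self, evM_self, entry_id F, entry_id (starM D G)]
    exact D.ev_nat _
  · rintro ⟨i, j⟩ - h
    rw [entry_hc]
    by_cases hj : f = j
    · subst hj
      rw [evM_ne D F x fun h' => h (by rw [h']), comp_zero]
    · rw [entry_id_ne F hj, hh_zero_right, zero_comp]

/-- In the row of `i` the unit, the counit and the identity matrices are all diagonal, so only the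
path through `((i, i), i)` contributes. It gives the triangle identity of the summand `F.X i` when
`j = i`, and zero otherwise. -/
lemma left_triangleM (F : a ⟶ b) :
    hc (coevM D F) (𝟙 F) ≫ (α_ F (starM D F) F).hom ≫ hc (𝟙 F) (evM D F) ≫ (ρ_ F).hom =
      (λ_ F).hom := by
  refine ext_entry ?_
  rintro ⟨x, i⟩ j
  rw [entry_comp]
  have key : ∀ p q r, entry ((α_ F (starM D F) F).hom ≫ hc (𝟙 F) (evM D F) ≫ (ρ_ F).hom)
      ((p, q), r) j = (α_ (F.X p) (D.star (F.X q)) (F.X r)).hom ≫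
        hh (entry (𝟙 F) p j) (entry (evM D F) (q, r) x) ≫ (ρ_ (F.X j)).hom := fun p q r =>
    (ri_comp (F := (F ≫ starM D F) ≫ F) (G := F ≫ starM D F ≫ F) _ _ _ ((p, q), r) j).trans
      (congrArg (_ ≫ ·) (comp_ri (F := F ≫ 𝟙 b) (G := F) (Equiv.prodPUnit F.ι)
        (fun p => ρ_ (F.X p.1)) (hc (𝟙 F) (evM D F)) (p, (q, r)) (j, PUnit.unit)))
  refine (Finset.sum_eq_single ((i, i), i) ?_ (by simp)).trans ?_
  · rintro ⟨⟨p, q⟩, r⟩ - h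
    rw [entry_hc, key]
    by_cases hr : i = r
    · subst hr
      by_cases hq : q = i
      · subst hq
        rw [coevM_ne D F x fun h' => h (by rw [h']), hh_zero_left, zero_comp]
      · rw [evM_ne D F x hq, hh_zero_right, zero_comp, comp_zero, comp_zero]
    · rw [entry_id_ne F hr, hh_zero_right, zero_comp]
  · rw [entry_hc, key, coevM_self, evM_self, entry_id]
    by_cases hij : i = j
    · subst hij
      rw [entry_id]
      exact (D.left_triangle _).trans
        (ri_self (F := 𝟙 a ≫ F) (G := F) (Equiv.punitProd F.ι) (fun p => λ_ (F.X p.2))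
          (x, i)).symm
    · rw [entry_id_ne F hij, hh_zero_left, zero_comp, comp_zero, comp_zero]
      exact (ri_ne (F := 𝟙 a ≫ F) (G := F) (Equiv.punitProd F.ι) (fun p => λ_ (F.X p.2))
        (i := (x, i)) (j := j) hij).symm

lemma right_triangleM (F : a ⟶ b) :
    hc (𝟙 (starM D F)) (coevM D F) ≫ (α_ (starM D F) F (starM D F)).inv ≫
      hc (evM D F) (𝟙 (starM D F)) ≫ (λ_ (starM D F)).hom = (ρ_ (starM D F)).hom := by
  refine ext_entry ?_
  rintro ⟨i, x⟩ j
  -- The inverse associator is grouped with the factor before it, since `comp_ri_inv` computes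
  -- entries of composites ending in an inverse re-indexing.
  rw [← Category.assoc, entry_comp]
  have key : ∀ p q r, entry (hc (𝟙 (starM D F)) (coevM D F) ≫
      (α_ (starM D F) F (starM D F)).inv) (i, x) ((p, q), r) =
        hh (entry (𝟙 (starM D F)) i p) (entry (coevM D F) x (q, r)) ≫
          (α_ (D.star (F.X p)) (F.X q) (D.star (F.X r))).inv := fun p q r =>
    comp_ri_inv (F := (starM D F ≫ F) ≫ starM D F) (G := starM D F ≫ F ≫ starM D F)
      (Equiv.prodAssoc F.ι F.ι F.ι) (fun p => α_ (D.star (F.X p.1.1)) (F.X p.1.2) (D.star (F.X p.2)))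
      (hc (𝟙 (starM D F)) (coevM D F)) (i, x) ((p, q), r)
  have key' : ∀ p q r, entry (hc (evM D F) (𝟙 (starM D F)) ≫ (λ_ (starM D F)).hom)
      ((p, q), r) j = hh (entry (evM D F) (p, q) x) (entry (𝟙 (starM D F)) r j) ≫
        (λ_ (D.star (F.X j))).hom := fun p q r =>
    comp_ri (F := 𝟙 b ≫ starM D F) (G := starM D F) (Equiv.punitProd F.ι)
      (fun p => λ_ (D.star (F.X p.2))) (hc (evM D F) (𝟙 (starM D F))) ((p, q), r) (x, j)
  refine (Finset.sum_eq_single ((i, i), i) ?_ (by simp)).trans ?_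
  · rintro ⟨⟨p, q⟩, r⟩ - h
    rw [key, key']
    by_cases hp : i = p
    · subst hp
      by_cases hq : q = r
      · subst hq
        rw [evM_ne D F x fun h' => h (by rw [h']), hh_zero_left, zero_comp, comp_zero]
      · rw [coevM_ne D F x hq, hh_zero_right, zero_comp, zero_comp]
    · rw [entry_id_ne (starM D F) hp, hh_zero_left, zero_comp, zero_comp]
  · rw [key, key', coevM_self, evM_self, entry_id (starM D F)]
    by_cases hij : i = j
    · subst hij
      rw [entry_id (starM D F), Category.assoc]
      exact (D.right_triangle _).trans
        (ri_self (F := starM D F ≫ 𝟙 a) (G := starM D F) (Equiv.prodPUnit F.ι)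
          (fun p => ρ_ (D.star (F.X p.1))) (i, x)).symm
    · rw [entry_id_ne (starM D F) hij, hh_zero_right, zero_comp, comp_zero]
      exact (ri_ne (F := starM D F ≫ 𝟙 a) (G := starM D F) (Equiv.prodPUnit F.ι)
        (fun p => ρ_ (D.star (F.X p.1))) (i := (i, x)) (j := j) hij).symm

/-- The duality structure of the additive envelope. -/
def duality : LinDuality k (MatBicat B) where
  star := starM D
  map := mapM D
  map_id := mapM_id D
  map_comp := mapM_comp D
  mul := mulM D
  unit := unitM D
  mul_hh η θ := by rw [hh_eq_hc, hh_eq_hc]; exact mulM_hc D η θ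
  mul_assoc F G H := by rw [hh_eq_hc, hh_eq_hc]; exact mulM_assoc D F G H
  unit_mul F := by rw [hh_eq_hc]; exact unitM_mul D F
  mul_unit F := by rw [hh_eq_hc]; exact mulM_unit D F
  inv := invM D
  inv_naturality := invM_nat D
  inv_mul F G := by rw [hh_eq_hc]; exact invM_mul D F G
  inv_unit := invM_unit D
  coev := coevM D
  ev := evM D
  left_triangle F := by rw [hh_eq_hc, hh_eq_hc]; exact left_triangleM D F
  right_triangle F := by rw [hh_eq_hc, hh_eq_hc]; exact right_triangleM D F
  coev_nat η := by rw [hh_eq_hc, hh_eq_hc]; exact coevM_nat D η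
  ev_nat η := by rw [hh_eq_hc, hh_eq_hc]; exact evM_nat D η
  map_unit := mapM_unit D
  map_add η θ := ext_entry fun _ _ => D.map_add _ _
  map_smul r η := ext_entry fun _ _ => D.map_smul _ _

end MatBicat

/-! ### Adjunctions cut down by idempotents -/

namespace Duality

variable {B : Type u} [Bicategory.{w, v} B] (D : Duality B) {a b : B}

/-- The zigzag with endomorphisms inserted: `q` enters through the incoming strand, and `p` slides
along the outgoing one past the associator and the right unitor. For an idempotent `p = q` the
result is the triangle identity of the summand it cuts out. -/
lemma left_triangle_comp {F : a ⟶ b} (p q : F ⟶ F) :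
    hh (D.coev F ≫ hh p (𝟙 (D.star F))) q ≫ (α_ F (D.star F) F).hom ≫ hh (𝟙 F) (D.ev F) ≫
      (ρ_ F).hom = (λ_ F).hom ≫ q ≫ p := by
  have h1 : hh (D.coev F ≫ hh p (𝟙 (D.star F))) q =
      hh (𝟙 _) q ≫ hh (D.coev F) (𝟙 F) ≫ hh (hh p (𝟙 (D.star F))) (𝟙 F) := by
    rw [← hh_comp, ← hh_comp, Category.comp_id, Category.id_comp, Category.comp_id]
  have h2 : hh (hh p (𝟙 (D.star F))) (𝟙 F) ≫ (α_ F (D.star F) F).hom ≫ hh (𝟙 F) (D.ev F) ≫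
      (ρ_ F).hom = (α_ F (D.star F) F).hom ≫ hh (𝟙 F) (D.ev F) ≫ (ρ_ F).hom ≫ p := by
    rw [← Category.assoc, hh_assoc, hh_id, ← hh_rightUnitor p]
    simp only [Category.assoc]
    rw [← Category.assoc (hh p _), ← hh_comp, ← Category.assoc (hh (𝟙 F) _), ← hh_comp]
    simp only [Category.id_comp, Category.comp_id]
  rw [h1, Category.assoc, Category.assoc, h2]
  have h3 := D.left_triangle F
  have h4 : hh (D.coev F) (𝟙 F) ≫ (α_ F (D.star F) F).hom ≫ hh (𝟙 F) (D.ev F) ≫ (ρ_ F).hom ≫ p =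
      (λ_ F).hom ≫ p := by
    rw [← h3]
    simp only [Category.assoc]
  rw [h4, ← Category.assoc, hh_leftUnitor, Category.assoc]

lemma right_triangle_comp {F : a ⟶ b} (p q : D.star F ⟶ D.star F) :
    hh q (D.coev F ≫ hh (𝟙 F) p) ≫ (α_ (D.star F) F (D.star F)).inv ≫
      hh (D.ev F) (𝟙 (D.star F)) ≫ (λ_ (D.star F)).hom = (ρ_ (D.star F)).hom ≫ q ≫ p := by
  have h1 : hh q (D.coev F ≫ hh (𝟙 F) p) =
      hh q (𝟙 _) ≫ hh (𝟙 (D.star F)) (D.coev F) ≫ hh (𝟙 (D.star F)) (hh (𝟙 F) p) := by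
    rw [← hh_comp, ← hh_comp, Category.comp_id, Category.id_comp, Category.comp_id]
  have h0 : hh (𝟙 (D.star F)) (hh (𝟙 F) p) ≫ (α_ (D.star F) F (D.star F)).inv =
      (α_ (D.star F) F (D.star F)).inv ≫ hh (𝟙 (D.star F ≫ F)) p := by
    rw [Iso.comp_inv_eq, Category.assoc, ← hh_id, hh_assoc, Iso.inv_hom_id_assoc]
  have h2 : hh (𝟙 (D.star F)) (hh (𝟙 F) p) ≫ (α_ (D.star F) F (D.star F)).inv ≫
      hh (D.ev F) (𝟙 (D.star F)) ≫ (λ_ (D.star F)).hom =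
      (α_ (D.star F) F (D.star F)).inv ≫ hh (D.ev F) (𝟙 (D.star F)) ≫ (λ_ (D.star F)).hom ≫ p := by
    rw [reassoc_of% h0, ← hh_leftUnitor p]
    rw [← Category.assoc (hh _ p), ← hh_comp, ← Category.assoc (hh (D.ev F) _), ← hh_comp]
    simp only [Category.id_comp, Category.comp_id]
  rw [h1, Category.assoc, Category.assoc, h2]
  have h4 : hh (𝟙 (D.star F)) (D.coev F) ≫ (α_ (D.star F) F (D.star F)).inv ≫
      hh (D.ev F) (𝟙 (D.star F)) ≫ (λ_ (D.star F)).hom ≫ p = (ρ_ (D.star F)).hom ≫ p := by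
    rw [← D.right_triangle F]
    simp only [Category.assoc]
  rw [h4, ← Category.assoc, hh_rightUnitor, Category.assoc]

/-- By `coev_nat` the factor `map p` on the dual strand may be traded for another `p` on the first
strand, where it is absorbed. So truncating the unit on one strand is the same as truncating it on
both. -/
lemma coev_idem {F : a ⟶ b} {p : F ⟶ F} (hp : p ≫ p = p) :
    D.coev F ≫ hh p (D.map p) = D.coev F ≫ hh p (𝟙 (D.star F)) := by
  have h : hh p (D.map p) = hh (𝟙 F) (D.map p) ≫ hh p (𝟙 (D.star F)) := by
    rw [← hh_comp, Category.id_comp, Category.comp_id]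
  rw [h, ← Category.assoc, ← D.coev_nat, Category.assoc, ← hh_comp, hp, Category.comp_id]

lemma coev_idem' {F : a ⟶ b} {p : F ⟶ F} (hp : p ≫ p = p) :
    D.coev F ≫ hh p (D.map p) = D.coev F ≫ hh (𝟙 F) (D.map p) := by
  rw [coev_idem D hp, D.coev_nat]

lemma ev_idem {F : a ⟶ b} {p : F ⟶ F} (hp : p ≫ p = p) :
    hh (D.map p) p ≫ D.ev F = hh (D.map p) (𝟙 F) ≫ D.ev F := by
  have h : hh (D.map p) p = hh (D.map p) (𝟙 F) ≫ hh (𝟙 (D.star F)) p := by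
    rw [← hh_comp, Category.id_comp, Category.comp_id]
  rw [h, Category.assoc, D.ev_nat, ← Category.assoc, ← hh_comp, ← D.map_comp, hp, Category.comp_id]

lemma ev_idem' {F : a ⟶ b} {p : F ⟶ F} (hp : p ≫ p = p) :
    hh (D.map p) p ≫ D.ev F = hh (𝟙 (D.star F)) p ≫ D.ev F := by
  rw [ev_idem D hp, D.ev_nat]

end Duality

/-! ### Dualities of idempotent completions -/

namespace KarBicat

open CategoryTheory.Idempotents

section

variable {B : Type u} [Bicategory.{w, v} B] {a b c d : KarBicat B}

lemma hh_eq_hc {F F' : a ⟶ b} {G G' : b ⟶ c} (η : F ⟶ F') (θ : G ⟶ G') : hh η θ = hc η θ := by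
  refine ext_un ?_
  change hh (un η) G.p ≫ hh F'.p (un θ) = hh (un η) (un θ)
  rw [← hh_comp, un_p, p_un]

lemma un_hh {F F' : a ⟶ b} {G G' : b ⟶ c} (η : F ⟶ F') (θ : G ⟶ G') :
    un (hh η θ) = hh (un η) (un θ) := congrArg un (hh_eq_hc η θ)

/-- A 2-morphism of the completion is often the source idempotent followed by a 2-morphism of `B`.
This form is stable under vertical and horizontal composition, so that coherence laws reduce to
those of `B` preceded by one common idempotent. -/
lemma raw_hh {P P' : a ⟶ b} {Q Q' : b ⟶ c} {η : P ⟶ P'} {θ : Q ⟶ Q'} {x : P.X ⟶ P'.X}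
    {y : Q.X ⟶ Q'.X} (hx : un η = P.p ≫ x) (hy : un θ = Q.p ≫ y) :
    un (hh η θ) = (P ≫ Q).p ≫ hh x y := by
  rw [hh_eq_hc]
  exact raw_hc hx hy

lemma un_isoMk_comp {P Q R : a ⟶ b} (φ : P.X ≅ Q.X) (h : P.p ≫ φ.hom = φ.hom ≫ Q.p)
    (η : Q ⟶ R) : un ((isoMk φ h).hom ≫ η) = φ.hom ≫ un η := by
  rw [un_comp, un_isoMk_hom', Category.assoc, p_un]

lemma un_comp_isoMk {P Q R : a ⟶ b} (φ : P.X ≅ Q.X) (h : P.p ≫ φ.hom = φ.hom ≫ Q.p)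
    (η : R ⟶ P) : un (η ≫ (isoMk φ h).hom) = un η ≫ φ.hom := by
  rw [un_comp, un_isoMk_hom, ← Category.assoc, un_p]

variable (D : Duality B)

/-- The action of `⋆` on direct summands. -/
abbrev starK (P : a ⟶ b) : b ⟶ a :=
  Karoubi.mk (D.star P.X) (D.map P.p) (by rw [← D.map_comp, P.idem])

/-- The action of `⋆` on 2-morphisms. -/
def mapK {P Q : a ⟶ b} (η : P ⟶ Q) : starK D Q ⟶ starK D P :=
  mk' (D.map (un η)) (by
    change D.map Q.p ≫ _ ≫ D.map P.p = _
    rw [← D.map_comp, ← D.map_comp, p_un, un_p])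

lemma un_mapK {P Q : a ⟶ b} (η : P ⟶ Q) : un (mapK D η) = D.map (un η) := rfl

/-- `⋆` reverses composition, so a factorisation with the idempotent at the target becomes one with
the idempotent at the source, as `raw_comp` requires. -/
lemma raw_mapK {P Q : a ⟶ b} {η : P ⟶ Q} {x : P.X ⟶ Q.X} (hx : un η = x ≫ Q.p) :
    un (mapK D η) = (starK D Q).p ≫ D.map x := by
  rw [un_mapK, hx, D.map_comp]

/-- Compatibility of `⋆` with composition. -/
def mulK (P : a ⟶ b) (Q : b ⟶ c) : starK D Q ≫ starK D P ≅ starK D (P ≫ Q) :=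
  isoMk (P := starK D Q ≫ starK D P) (Q := starK D (P ≫ Q)) (D.mul P.X Q.X) (D.mul_hh P.p Q.p).symm

/-- Compatibility of `⋆` with identities. -/
def unitK (a : KarBicat B) : 𝟙 a ≅ starK D (𝟙 a) :=
  isoMk (P := 𝟙 a) (Q := starK D (𝟙 a)) (D.unit a.as) (D.map_unit (𝟙 _)).symm

/-- The isomorphism from a 1-morphism to its double dual. -/
def invK (P : a ⟶ b) : P ≅ starK D (starK D P) :=
  isoMk (P := P) (Q := starK D (starK D P)) (D.inv P.X) (D.inv_naturality P.p)

lemma un_mulK (P : a ⟶ b) (Q : b ⟶ c) :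
    un (mulK D P Q).hom = (starK D Q ≫ starK D P).p ≫ (D.mul P.X Q.X).hom := rfl

lemma un_unitK (a : KarBicat B) : un (unitK D a).hom = (𝟙 a : a ⟶ a).p ≫ (D.unit a.as).hom := rfl

lemma un_invK (P : a ⟶ b) : un (invK D P).hom = P.p ≫ (D.inv P.X).hom := rfl

/-- The unit of the adjunction. -/
def coevK (P : a ⟶ b) : 𝟙 a ⟶ P ≫ starK D P :=
  mk' (P := 𝟙 a) (Q := P ≫ starK D P) (D.coev P.X ≫ hh P.p (D.map P.p)) (by
    change 𝟙 _ ≫ (D.coev P.X ≫ hh P.p (D.map P.p)) ≫ hh P.p (D.map P.p) = _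
    rw [Category.id_comp, Category.assoc, ← hh_comp, ← D.map_comp, P.idem])

/-- The counit of the adjunction. -/
def evK (P : a ⟶ b) : starK D P ≫ P ⟶ 𝟙 b :=
  mk' (P := starK D P ≫ P) (Q := 𝟙 b) (hh (D.map P.p) P.p ≫ D.ev P.X) (by
    change hh (D.map P.p) P.p ≫ (hh (D.map P.p) P.p ≫ D.ev P.X) ≫ 𝟙 _ = _
    rw [Category.comp_id, ← Category.assoc, ← hh_comp, ← D.map_comp, P.idem])

lemma un_coevK (P : a ⟶ b) : un (coevK D P) = D.coev P.X ≫ hh P.p (D.map P.p) := rfl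

lemma un_evK (P : a ⟶ b) : un (evK D P) = (starK D P ≫ P).p ≫ D.ev P.X := rfl

lemma left_triangleK (P : a ⟶ b) :
    hh (coevK D P) (𝟙 P) ≫ (α_ P (starK D P) P).hom ≫ hh (𝟙 P) (evK D P) ≫ (ρ_ P).hom =
      (λ_ P).hom := by
  refine ext_un ?_
  have h1 := raw_comp (un_as P (starK D P) P)
    (raw_comp (raw_hh (raw_id P) (un_evK D P)) (un_ru P))
  refine (congrArg (un (hh (coevK D P) (𝟙 P)) ≫ ·) h1).trans ?_
  -- The unit is truncated on both strands; keeping only the truncation on `P` puts the zigzag into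
  -- the form of `left_triangle_comp`.
  rw [← Category.assoc, un_p, un_hh, un_coevK, D.coev_idem P.idem]
  refine (D.left_triangle_comp P.p P.p).trans ?_
  rw [P.idem]
  exact (un_lu' P).symm

lemma right_triangleK (P : a ⟶ b) :
    hh (𝟙 (starK D P)) (coevK D P) ≫ (α_ (starK D P) P (starK D P)).inv ≫
      hh (evK D P) (𝟙 (starK D P)) ≫ (λ_ (starK D P)).hom = (ρ_ (starK D P)).hom := by
  refine ext_un ?_
  have h1 := raw_comp (raw_hh (un_evK D P) (raw_id (starK D P))) (un_lu (starK D P))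
  have h2 : un (α_ (starK D P) P (starK D P)).inv =
    (α_ (D.star P.X) P.X (D.star P.X)).inv ≫ ((starK D P ≫ P) ≫ starK D P).p := rfl
  -- The inverse associator carries its idempotent at the target by definition; naturality moves it
  -- to the source, the form needed for `raw_comp`.
  have h3 : (starK D P ≫ P ≫ starK D P).p ≫ (α_ (D.star P.X) P.X (D.star P.X)).inv =
      (α_ (D.star P.X) P.X (D.star P.X)).inv ≫ ((starK D P ≫ P) ≫ starK D P).p := by
    rw [Iso.comp_inv_eq, Category.assoc]
    refine Eq.trans ?_ (congrArg (_ ≫ ·) (hh_assoc _ _ _).symm)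
    exact (Iso.inv_hom_id_assoc _ _).symm
  refine (congrArg (un (hh (𝟙 (starK D P)) (coevK D P)) ≫ ·)
    (raw_comp (h2.trans h3.symm) h1)).trans ?_
  rw [← Category.assoc, un_p, un_hh, un_coevK, D.coev_idem' P.idem]
  refine (D.right_triangle_comp (D.map P.p) (D.map P.p)).trans ?_
  rw [← D.map_comp, P.idem]
  exact (un_ru' (starK D P)).symm

/-- The truncation on both sides can be placed on the strand where `un η` or its dual absorbs it.
The remaining idempotents are moved across the unit and absorbed in turn, which leaves naturality of
the unit in `B`. -/
lemma coevK_nat {P Q : a ⟶ b} (η : P ⟶ Q) :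
    coevK D P ≫ hh η (𝟙 (starK D P)) = coevK D Q ≫ hh (𝟙 Q) (mapK D η) := by
  refine ext_un ?_
  rw [un_comp, un_comp, un_hh, un_hh, un_coevK, un_coevK, un_mapK, un_id, un_id,
    D.coev_idem P.idem, D.coev_idem' Q.idem, Category.assoc, Category.assoc, ← hh_comp, ← hh_comp,
    p_un, Category.id_comp, Category.id_comp, ← D.map_comp, un_p]
  have h1 : hh (un η) (D.map P.p) = hh (𝟙 P.X) (D.map P.p) ≫ hh (un η) (𝟙 (D.star P.X)) := by
    rw [← hh_comp, Category.id_comp, Category.comp_id]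
  have h2 : hh Q.p (D.map (un η)) = hh Q.p (𝟙 (D.star Q.X)) ≫ hh (𝟙 Q.X) (D.map (un η)) := by
    rw [← hh_comp, Category.id_comp, Category.comp_id]
  rw [h1, h2, ← Category.assoc, ← D.coev_nat, ← Category.assoc, D.coev_nat Q.p, Category.assoc,
    Category.assoc, ← hh_comp, ← hh_comp, p_un, ← D.map_comp, un_p]
  simp only [Category.id_comp]
  exact D.coev_nat (un η)

lemma evK_nat {P Q : a ⟶ b} (η : P ⟶ Q) :
    hh (𝟙 (starK D Q)) η ≫ evK D Q = hh (mapK D η) (𝟙 P) ≫ evK D P := by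
  refine ext_un ?_
  have h0 : ∀ R : a ⟶ b, un (evK D R) = hh (D.map R.p) R.p ≫ D.ev R.X := fun _ => rfl
  rw [un_comp, un_comp, un_hh, un_hh, h0, h0, un_mapK, un_id, un_id, D.ev_idem' Q.idem,
    D.ev_idem P.idem, ← Category.assoc, ← Category.assoc, ← hh_comp, ← hh_comp, un_p,
    ← D.map_comp, p_un, Category.comp_id, Category.comp_id]
  change hh (D.map Q.p) (un η) ≫ _ = _
  have h1 : hh (D.map Q.p) (un η) = hh (𝟙 (D.star Q.X)) (un η) ≫ hh (D.map Q.p) (𝟙 Q.X) := by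
    rw [← hh_comp, Category.id_comp, Category.comp_id]
  have h2 : hh (D.map (un η)) P.p = hh (D.map (un η)) (𝟙 P.X) ≫ hh (𝟙 (D.star P.X)) P.p := by
    rw [← hh_comp, Category.id_comp, Category.comp_id]
  rw [h1, h2, Category.assoc, ← D.ev_nat, Category.assoc, D.ev_nat P.p, ← Category.assoc,
    ← Category.assoc, ← hh_comp, ← hh_comp, un_p, ← D.map_comp, p_un]
  simp only [Category.comp_id]
  exact D.ev_nat (un η)

/-- The duality structure of the idempotent completion. -/
def duality' : Duality (KarBicat B) where
  star := starK D
  map := mapK D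
  map_id P := rfl
  map_comp η θ := ext_un (D.map_comp _ _)
  mul := mulK D
  unit := unitK D
  mul_hh {a b c P P' Q Q'} η θ := by
    refine ext_un ?_
    refine (un_isoMk_comp (P := starK D Q' ≫ starK D P') (Q := starK D (P' ≫ Q'))
      (D.mul P'.X Q'.X) _ _).trans ?_
    refine Eq.trans ?_ (un_comp_isoMk (P := starK D Q ≫ starK D P) (Q := starK D (P ≫ Q))
      (D.mul P.X Q.X) _ _).symm
    rw [un_mapK, un_hh, un_hh]
    exact D.mul_hh (un η) (un θ)
  mul_assoc P Q R := ext_un (by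
    have h1 := raw_comp (raw_hh (un_mulK D Q R) (raw_id (starK D P)))
      (raw_comp (un_mulK D P (Q ≫ R)) (raw_mapK D (un_as' P Q R)))
    have h2 := raw_comp (un_as (starK D R) (starK D Q) (starK D P))
      (raw_comp (raw_hh (raw_id (starK D R)) (un_mulK D P Q)) (un_mulK D (P ≫ Q) R))
    refine h1.trans (Eq.trans ?_ h2.symm)
    exact congrArg (_ ≫ ·) (D.mul_assoc P.X Q.X R.X))
  unit_mul {a b} P := ext_un (by
    have h1 := raw_comp (raw_hh (raw_id (starK D P)) (un_unitK D a)) (un_mulK D (𝟙 a) P)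
    have h2 := raw_comp (un_ru (starK D P)) (raw_mapK D (un_lu' P))
    refine h1.trans (Eq.trans ?_ h2.symm)
    exact congrArg (_ ≫ ·) (D.unit_mul P.X))
  mul_unit {a b} P := ext_un (by
    have h1 := raw_comp (raw_hh (un_unitK D b) (raw_id (starK D P))) (un_mulK D P (𝟙 b))
    have h2 := raw_comp (un_lu (starK D P)) (raw_mapK D (un_ru' P))
    refine h1.trans (Eq.trans ?_ h2.symm)
    exact congrArg (_ ≫ ·) (D.mul_unit P.X))
  inv := invK D
  inv_naturality {a b P Q} η := ext_un (by
    refine (un_comp_isoMk (P := Q) (Q := starK D (starK D Q)) (D.inv Q.X) _ _).trans ?_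
    refine Eq.trans ?_ (un_isoMk_comp (P := P) (Q := starK D (starK D P)) (D.inv P.X) _ _).symm
    exact D.inv_naturality (un η))
  inv_mul P Q := ext_un (by
    have h1 := raw_comp (raw_hh (un_invK D P) (un_invK D Q)) (un_mulK D (starK D Q) (starK D P))
    have h2 := raw_comp (un_invK D (P ≫ Q)) (raw_mapK D
      (un_isoMk_hom' (P := starK D Q ≫ starK D P) (Q := starK D (P ≫ Q)) (D.mul P.X Q.X)
        (D.mul_hh P.p Q.p).symm))
    refine h1.trans (Eq.trans ?_ h2.symm)
    exact congrArg (_ ≫ ·) (D.inv_mul P.X Q.X))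
  inv_unit a := ext_un (by
    have h2 := raw_comp (un_invK D (𝟙 a)) (raw_mapK D
      (un_isoMk_hom' (P := 𝟙 a) (Q := starK D (𝟙 a)) (D.unit a.as) (D.map_unit (𝟙 _)).symm))
    refine (un_unitK D a).trans (Eq.trans ?_ h2.symm)
    exact congrArg (_ ≫ ·) (D.inv_unit a.as))
  coev := coevK D
  ev := evK D
  left_triangle := left_triangleK D
  right_triangle := right_triangleK D
  coev_nat := coevK_nat D
  ev_nat := evK_nat D
  map_unit {a} e := ext_un (by
    refine (un_isoMk_comp (P := 𝟙 a) (Q := starK D (𝟙 a)) (D.unit a.as) _ _).trans ?_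
    refine Eq.trans ?_ (un_comp_isoMk (P := 𝟙 a) (Q := starK D (𝟙 a)) (D.unit a.as) _ _).symm
    exact D.map_unit (un e))

end

variable {k : Type*} [Field k] {B : Type u} [Bicategory.{w, v} B] [PreaddBicategory B]
  [LinBicategory k B] (D : LinDuality k B)

/-- The linear duality structure of the idempotent completion. -/
def duality : LinDuality k (KarBicat B) where
  toDuality := duality' D.toDuality
  map_add _ _ := ext_un (D.map_add _ _)
  map_smul _ _ := ext_un (D.map_smul _ _)

end KarBicat

/-! ### Dualities after splitting identities -/

namespace Duality

variable {B : Type u} [Bicategory.{w, v} B] (D : Duality B) {a b : B}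

lemma map_leftUnitor (F : a ⟶ b) : D.map (λ_ F).hom =
    (ρ_ (D.star F)).inv ≫ hh (𝟙 (D.star F)) (D.unit a).hom ≫ (D.mul (𝟙 a) F).hom := by
  rw [D.unit_mul, Iso.inv_hom_id_assoc]

lemma map_rightUnitor (F : a ⟶ b) : D.map (ρ_ F).hom =
    (λ_ (D.star F)).inv ≫ hh (D.unit b).hom (𝟙 (D.star F)) ≫ (D.mul F (𝟙 b)).hom := by
  rw [D.mul_unit, Iso.inv_hom_id_assoc]

/-- `⋆` reverses 1-morphisms, so a cut at the source becomes a cut at the target. It is a cut by `e`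
itself, not by `map e`, because `map_unit` identifies the two through the unit constraint. -/
lemma map_cutLeft (e : 𝟙 a ⟶ 𝟙 a) (F : a ⟶ b) : D.map (cutLeft e F) = cutRight (D.star F) e := by
  have h1 : D.map (λ_ F).hom ≫ D.map (λ_ F).inv = 𝟙 _ := by
    rw [← D.map_comp, Iso.inv_hom_id, D.map_id]
  have h2 : hh (𝟙 (D.star F)) (D.unit a).hom ≫ hh (𝟙 (D.star F)) (D.map e) =
      hh (𝟙 (D.star F)) e ≫ hh (𝟙 (D.star F)) (D.unit a).hom := by
    rw [← hh_comp, ← hh_comp, D.map_unit]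
  rw [cutLeft, D.map_comp, D.map_comp, map_leftUnitor, ← hh_id_right]
  simp only [Category.assoc]
  rw [← Category.assoc (D.mul _ _).hom, D.mul_hh, D.map_id, Category.assoc, reassoc_of% h2,
    cutRight, ← hh_id_left, ← Category.assoc (hh _ (D.unit a).hom), D.unit_mul, Category.assoc, h1,
    Category.comp_id]

lemma map_cutRight (F : a ⟶ b) (e : 𝟙 b ⟶ 𝟙 b) : D.map (cutRight F e) = cutLeft e (D.star F) := by
  have h1 : D.map (ρ_ F).hom ≫ D.map (ρ_ F).inv = 𝟙 _ := by
    rw [← D.map_comp, Iso.inv_hom_id, D.map_id]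
  have h2 : hh (D.unit b).hom (𝟙 (D.star F)) ≫ hh (D.map e) (𝟙 (D.star F)) =
      hh e (𝟙 (D.star F)) ≫ hh (D.unit b).hom (𝟙 (D.star F)) := by
    rw [← hh_comp, ← hh_comp, D.map_unit]
  rw [cutRight, D.map_comp, D.map_comp, map_rightUnitor, ← hh_id_left]
  simp only [Category.assoc]
  rw [← Category.assoc (D.mul _ _).hom, D.mul_hh, D.map_id, Category.assoc, reassoc_of% h2,
    cutLeft, ← hh_id_right, ← Category.assoc (hh (D.unit b).hom _), D.mul_unit, Category.assoc, h1,
    Category.comp_id]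

/-- Cuts on the two sides are exchanged and the idempotents kept, so `⋆` is well defined on the
1-morphisms of `SplitBicat` and preserves its objects. -/
lemma inCorner_star {e : 𝟙 a ⟶ 𝟙 a} {e' : 𝟙 b ⟶ 𝟙 b} {F : a ⟶ b} (h : InCorner e e' F) :
    InCorner e' e (D.star F) := by
  change cutLeft e' (D.star F) ≫ cutRight (D.star F) e = 𝟙 _
  have h : cutLeft e F ≫ cutRight F e' = 𝟙 F := h
  rw [← map_cutLeft, ← map_cutRight, ← D.map_comp, h, D.map_id]

/-- For the inclusion `i` of the summand, `i ≫ unit ≫ map i` is the unit constraint restricted to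
it. The law follows from the one for the full identity and naturality of `mul`; no retraction of `i`
is required. -/
lemma unit_mul_of_hom {o : a ⟶ a} (i : o ⟶ 𝟙 a) (F : a ⟶ b) :
    hh (𝟙 (D.star F)) (i ≫ (D.unit a).hom ≫ D.map i) ≫ (D.mul o F).hom =
      (D.star F ◁ i ≫ (ρ_ (D.star F)).hom) ≫ D.map (i ▷ F ≫ (λ_ F).hom) := by
  have h : ∀ {x y z w : a ⟶ a} (r : x ⟶ y) (s : y ⟶ z) (t : z ⟶ w),
      hh (𝟙 (D.star F)) (r ≫ s ≫ t) =
        hh (𝟙 (D.star F)) r ≫ hh (𝟙 (D.star F)) s ≫ hh (𝟙 (D.star F)) t := by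
    intros
    simp [hh_id_left]
  have h1 := D.mul_hh i (𝟙 F)
  rw [D.map_id] at h1
  rw [h, D.map_comp, ← hh_id_left, ← hh_id_right]
  simp only [Category.assoc]
  rw [← h1, ← Category.assoc (hh _ (D.unit a).hom), D.unit_mul, Category.assoc]

lemma mul_unit_of_hom {o : b ⟶ b} (F : a ⟶ b) (i : o ⟶ 𝟙 b) :
    hh (i ≫ (D.unit b).hom ≫ D.map i) (𝟙 (D.star F)) ≫ (D.mul F o).hom =
      (i ▷ D.star F ≫ (λ_ (D.star F)).hom) ≫ D.map (F ◁ i ≫ (ρ_ F).hom) := by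
  have h : ∀ {x y z w : b ⟶ b} (r : x ⟶ y) (s : y ⟶ z) (t : z ⟶ w),
      hh (r ≫ s ≫ t) (𝟙 (D.star F)) =
        hh r (𝟙 (D.star F)) ≫ hh s (𝟙 (D.star F)) ≫ hh t (𝟙 (D.star F)) := by
    intros
    simp [hh_id_right]
  have h1 := D.mul_hh (𝟙 F) i
  rw [D.map_id] at h1
  rw [h, D.map_comp, ← hh_id_left, ← hh_id_right]
  simp only [Category.assoc]
  rw [← h1, ← Category.assoc (hh (D.unit b).hom _), D.mul_unit, Category.assoc]

lemma inv_unit_of_hom {o : a ⟶ a} (i : o ⟶ 𝟙 a) : i ≫ (D.unit a).hom ≫ D.map i =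
    (D.inv o).hom ≫ D.map (i ≫ (D.unit a).hom ≫ D.map i) := by
  rw [D.map_comp, D.map_comp]
  simp only [Category.assoc]
  rw [← Category.assoc (D.inv o).hom, ← D.inv_naturality, Category.assoc,
    ← Category.assoc (D.inv _).hom, ← D.inv_unit]

/-- Projecting the counit to the summand and including it again inserts the cut by `p ≫ i'`, which
acts as the identity on `F`. What remains is the original zigzag preceded by `i`. -/
lemma left_triangle_of_hom {o : a ⟶ a} {o' : b ⟶ b} (i : o ⟶ 𝟙 a) (p : 𝟙 b ⟶ o') (i' : o' ⟶ 𝟙 b)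
    {F : a ⟶ b} (h : cutRight F (p ≫ i') = 𝟙 F) :
    hh (i ≫ D.coev F) (𝟙 F) ≫ (α_ F (D.star F) F).hom ≫ hh (𝟙 F) (D.ev F ≫ p) ≫
      F ◁ i' ≫ (ρ_ F).hom = i ▷ F ≫ (λ_ F).hom := by
  have h1 : hh (𝟙 F) (D.ev F ≫ p) ≫ F ◁ i' ≫ (ρ_ F).hom = hh (𝟙 F) (D.ev F) ≫ (ρ_ F).hom := by
    have h2 : F ◁ p ≫ F ◁ i' ≫ (ρ_ F).hom = (ρ_ F).hom := by
      rw [cutRight, Iso.inv_comp_eq, Category.comp_id, whiskerLeft_comp, Category.assoc] at h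
      exact h
    rw [hh_id_left, hh_id_left, whiskerLeft_comp, Category.assoc, h2]
  rw [h1, ← D.left_triangle F, hh_id_right, comp_whiskerRight, ← hh_id_right (D.coev F)]
  simp only [Category.assoc]

lemma right_triangle_of_hom {o : a ⟶ a} {o' : b ⟶ b} (i : o ⟶ 𝟙 a) (p : 𝟙 b ⟶ o')
    (i' : o' ⟶ 𝟙 b) {F : a ⟶ b} (h : cutLeft (p ≫ i') (D.star F) = 𝟙 (D.star F)) :
    hh (𝟙 (D.star F)) (i ≫ D.coev F) ≫ (α_ (D.star F) F (D.star F)).inv ≫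
      hh (D.ev F ≫ p) (𝟙 (D.star F)) ≫ i' ▷ D.star F ≫ (λ_ (D.star F)).hom =
      D.star F ◁ i ≫ (ρ_ (D.star F)).hom := by
  have h1 : hh (D.ev F ≫ p) (𝟙 (D.star F)) ≫ i' ▷ D.star F ≫ (λ_ (D.star F)).hom =
      hh (D.ev F) (𝟙 (D.star F)) ≫ (λ_ (D.star F)).hom := by
    have h2 : p ▷ D.star F ≫ i' ▷ D.star F ≫ (λ_ (D.star F)).hom = (λ_ (D.star F)).hom := by
      rw [cutLeft, Iso.inv_comp_eq, Category.comp_id, comp_whiskerRight, Category.assoc] at h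
      exact h
    rw [hh_id_right, hh_id_right, comp_whiskerRight, Category.assoc, h2]
  rw [h1, ← D.right_triangle F, hh_id_left, whiskerLeft_comp, ← hh_id_left _ (D.coev F)]
  simp only [Category.assoc]

/-- An endomorphism `e` of the summand extends to `p ≫ e ≫ i` on the full identity, where `map_unit`
is available; restricting again recovers `e`. -/
lemma map_unit_of_retract {o : a ⟶ a} (i : o ⟶ 𝟙 a) (p : 𝟙 a ⟶ o) (h : i ≫ p = 𝟙 o)
    (e : o ⟶ o) : (i ≫ (D.unit a).hom ≫ D.map i) ≫ D.map e =
      e ≫ i ≫ (D.unit a).hom ≫ D.map i := by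
  have h1 := congrArg (fun t => i ≫ t ≫ D.map i) (D.map_unit (p ≫ e ≫ i))
  simp only [Category.assoc, ← D.map_comp] at h1
  rw [reassoc_of% h, reassoc_of% h] at h1
  simp only [Category.assoc, ← D.map_comp]
  exact h1

end Duality

namespace SplitBicat

variable {B : Type u} [Bicategory.{w, v} B] [PreaddBicategory B]
  [∀ a b : B, IsIdempotentComplete (a ⟶ b)] (D : Duality B) {a b c d : SplitBicat B}

/-- The action of `⋆` on 1-morphisms in the corner. -/
abbrev starS (F : a ⟶ b) : b ⟶ a := ⟨D.star (u1 F), D.inCorner_star F.property⟩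

/-- The identity constraint on the direct summands of the identities. -/
def unitB (a : SplitBicat B) : a.one ≅ D.star a.one where
  hom := a.incl ≫ (D.unit a.obj).hom ≫ D.map a.incl
  inv := D.map a.proj ≫ (D.unit a.obj).inv ≫ a.proj
  hom_inv_id := by
    have h : D.map a.incl ≫ D.map a.proj = D.map a.e := by rw [← D.map_comp, proj_incl]
    simp only [Category.assoc]
    rw [reassoc_of% h, ← Category.assoc (D.unit a.obj).hom, D.map_unit, Category.assoc,
      Iso.hom_inv_id_assoc, ← proj_incl, Category.assoc, incl_proj, Category.comp_id, incl_proj]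
  inv_hom_id := by
    have h : (D.unit a.obj).inv ≫ a.e ≫ (D.unit a.obj).hom = D.map a.e := by
      rw [← D.map_unit, Iso.inv_hom_id_assoc]
    have h' : D.map a.proj ≫ D.map a.incl = 𝟙 _ := by rw [← D.map_comp, incl_proj, D.map_id]
    simp only [Category.assoc]
    rw [← Category.assoc a.proj, proj_incl, reassoc_of% h, ← D.map_comp, ← proj_incl,
      ← Category.assoc, incl_proj, Category.id_comp, h']

/-- The unit of the adjunction. -/
def coevS (F : a ⟶ b) : 𝟙 a ⟶ F ≫ starS D F :=
  mk2 (F := 𝟙 a) (G := F ≫ starS D F) (a.incl ≫ D.coev (u1 F))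

/-- The counit of the adjunction. -/
def evS (F : a ⟶ b) : starS D F ≫ F ⟶ 𝟙 b :=
  mk2 (F := starS D F ≫ F) (G := 𝟙 b) (D.ev (u1 F) ≫ b.proj)

/-- The duality structure on the 2-category with split identities. -/
def duality' : Duality (SplitBicat B) where
  star := starS D
  map {a b F G} η := mk2 (F := starS D G) (G := starS D F) (D.map (u2 η))
  map_id F := ext_u2 (D.map_id (u1 F))
  map_comp η θ := ext_u2 (D.map_comp (u2 η) (u2 θ))
  mul F G := iso2 (F := starS D G ≫ starS D F) (G := starS D (F ≫ G)) (D.mul (u1 F) (u1 G))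
  unit a := iso2 (F := 𝟙 a) (G := starS D (𝟙 a)) (unitB D a)
  mul_hh η θ := ext_u2 (D.mul_hh (u2 η) (u2 θ))
  mul_assoc F G H := ext_u2 (D.mul_assoc (u1 F) (u1 G) (u1 H))
  unit_mul {a _} F := ext_u2 (D.unit_mul_of_hom a.incl (u1 F))
  mul_unit {_ b} F := ext_u2 (D.mul_unit_of_hom (u1 F) b.incl)
  inv F := iso2 (F := F) (G := starS D (starS D F)) (D.inv (u1 F))
  inv_naturality η := ext_u2 (D.inv_naturality (u2 η))
  inv_mul F G := ext_u2 (D.inv_mul (u1 F) (u1 G))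
  inv_unit a := ext_u2 (D.inv_unit_of_hom a.incl)
  coev := coevS D
  ev := evS D
  left_triangle {a b} F := ext_u2 (D.left_triangle_of_hom a.incl b.proj b.incl (by
    rw [proj_incl]
    exact InCorner.right a.prim.idem F.property))
  right_triangle {a b} F := ext_u2 (D.right_triangle_of_hom a.incl b.proj b.incl (by
    rw [proj_incl]
    exact InCorner.left b.prim.idem (D.inCorner_star F.property)))
  coev_nat {a _ F G} η := ext_u2 (by
    refine (Category.assoc _ _ _).trans (Eq.trans ?_ (Category.assoc _ _ _).symm)
    exact congrArg (a.incl ≫ ·) (D.coev_nat (u2 η)))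
  ev_nat {_ b F G} η := ext_u2 (by
    refine (Category.assoc _ _ _).symm.trans (Eq.trans ?_ (Category.assoc _ _ _))
    exact congrArg (· ≫ b.proj) (D.ev_nat (u2 η)))
  map_unit {a} e := ext_u2 (D.map_unit_of_retract a.incl a.proj a.incl_proj (u2 e))

variable {k : Type*} [Field k] [LinBicategory k B]

/-- The linear duality structure on the 2-category with split identities. -/
def duality (D : LinDuality k B) : LinDuality k (SplitBicat B) where
  toDuality := duality' D.toDuality
  map_add η θ := ext_u2 (D.map_add (u2 η) (u2 θ))
  map_smul r η := ext_u2 (D.map_smul r (u2 η))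

end SplitBicat

/-! ### The duality structure of the first 2-category -/

namespace ACat

variable {n : ℕ} {a b c d : ACat n}

instance : Finite (ACat n) :=
  Finite.of_injective (fun _ : ACat n => PUnit.unit) fun ⟨⟩ ⟨⟩ _ => rfl

instance (a b : ACat n) : Finite (a ⟶ b) :=
  Finite.of_injective (fun f : a ⟶ b => perm f) fun ⟨_⟩ ⟨_⟩ h => congrArg Mor1.mk h

instance (f g : a ⟶ b) : Finite (f ⟶ g) :=
  have : Finite (SetRel (Fin n) (Fin n)) := inferInstanceAs (Finite (Set (Fin n × Fin n)))
  Finite.of_injective (fun α : f ⟶ g => val α) fun _ _ h => Mor2.ext h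

lemma hh_eq_hc {f f' : a ⟶ b} {g g' : b ⟶ c} (η : f ⟶ f') (θ : g ⟶ g') : hh η θ = hc η θ := by
  refine ext_val fun x z => ?_
  change (x, z) ∈ val (hc η (𝟙 g) ≫ hc (𝟙 f') θ) ↔ _
  simp only [mem_comp, mem_hc, mem_id]
  constructor
  · rintro ⟨⟨y, h1, h2⟩, y', h3, h4⟩
    rw [mem_right η h1] at h3
    exact ⟨y, h1, h3 ▸ h4⟩
  · rintro ⟨y, h1, h2⟩
    exact ⟨⟨y, h1, mem_left θ h2⟩, y, mem_right η h1, h2⟩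

lemma mem_hh {f f' : a ⟶ b} {g g' : b ⟶ c} (η : f ⟶ f') (θ : g ⟶ g') {x z : Fin n} :
    (x, z) ∈ val (hh η θ) ↔ ∃ y, (x, y) ∈ val η ∧ (y, z) ∈ val θ := by
  rw [hh_eq_hc, mem_hc]

/-- The action of `⋆` on 1-morphisms. -/
def starA (f : a ⟶ b) : b ⟶ a := Mor1.mk (perm f)⁻¹

lemma perm_starA (f : a ⟶ b) : perm (starA f) = (perm f)⁻¹ := rfl

/-- The action of `⋆` on 2-morphisms: inversion of relations. -/
def mapA {f g : a ⟶ b} (η : f ⟶ g) : starA g ⟶ starA f :=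
  Mor2.mk {p | (p.2, p.1) ∈ val η}
    (fun p hp => by
      change (perm g)⁻¹ p.1 = p.2
      exact Equiv.Perm.inv_eq_iff_eq.mpr (mem_right η hp).symm)
    (fun p hp => by
      change (perm f)⁻¹ p.1 = p.2
      exact Equiv.Perm.inv_eq_iff_eq.mpr (mem_left η hp).symm)

lemma mem_mapA {f g : a ⟶ b} (η : f ⟶ g) {x y : Fin n} :
    (x, y) ∈ val (mapA η) ↔ (y, x) ∈ val η := Iff.rfl

/-- The underlying relation is the whole graph of the source. -/
def IsFull {f g : a ⟶ b} (η : f ⟶ g) : Prop := ∀ x, (x, perm f x) ∈ val η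

lemma IsFull.perm_eq {f g : a ⟶ b} {η : f ⟶ g} (h : IsFull η) : perm f = perm g :=
  Equiv.ext fun x => (mem_right η (h x)).symm

/-- Between two given 1-morphisms there is at most one full 2-morphism. All structural 2-morphisms
are full and fullness is preserved by both compositions and by `⋆`, so laws involving only
structural 2-morphisms hold automatically. -/
lemma IsFull.eq {f g : a ⟶ b} {η θ : f ⟶ g} (h : IsFull η) (h' : IsFull θ) : η = θ :=
  ext_val fun x _ => ⟨fun hx => mem_left η hx ▸ h' x, fun hx => mem_left θ hx ▸ h x⟩

lemma isFull_isoOfEq {f g : a ⟶ b} (h : perm f = perm g) : IsFull (isoOfEq h).hom := fun _ => rfl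

lemma isFull_isoOfEq_inv {f g : a ⟶ b} (h : perm f = perm g) : IsFull (isoOfEq h).inv :=
  fun x => by
    change perm f x = perm g x
    rw [h]

lemma isFull_id (f : a ⟶ b) : IsFull (𝟙 f) := fun _ => rfl

lemma IsFull.comp {f g h : a ⟶ b} {η : f ⟶ g} {θ : g ⟶ h} (h1 : IsFull η) (h2 : IsFull θ) :
    IsFull (η ≫ θ) := fun x => (mem_comp η θ).mpr ⟨h1 x, by rw [h1.perm_eq]; exact h2 x⟩

lemma IsFull.hh {f f' : a ⟶ b} {g g' : b ⟶ c} {η : f ⟶ f'} {θ : g ⟶ g'} (h1 : IsFull η)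
    (h2 : IsFull θ) : IsFull (hh η θ) := fun x => (mem_hh η θ).mpr ⟨_, h1 x, h2 _⟩

lemma IsFull.map {f g : a ⟶ b} {η : f ⟶ g} (h : IsFull η) : IsFull (mapA η) := fun x => by
  refine (mem_mapA η).mpr ?_
  have := h ((perm g)⁻¹ x)
  have hx : perm f ((perm g)⁻¹ x) = x := by rw [h.perm_eq]; exact (perm g).apply_symm_apply x
  rwa [hx] at this

/-- Vertical composition is intersection, and the full graph already contains `θ`. Structural
factors can therefore be dropped from any law. -/
lemma IsFull.mem_comp_left {f g h : a ⟶ b} {η : f ⟶ g} (hη : IsFull η) (θ : g ⟶ h) {x y : Fin n} :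
    (x, y) ∈ val (η ≫ θ) ↔ (x, y) ∈ val θ :=
  (mem_comp η θ).trans ⟨fun h => h.2, fun h => ⟨by
    rw [← mem_left θ h, ← hη.perm_eq]; exact hη x, h⟩⟩

lemma IsFull.mem_comp_right {f g h : a ⟶ b} {θ : g ⟶ h} (hθ : IsFull θ) (η : f ⟶ g) {x y : Fin n} :
    (x, y) ∈ val (η ≫ θ) ↔ (x, y) ∈ val η :=
  (mem_comp η θ).trans ⟨fun h => h.1, fun h => ⟨h, by rw [← mem_right η h]; exact hθ x⟩⟩

/-- Compatibility of `⋆` with composition. -/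
def mulA (f : a ⟶ b) (g : b ⟶ c) : starA g ≫ starA f ≅ starA (f ≫ g) :=
  isoOfEq (mul_inv_rev (perm g) (perm f)).symm

/-- Compatibility of `⋆` with identities. -/
def unitA (a : ACat n) : 𝟙 a ≅ starA (𝟙 a) := isoOfEq inv_one.symm

/-- The isomorphism from a 1-morphism to its double dual. -/
def invA (f : a ⟶ b) : f ≅ starA (starA f) := isoOfEq (inv_inv (perm f)).symm

/-- The unit of the adjunction. -/
def coevA (f : a ⟶ b) : 𝟙 a ⟶ f ≫ starA f := (isoOfEq (inv_mul_cancel (perm f)).symm).hom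

/-- The counit of the adjunction. -/
def evA (f : a ⟶ b) : starA f ≫ f ⟶ 𝟙 b :=
  (isoOfEq (f := starA f ≫ f) (g := 𝟙 b) (mul_inv_cancel (perm f))).hom

lemma isFull_mulA (f : a ⟶ b) (g : b ⟶ c) : IsFull (mulA f g).hom := isFull_isoOfEq _
lemma isFull_unitA (a : ACat n) : IsFull (unitA a).hom := isFull_isoOfEq _
lemma isFull_invA (f : a ⟶ b) : IsFull (invA f).hom := isFull_isoOfEq _
lemma isFull_coevA (f : a ⟶ b) : IsFull (coevA f) := isFull_isoOfEq _
lemma isFull_evA (f : a ⟶ b) : IsFull (evA f) := isFull_isoOfEq _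
lemma isFull_associator (f : a ⟶ b) (g : b ⟶ c) (h : c ⟶ d) : IsFull (α_ f g h).hom :=
  fun _ => rfl
lemma isFull_associator_inv (f : a ⟶ b) (g : b ⟶ c) (h : c ⟶ d) : IsFull (α_ f g h).inv :=
  isFull_isoOfEq_inv (f := (f ≫ g) ≫ h) (g := f ≫ g ≫ h) (mul_assoc _ _ _).symm
lemma isFull_leftUnitor (f : a ⟶ b) : IsFull (λ_ f).hom := fun _ => rfl
lemma isFull_rightUnitor (f : a ⟶ b) : IsFull (ρ_ f).hom := fun _ => rfl

/-- The duality structure given by inversion of permutations and relations. -/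
def duality (n : ℕ) : Duality (ACat n) where
  star := starA
  map := mapA
  map_id f := (isFull_id f).map.eq (isFull_id _)
  map_comp η θ := ext_val fun x y => by simp only [mem_mapA, mem_comp, and_comm]
  mul := mulA
  unit := unitA
  mul_hh {a b c f f' g g'} η θ := ext_val fun x y => by
    rw [(isFull_mulA f' g').mem_comp_left, (isFull_mulA f g).mem_comp_right, mem_mapA, mem_hh,
      mem_hh]
    simp only [mem_mapA, and_comm]
  mul_assoc f g h := (((isFull_mulA g h).hh (isFull_id _)).comp
    ((isFull_mulA f _).comp (isFull_associator f g h).map)).eq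
    ((isFull_associator _ _ _).comp (((isFull_id _).hh (isFull_mulA f g)).comp (isFull_mulA _ h)))
  unit_mul {a _} f := (((isFull_id _).hh (isFull_unitA a)).comp (isFull_mulA _ f)).eq
    ((isFull_rightUnitor _).comp (isFull_leftUnitor f).map)
  mul_unit {_ b} f := (((isFull_unitA b).hh (isFull_id _)).comp (isFull_mulA f _)).eq
    ((isFull_leftUnitor _).comp (isFull_rightUnitor f).map)
  inv := invA
  inv_naturality {_ _ f g} η := ext_val fun x y => by
    rw [(isFull_invA g).mem_comp_right, (isFull_invA f).mem_comp_left, mem_mapA, mem_mapA]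
  inv_mul f g := (((isFull_invA f).hh (isFull_invA g)).comp (isFull_mulA _ _)).eq
    ((isFull_invA _).comp (isFull_mulA f g).map)
  inv_unit a := (isFull_unitA a).eq ((isFull_invA _).comp (isFull_unitA a).map)
  coev := coevA
  ev := evA
  left_triangle f := (((isFull_coevA f).hh (isFull_id f)).comp ((isFull_associator _ _ _).comp
    (((isFull_id f).hh (isFull_evA f)).comp (isFull_rightUnitor f)))).eq (isFull_leftUnitor f)
  right_triangle f := (((isFull_id _).hh (isFull_coevA f)).comp
    ((isFull_associator_inv _ _ _).comp
    (((isFull_evA f).hh (isFull_id _)).comp (isFull_leftUnitor _)))).eq (isFull_rightUnitor _)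
  coev_nat {_ _ f g} η := ext_val fun x y => by
    rw [(isFull_coevA f).mem_comp_left, (isFull_coevA g).mem_comp_left, mem_hh, mem_hh]
    simp only [mem_id, mem_mapA, perm_starA, Equiv.Perm.inv_eq_iff_eq]
    -- Both sides describe the diagonal restricted to the domain of `η`.
    constructor
    · rintro ⟨z, h, rfl⟩
      have h1 := mem_left η h
      have : x = y := (perm f).injective h1
      subst this
      exact ⟨_, mem_right η h, h⟩
    · rintro ⟨z, rfl, h⟩
      have : y = x := (perm g).injective (mem_right η h)
      subst this
      exact ⟨_, h, (mem_left η h).symm⟩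
  ev_nat {_ _ f g} η := ext_val fun x y => by
    rw [(isFull_evA f).mem_comp_right, (isFull_evA g).mem_comp_right, mem_hh, mem_hh]
    simp only [mem_id, mem_mapA, perm_starA, Equiv.Perm.inv_eq_iff_eq]
    -- Here both sides describe the diagonal restricted to the range of `η`.
    constructor
    · rintro ⟨z, rfl, h⟩
      have : y = perm g z := (mem_right η h).symm
      subst this
      exact ⟨z, h, mem_left η h⟩
    · rintro ⟨z, h, rfl⟩
      have h1 := mem_right η h
      have h2 := mem_left η h
      subst h1
      exact ⟨z, rfl, h2 ▸ h⟩
  map_unit {a} e := ext_val fun x y => by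
    rw [(isFull_unitA a).mem_comp_left, (isFull_unitA a).mem_comp_right, mem_mapA]
    -- A 2-endomorphism of the identity is contained in the diagonal, hence symmetric.
    constructor
    · intro h
      have : y = x := mem_left e h
      subst this
      exact h
    · intro h
      have : x = y := mem_left e h
      subst this
      exact h

end ACat

/-! ### The duality structure of the second 2-category -/

namespace Ptn

variable {n : ℕ}

/-- The partition with the two copies of `Fin n` interchanged. -/
abbrev mirror (α : Ptn n) : Ptn n := Setoid.comap Sum.swap α

lemma mirror_mirror (α : Ptn n) : mirror (mirror α) = α := by
  ext u v
  change α (Sum.swap (Sum.swap u)) (Sum.swap (Sum.swap v)) ↔ _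
  rw [Sum.swap_swap, Sum.swap_swap]

lemma mirror_mono {α β : Ptn n} (h : α ≤ β) : mirror α ≤ mirror β := fun _ _ e => h e

/-- `mirror` is a monotone involution, hence an order automorphism, and those preserve joins. -/
lemma mirror_sup (α β : Ptn n) : mirror (α ⊔ β) = mirror α ⊔ mirror β := by
  apply le_antisymm
  · rw [← mirror_mirror (mirror α ⊔ mirror β)]
    refine mirror_mono (sup_le ?_ ?_)
    · conv_lhs => rw [← mirror_mirror α]
      exact mirror_mono le_sup_left
    · conv_lhs => rw [← mirror_mirror β]
      exact mirror_mono le_sup_right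
  · exact sup_le (mirror_mono le_sup_left) (mirror_mono le_sup_right)

/-- Turning the three-layer picture upside down exchanges the outer layers, fixes the middle one and
swaps the two factors. -/
lemma mirror_comp_le (α β : Ptn n) : mirror (comp α β) ≤ comp (mirror β) (mirror α) := by
  intro u v h
  have := glue_le (t := Setoid.comap (Sum.elim (Sum.inr ∘ Sum.inr) (Sum.elim (Sum.inr ∘ Sum.inl)
    Sum.inl)) (glue (mirror β) (mirror α))) (x := i13 (Sum.swap u)) (y := i13 (Sum.swap v)) ?_ ?_ h
  · rcases u with u | u <;> rcases v with v | v <;> exact this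
  · intro x y h
    have := glue_right (mirror β) (mirror α) (x := Sum.swap x) (y := Sum.swap y)
      (by rw [← mirror_mirror α] at h; exact h)
    rcases x with x | x <;> rcases y with y | y <;> exact this
  · intro x y h
    have := glue_left (mirror β) (mirror α) (x := Sum.swap x) (y := Sum.swap y)
      (by rw [← mirror_mirror β] at h; exact h)
    rcases x with x | x <;> rcases y with y | y <;> exact this

lemma mirror_comp (α β : Ptn n) : mirror (comp α β) = comp (mirror β) (mirror α) := by
  refine le_antisymm (mirror_comp_le α β) ?_
  -- The reverse inclusion is the one already proved, applied to the mirrored factors and then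
  -- mirrored.
  have := mirror_mono (mirror_comp_le (mirror β) (mirror α))
  rwa [mirror_mirror, mirror_mirror, mirror_mirror] at this

lemma mirror_ofPerm (π : Equiv.Perm (Fin n)) : mirror (ofPerm π) = ofPerm π⁻¹ := by
  have key : ∀ u : Fin n ⊕ Fin n, Sum.elim π id (Sum.swap u) = π (Sum.elim (⇑π⁻¹) id u) := by
    rintro (x | x)
    · exact (π.apply_symm_apply x).symm
    · rfl
  ext u v
  change Sum.elim π id (Sum.swap u) = Sum.elim π id (Sum.swap v) ↔ _
  rw [key, key, π.injective.eq_iff]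
  rfl

lemma IsPropagating.mirror {α : Ptn n} (h : IsPropagating α) : IsPropagating (mirror α) :=
  fun u => ⟨(h (Sum.swap u)).2, (h (Sum.swap u)).1⟩

end Ptn

/-- Used for the mate laws of `BCat`, where the two sides are pullbacks of one partition along maps
that differ only by moving points within blocks. -/
lemma comap_eq_of_forall {X Y : Type*} (s : Setoid X) {φ ψ : Y → X} (h : ∀ u, s (φ u) (ψ u)) :
    Setoid.comap φ s = Setoid.comap ψ s :=
  Setoid.ext fun u v => ⟨fun e => s.trans (s.symm (h u)) (s.trans e (h v)),
    fun e => s.trans (h u) (s.trans e (s.symm (h v)))⟩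

namespace BCat

open Ptn

variable {n : ℕ} {a b c d : BCat n}

instance : Finite (BCat n) :=
  Finite.of_injective (fun _ : BCat n => PUnit.unit) fun ⟨⟩ ⟨⟩ _ => rfl

instance (a b : BCat n) : Finite (a ⟶ b) :=
  Finite.of_injective (fun f : a ⟶ b => perm f) fun ⟨_⟩ ⟨_⟩ h => congrArg Mor1.mk h

instance (f g : a ⟶ b) : Finite (f ⟶ g) :=
  Finite.of_injective (fun α : f ⟶ g => val α) fun _ _ h => Mor2.ext h

lemma hh_eq_hc {f f' : a ⟶ b} {g g' : b ⟶ c} (η : f ⟶ f') (θ : g ⟶ g') : hh η θ = hc η θ := by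
  refine ext_val ?_
  change val (hc η (𝟙 g) ≫ hc (𝟙 f') θ) = _
  rw [val_comp, val_hc, val_hc, val_hc, val_id, val_id, ← comp_sup le_rfl (right_le η),
    sup_eq_right.mpr (right_le η), sup_eq_left.mpr (left_le θ)]

lemma val_hh {f f' : a ⟶ b} {g g' : b ⟶ c} (η : f ⟶ f') (θ : g ⟶ g') :
    val (hh η θ) = Ptn.comp (val η) (val θ) := by
  rw [hh_eq_hc, val_hc]

/-- The action of `⋆` on 1-morphisms. -/
def starB (f : a ⟶ b) : b ⟶ a := Mor1.mk (perm f)⁻¹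

lemma perm_starB (f : a ⟶ b) : perm (starB f) = (perm f)⁻¹ := rfl

/-- The action of `⋆` on 2-morphisms. -/
def mapB {f g : a ⟶ b} (η : f ⟶ g) : starB g ⟶ starB f :=
  Mor2.mk (Ptn.mirror (val η)) (Mor2.propagating η).mirror
    ((mirror_ofPerm (perm g)).symm.le.trans (mirror_mono (right_le η)))
    ((mirror_ofPerm (perm f)).symm.le.trans (mirror_mono (left_le η)))

lemma val_mapB {f g : a ⟶ b} (η : f ⟶ g) : val (mapB η) = Ptn.mirror (val η) := rfl

/-- The underlying partition is that of the source. -/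
def IsFull {f g : a ⟶ b} (η : f ⟶ g) : Prop := val η = ofPerm (perm f)

lemma IsFull.perm_eq {f g : a ⟶ b} {η : f ⟶ g} (h : IsFull η) : perm f = perm g :=
  Equiv.ext fun x => (ofPerm_le_iff _ _).mp ((right_le η).trans (le_of_eq h)) x

/-- As for relations, fullness determines a 2-morphism, so laws between structural 2-morphisms need
no computation. -/
lemma IsFull.eq {f g : a ⟶ b} {η θ : f ⟶ g} (h : IsFull η) (h' : IsFull θ) : η = θ :=
  ext_val (Eq.trans h (Eq.symm h'))

lemma isFull_isoOfEq {f g : a ⟶ b} (h : perm f = perm g) : IsFull (isoOfEq h).hom := rfl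

lemma isFull_isoOfEq_inv {f g : a ⟶ b} (h : perm f = perm g) : IsFull (isoOfEq h).inv :=
  congrArg ofPerm h

lemma isFull_id (f : a ⟶ b) : IsFull (𝟙 f) := rfl

lemma IsFull.val_comp_left {f g h : a ⟶ b} {η : f ⟶ g} (hη : IsFull η) (θ : g ⟶ h) :
    val (η ≫ θ) = val θ := by
  rw [val_comp, hη, hη.perm_eq, sup_eq_left.mpr (left_le θ)]

lemma IsFull.val_comp_right {f g h : a ⟶ b} {θ : g ⟶ h} (hθ : IsFull θ) (η : f ⟶ g) :
    val (η ≫ θ) = val η := by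
  rw [val_comp, hθ, sup_eq_right.mpr (right_le η)]

lemma IsFull.comp {f g h : a ⟶ b} {η : f ⟶ g} {θ : g ⟶ h} (h1 : IsFull η) (h2 : IsFull θ) :
    IsFull (η ≫ θ) := (h2.val_comp_right η).trans h1

lemma IsFull.hh {f f' : a ⟶ b} {g g' : b ⟶ c} {η : f ⟶ f'} {θ : g ⟶ g'} (h1 : IsFull η)
    (h2 : IsFull θ) : IsFull (hh η θ) := by
  rw [IsFull, val_hh, h1, h2, ofPerm_comp_ofPerm, perm_comp]

lemma IsFull.map {f g : a ⟶ b} {η : f ⟶ g} (h : IsFull η) : IsFull (mapB η) := by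
  rw [IsFull, val_mapB, h, mirror_ofPerm, perm_starB, h.perm_eq]

/-- Compatibility of `⋆` with composition. -/
def mulB (f : a ⟶ b) (g : b ⟶ c) : starB g ≫ starB f ≅ starB (f ≫ g) :=
  isoOfEq (mul_inv_rev (perm g) (perm f)).symm

/-- Compatibility of `⋆` with identities. -/
def unitB (a : BCat n) : 𝟙 a ≅ starB (𝟙 a) := isoOfEq inv_one.symm

/-- The isomorphism from a 1-morphism to its double dual. -/
def invB (f : a ⟶ b) : f ≅ starB (starB f) := isoOfEq (inv_inv (perm f)).symm

/-- The unit of the adjunction. -/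
def coevB (f : a ⟶ b) : 𝟙 a ⟶ f ≫ starB f := (isoOfEq (inv_mul_cancel (perm f)).symm).hom

/-- The counit of the adjunction. -/
def evB (f : a ⟶ b) : starB f ≫ f ⟶ 𝟙 b :=
  (isoOfEq (f := starB f ≫ f) (g := 𝟙 b) (mul_inv_cancel (perm f))).hom

lemma isFull_mulB (f : a ⟶ b) (g : b ⟶ c) : IsFull (mulB f g).hom := isFull_isoOfEq _
lemma isFull_unitB (a : BCat n) : IsFull (unitB a).hom := isFull_isoOfEq _
lemma isFull_invB (f : a ⟶ b) : IsFull (invB f).hom := isFull_isoOfEq _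
lemma isFull_coevB (f : a ⟶ b) : IsFull (coevB f) := isFull_isoOfEq _
lemma isFull_evB (f : a ⟶ b) : IsFull (evB f) := isFull_isoOfEq _
lemma isFull_associator (f : a ⟶ b) (g : b ⟶ c) (h : c ⟶ d) : IsFull (α_ f g h).hom :=
  rfl
lemma isFull_associator_inv (f : a ⟶ b) (g : b ⟶ c) (h : c ⟶ d) : IsFull (α_ f g h).inv :=
  isFull_isoOfEq_inv (f := (f ≫ g) ≫ h) (g := f ≫ g ≫ h) (mul_assoc _ _ _).symm
lemma isFull_leftUnitor (f : a ⟶ b) : IsFull (λ_ f).hom := rfl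
lemma isFull_rightUnitor (f : a ⟶ b) : IsFull (ρ_ f).hom := rfl

/-- The duality structure given by inversion of permutations and interchanging the two copies of
`Fin n`. -/
def duality (n : ℕ) : Duality (BCat n) where
  star := starB
  map := mapB
  map_id f := (isFull_id f).map.eq (isFull_id _)
  map_comp η θ := ext_val <| by
    rw [val_mapB, val_comp, val_comp, mirror_sup, val_mapB, val_mapB, sup_comm]
  mul := mulB
  unit := unitB
  mul_hh {a b c f f' g g'} η θ := ext_val <| by
    rw [(isFull_mulB f' g').val_comp_left, (isFull_mulB f g).val_comp_right, val_mapB, val_hh,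
      val_hh, mirror_comp, val_mapB, val_mapB]
  mul_assoc f g h := (((isFull_mulB g h).hh (isFull_id _)).comp
    ((isFull_mulB f _).comp (isFull_associator f g h).map)).eq
    ((isFull_associator _ _ _).comp (((isFull_id _).hh (isFull_mulB f g)).comp (isFull_mulB _ h)))
  unit_mul {a _} f := (((isFull_id _).hh (isFull_unitB a)).comp (isFull_mulB _ f)).eq
    ((isFull_rightUnitor _).comp (isFull_leftUnitor f).map)
  mul_unit {_ b} f := (((isFull_unitB b).hh (isFull_id _)).comp (isFull_mulB f _)).eq
    ((isFull_leftUnitor _).comp (isFull_rightUnitor f).map)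
  inv := invB
  inv_naturality {_ _ f g} η := ext_val <| by
    rw [(isFull_invB g).val_comp_right, (isFull_invB f).val_comp_left, val_mapB, val_mapB,
      mirror_mirror]
  inv_mul f g := (((isFull_invB f).hh (isFull_invB g)).comp (isFull_mulB _ _)).eq
    ((isFull_invB _).comp (isFull_mulB f g).map)
  inv_unit a := (isFull_unitB a).eq ((isFull_invB _).comp (isFull_unitB a).map)
  coev := coevB
  ev := evB
  left_triangle f := (((isFull_coevB f).hh (isFull_id f)).comp ((isFull_associator _ _ _).comp
    (((isFull_id f).hh (isFull_evB f)).comp (isFull_rightUnitor f)))).eq (isFull_leftUnitor f)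
  right_triangle f := (((isFull_id _).hh (isFull_coevB f)).comp
    ((isFull_associator_inv _ _ _).comp
    (((isFull_evB f).hh (isFull_id _)).comp (isFull_leftUnitor _)))).eq (isFull_rightUnitor _)
  coev_nat {_ _ f g} η := ext_val <| by
    rw [(isFull_coevB f).val_comp_left, (isFull_coevB g).val_comp_left, val_hh, val_hh, val_id,
      val_id, val_mapB, comp_ofPerm, ofPerm_comp]
    -- Composition with a permutation is a relabelling, so both sides are pullbacks of `val η`. The
    -- relabellings differ by moving upper points along `g` and lower points along `f`, and `val η`
    -- is coarser than both permutations.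
    refine comap_eq_of_forall (ψ := Sum.swap ∘ Sum.map (perm g) id) (val η) ?_
    rintro (x | x)
    · exact (ofPerm_le_iff _ _).mp (right_le η) x
    · exact Setoid.symm' _ ((ofPerm_le_iff _ _).mp (left_le η) x)
  ev_nat {_ _ f g} η := ext_val <| by
    rw [(isFull_evB f).val_comp_right, (isFull_evB g).val_comp_right, val_hh, val_hh, val_id,
      val_id, val_mapB, comp_ofPerm, ofPerm_comp]
    refine comap_eq_of_forall (ψ := Sum.swap ∘ Sum.map id (perm f).symm) (val η) ?_
    rintro (x | x)
    · have := (ofPerm_le_iff _ _).mp (right_le η) ((perm g).symm x)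
      rwa [Equiv.apply_symm_apply] at this
    · have := (ofPerm_le_iff _ _).mp (left_le η) ((perm f).symm x)
      rw [Equiv.apply_symm_apply] at this
      exact Setoid.symm' _ this
  map_unit {a} e := ext_val <| by
    rw [(isFull_unitB a).val_comp_left, (isFull_unitB a).val_comp_right, val_mapB]
    -- A partition coarser than the identity relates each point to its copy in the other row, so
    -- exchanging the rows does not change it.
    refine comap_eq_of_forall (ψ := id) (val e) ?_
    have h := (ofPerm_le_iff _ _).mp (left_le e)
    rintro (x | x)
    · exact Setoid.symm' _ (h x)
    · exact h x

end BCat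

end TwoCat
end

/-! ### Assembling the four constructions -/

theorem theorem4p1 (k : Type*) [Field k] (n : ℕ) (hn : 1 ≤ n) :
    (TwoCat.IsFiat k (TwoCat.SplitBicat (TwoCat.Finitarization k (TwoCat.ACat n))) ∧
      TwoCat.IsFiat k (TwoCat.SplitBicat (TwoCat.Finitarization k (TwoCat.BCat n)))) ∧
    (TwoCat.IsFinitary k (TwoCat.Finitarization k (TwoCat.OrdCat (TwoCat.IS n))) ∧
      ¬ TwoCat.IsFiat k (TwoCat.Finitarization k (TwoCat.OrdCat (TwoCat.IS n)))) ∧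
    (TwoCat.IsFinitary k (TwoCat.Finitarization k (TwoCat.OrdCat (TwoCat.Fstar n))) ∧
      (2 ≤ n → ¬ TwoCat.IsFiat k (TwoCat.Finitarization k (TwoCat.OrdCat (TwoCat.Fstar n))))) := by
  refine ⟨⟨?_, ?_⟩, ⟨TwoCat.OrdCat.isFinitary k, TwoCat.IS.not_isFiat k hn⟩,
    TwoCat.OrdCat.isFinitary k, fun h => TwoCat.Fstar.not_isFiat k h⟩
  · exact (TwoCat.SplitBicat.duality (TwoCat.KarBicat.duality (TwoCat.MatBicat.duality
      (TwoCat.LinBicat.duality (TwoCat.ACat.duality n))))).isFiat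
        (TwoCat.SplitBicat.isFinitary k (TwoCat.isPrefinitary_finitarization k (TwoCat.ACat n)))
  · exact (TwoCat.SplitBicat.duality (TwoCat.KarBicat.duality (TwoCat.MatBicat.duality
      (TwoCat.LinBicat.duality (TwoCat.BCat.duality n))))).isFiat
        (TwoCat.SplitBicat.isFinitary k (TwoCat.isPrefinitary_finitarization k (TwoCat.BCat n)))
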